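/- **Setting.** Let $d\ge 2$. A set $\mathcal S\subset\mathbb R^d$ is a *Lipschitz hypersurface in graph representation* if every $x\in\mathcal S$ has an open neighbourhood $V$ for which there are *Lipschitz-graph coordinates* $(\mathrm g,U)$: $U\subset\mathbb R^{d-1}$ is open and $\mathrm g:U\to\mathcal S\cap V$ is a bijection of the form $\mathrm g(y)=Q(y,h(y))^T+x^*$ with $Q$ orthogonal, $x^*\in\mathbb R^d$ and $h:U\to\mathbb R$ Lipschitz. A point $x=\mathrm g(y)$ at which such $\mathrm g$ is differentiable at $y$ is *regular* ($\mathcal H_{d-1}$-almost every point is), with tangent space $T_x\mathcal S=\mathrm g'(y)\mathbb R^{d-1}$ and surface gradient $\nabla_{\mathcal S}u(x)=\sum_{i,j}\mathrm g^{ij}(y)\,\partial_j(u\circ \mathrm g)(y)\,\partial_i\mathrm g(y)$, where $(\mathrm g^{ij})$ is the inverse of the metric tensor $((\partial_i \mathrm g,\partial_j \mathrm g))_{ij}$. A set $\mathcal S$ is a *$(d-1)$-dimensional Lipschitz submanifold* if every $x\in\mathcal S$ has an open neighbourhood $V$ and a bi-Lipschitz $\varphi:V\to\mathbb R^d$ with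 $\varphi(\mathcal S\cap V)=]0,1[^{d-1}\times\{0\}$. *Geometry.* $\Omega\subset\mathbb R^d$ is a bounded domain whose boundary is a disjoint union $\partial\Omega=\Gamma_D\,\dot\cup\,\Gamma_N\,\dot\cup\,\Gamma_{\rm d}$ with $\Gamma_D$ closed; $\Gamma_{\rm d}\subset\partial\Omega$ and $\Sigma\subset\Omega$ are Lipschitz hypersurfaces in graph representation; $\Gamma_N$ is a $(d-1)$-dimensional Lipschitz submanifold; each of $\overline{\Gamma_N}$, $\overline{\Gamma_{\rm d}}$, $\overline\Sigma$ is contained in a $(d-1)$-dimensional Lipschitz submanifold; and every $x\in\overline{\Gamma_N}\cap\overline{\Gamma_{\rm d}}$ has a neighbourhood $V$ such that $(\overline{\Gamma_N}\cup\overline{\Gamma_{\rm d}})\cap V$ is contained in a $(d-1)$-dimensional Lipschitz submanifold. Any of $\Gamma_D,\Gamma_N,\Gamma_{\rm d},\Sigma$ may be empty. *Coefficients.* $\mu_\Omega:\Omega\to\mathbb R^{d\times d}$ is measurable, bounded and uniformly elliptic: $(\mu_\Omega(x)\xi,\xi)\ge m|\xi|^2$ for all $x\in\Omega$, $\xi\in\mathbb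 R^d$, with some $m>0$. For $\mathcal S\in\{\Gamma_{\rm d},\Sigma\}$, $\mu_{\mathcal S}:\mathcal S\to\mathbb R^{d\times d}$ is measurable and there are a measurable, bounded, nonnegative $\mu_{\mathcal S}^*:\mathcal S\to\mathbb R$ and $c_1,c_2>0$ with $\|\mu_{\mathcal S}(x)\|\le c_2\mu^*_{\mathcal S}(x)$ for $x\in\mathcal S$ and $(\mu_{\mathcal S}(x)\xi,\xi)\ge c_1\mu^*_{\mathcal S}(x)|\xi|^2$ for regular $x\in\mathcal S$ and $\xi\in T_x\mathcal S$. *Spaces and form.* Let $C_D^\infty(\Omega)=\{u|_\Omega: u\in C_c^\infty(\mathbb R^d;\mathbb C),\ \operatorname{supp}u\cap\Gamma_D=\emptyset\}$, let $\mathrm{dom}(\mathfrak t)$ be its completion with respect to $$\|u\|_{\mathrm{dom}(\mathfrak t)}^2=\|u\|_{L^2(\Omega)}^2+\|\nabla u\|_{L^2(\Omega)}^2+\int_{\Gamma_{\rm d}}|\nabla_{\Gamma_{\rm d}}u|^2\mu^*_{\Gamma_{\rm d}}\,d\mathcal H_{d-1}+\int_\Sigma|\nabla_\Sigma u|^2\mu_\Sigma^*\,d\mathcal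 H_{d-1},$$ let $\mathbb L^2=L^2\big((\Omega\setminus\Sigma)\cup\Gamma_{\rm d}\cup\Sigma,\ dx+\mathcal H_{d-1}\big)\cong L^2(\Omega\setminus\Sigma)\oplus L^2(\Gamma_{\rm d})\oplus L^2(\Sigma)$ (complex valued), and $$\mathfrak t(u,v)=\int_\Omega(\mu_\Omega\nabla u,\overline{\nabla v})\,dx+\int_{\Gamma_{\rm d}}(\mu_{\Gamma_{\rm d}}\nabla_{\Gamma_{\rm d}}u,\overline{\nabla_{\Gamma_{\rm d}}v})\,d\mathcal H_{d-1}+\int_\Sigma(\mu_\Sigma\nabla_\Sigma u,\overline{\nabla_\Sigma v})\,d\mathcal H_{d-1}.$$ **Proposition.** The map $u\mapsto(u,u|_{\Gamma_{\rm d}},u|_\Sigma)$, $u\in C_D^\infty(\Omega)$, extends to a continuous linear map $\mathfrak J:\mathrm{dom}(\mathfrak t)\to\mathbb L^2$, which is compact and has dense range. The form $\mathfrak t$ is continuous on $\mathrm{dom}(\mathfrak t)$ and $\mathfrak J$-elliptic: there is $c>0$ with $\operatorname{Re}\mathfrak t(u,u)+\|\mathfrak Ju\|^2_{\mathbb L^2}\ge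 c\|u\|^2_{\mathrm{dom}(\mathfrak t)}$ for all $u\in\mathrm{dom}(\mathfrak t)$. There is a closed, densely defined operator $A_2$ on $\mathbb L^2$ associated with $\mathfrak t$: for $\varphi,\psi\in\mathbb L^2$ one has $\varphi\in\mathrm{dom}(A_2)$ and $A_2\varphi=\psi$ if and only if there is $u\in\mathrm{dom}(\mathfrak t)$ with $\varphi=\mathfrak Ju$ and $$(\psi,\mathfrak Jv)_{\mathbb L^2}=\mathfrak t(u,v)\qquad\text{for all }v\in\mathrm{dom}(\mathfrak t).$$ The operator $-A_2$ generates an analytic $C_0$-semigroup $(T_2(t))_{t\ge0}$ of contractions on $\mathbb L^2$, and $A_2$ has compact resolvent. -/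

import Mathlib

open MeasureTheory Set Filter Topology
open scoped ContDiff NNReal ENNReal

namespace DynBC

noncomputable section

/-- The space `ℝ^d` with `d = n + 1`. -/
abbrev Rd (n : ℕ) : Type := EuclideanSpace ℝ (Fin (n + 1))

/-- The parameter space `ℝ^(d-1)`, `d = n + 1`. -/
abbrev Rp (n : ℕ) : Type := EuclideanSpace ℝ (Fin n)

/-- The space `ℂ^d` with `d = n + 1`. -/
abbrev Cd (n : ℕ) : Type := EuclideanSpace ℂ (Fin (n + 1))

/-- The `(d-1)`-dimensional Hausdorff measure on `ℝ^d`, `d = n + 1`, in its usual normalization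
(it agrees with Lebesgue measure on `(d-1)`-dimensional planes). -/
abbrev surfaceMeasure (n : ℕ) : Measure (Rd n) := Measure.euclideanHausdorffMeasure n

/-! ### Lipschitz hypersurfaces and the surface gradient -/

/-- Lipschitz-graph coordinates for a set `S ⊆ ℝ^d`: an open `U ⊆ ℝ^(d-1)`, an open `V ⊆ ℝ^d` and
a bijection `U → S ∩ V` of the form `y ↦ Q (y, h y) + x₀` with `Q` orthogonal, `h` Lipschitz. -/
structure GraphChart {n : ℕ} (S : Set (Rd n)) where
  U : Set (Rp n)
  V : Set (Rd n)
  Q : Rd n ≃ₗᵢ[ℝ] Rd n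
  x₀ : Rd n
  h : Rp n → ℝ
  isOpen_U : IsOpen U
  isOpen_V : IsOpen V
  lipschitz : ∃ K : ℝ≥0, LipschitzOnWith K h U
  bijOn : BijOn (fun y : Rp n => Q (WithLp.toLp 2 (Fin.snoc (fun i => y i) (h y))) + x₀) U (S ∩ V)

/-- The coordinate map `g` of Lipschitz-graph coordinates. -/
def GraphChart.map {n : ℕ} {S : Set (Rd n)} (c : GraphChart S) (y : Rp n) : Rd n :=
  c.Q (WithLp.toLp 2 (Fin.snoc (fun i => y i) (c.h y))) + c.x₀

/-- `c` is a regular chart for `x`, and `y` is the parameter of `x`. -/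
def GraphChart.RegularAt {n : ℕ} {S : Set (Rd n)} (c : GraphChart S) (y : Rp n) (x : Rd n) : Prop :=
  y ∈ c.U ∧ c.map y = x ∧ DifferentiableAt ℝ c.map y

/-- `S` is a Lipschitz hypersurface in graph representation. -/
def IsLipschitzHypersurface {n : ℕ} (S : Set (Rd n)) : Prop :=
  ∀ x ∈ S, ∃ c : GraphChart S, x ∈ c.V

/-- `S` is a `(d-1)`-dimensional Lipschitz submanifold of `ℝ^d`: near each of its points a
bi-Lipschitz map of an open neighbourhood flattens it to `]0,1[^(d-1) × {0}`.
(The image of `V` is open automatically, by invariance of domain.) -/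
def IsLipschitzSubmanifold {n : ℕ} (S : Set (Rd n)) : Prop :=
  ∀ x ∈ S, ∃ (V : Set (Rd n)) (φ : Rd n → Rd n) (K : ℝ≥0),
    IsOpen V ∧ x ∈ V ∧ IsOpen (φ '' V) ∧ LipschitzOnWith K φ V ∧
    (∀ p ∈ V, ∀ q ∈ V, dist p q ≤ K * dist (φ p) (φ q)) ∧
    φ '' (S ∩ V) = {z | z (Fin.last n) = 0 ∧ ∀ i : Fin n, z i.castSucc ∈ Ioo (0 : ℝ) 1}

/-- The partial derivative `∂ᵢ g (y)` of the coordinate map. -/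
def GraphChart.partialMap {n : ℕ} {S : Set (Rd n)} (c : GraphChart S) (y : Rp n) (i : Fin n) :
    Rd n :=
  fderiv ℝ c.map y (EuclideanSpace.single i 1)

/-- The metric tensor `G(y) = ((∂ᵢ g(y), ∂ⱼ g(y)))ᵢⱼ`. -/
def GraphChart.metricTensor {n : ℕ} {S : Set (Rd n)} (c : GraphChart S) (y : Rp n) :
    Matrix (Fin n) (Fin n) ℝ :=
  Matrix.of fun i j => inner ℝ (c.partialMap y i) (c.partialMap y j)

/-- The surface gradient in coordinates, `∑ᵢⱼ gⁱʲ(y) ∂ⱼ(u ∘ g)(y) ∂ᵢ g(y)`. -/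
def GraphChart.surfaceGrad {n : ℕ} {S : Set (Rd n)} (c : GraphChart S) (u : Rd n → ℂ) (y : Rp n) :
    Cd n :=
  WithLp.toLp 2 fun k => ∑ i, ∑ j,
    (((c.metricTensor y)⁻¹ i j : ℝ) : ℂ) *
      fderiv ℝ (u ∘ c.map) y (EuclideanSpace.single j 1) * ((c.partialMap y i k : ℝ) : ℂ)

open Classical in
/-- The surface gradient `∇_S u (x)` at a regular point `x` of `S` (it does not depend on the
regular coordinates); it is set to zero at the (negligible) non-regular points. -/
def surfaceGrad {n : ℕ} (S : Set (Rd n)) (u : Rd n → ℂ) (x : Rd n) : Cd n :=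
  if H : ∃ p : GraphChart S × Rp n, p.1.RegularAt p.2 x then
    H.choose.1.surfaceGrad u H.choose.2
  else 0

/-- `ξ` belongs to the tangent space `T_x S` at the regular point `x`. -/
def IsTangent {n : ℕ} (S : Set (Rd n)) (x ξ : Rd n) : Prop :=
  ∃ (c : GraphChart S) (y η : Rp n), c.RegularAt y x ∧ ξ = fderiv ℝ c.map y η

/-! ### Data and standing assumptions -/

/-- The geometric data and the diffusion coefficients. The coefficients matter only on `Ω`, on the
dynamic boundary part `Γd` and on the interface `Sg` (that is, `Σ`), respectively. -/
structure Data (n : ℕ) where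
  Ω : Set (Rd n)
  ΓD : Set (Rd n)
  ΓN : Set (Rd n)
  Γd : Set (Rd n)
  Sg : Set (Rd n)
  μΩ : Rd n → Matrix (Fin (n + 1)) (Fin (n + 1)) ℝ
  μd : Rd n → Matrix (Fin (n + 1)) (Fin (n + 1)) ℝ
  μS : Rd n → Matrix (Fin (n + 1)) (Fin (n + 1)) ℝ
  /-- the weight for `Γd` -/
  wd : Rd n → ℝ
  /-- the weight for `Σ` -/
  wS : Rd n → ℝ

/-- The assumptions on the geometry. -/
structure Data.Geometric {n : ℕ} (D : Data n) : Prop where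
  isOpen : IsOpen D.Ω
  isConnected : IsConnected D.Ω
  isBounded : Bornology.IsBounded D.Ω
  frontier_eq : frontier D.Ω = D.ΓD ∪ D.ΓN ∪ D.Γd
  disjoint_DN : Disjoint D.ΓD D.ΓN
  disjoint_Dd : Disjoint D.ΓD D.Γd
  disjoint_Nd : Disjoint D.ΓN D.Γd
  isClosed_D : IsClosed D.ΓD
  interface_subset : D.Sg ⊆ D.Ω
  hypersurface_d : IsLipschitzHypersurface D.Γd
  hypersurface_S : IsLipschitzHypersurface D.Sg
  submanifold_N : IsLipschitzSubmanifold D.ΓN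
  closure_N : ∃ M, IsLipschitzSubmanifold M ∧ closure D.ΓN ⊆ M
  closure_d : ∃ M, IsLipschitzSubmanifold M ∧ closure D.Γd ⊆ M
  closure_S : ∃ M, IsLipschitzSubmanifold M ∧ closure D.Sg ⊆ M
  /-- Where the Neumann part and the dynamic part meet, they lie locally in one common Lipschitz
  submanifold (so they do not form cusps with each other). -/
  meeting : ∀ x ∈ closure D.ΓN ∩ closure D.Γd, ∃ V ∈ 𝓝 x, ∃ M, IsLipschitzSubmanifold M ∧
    (closure D.ΓN ∪ closure D.Γd) ∩ V ⊆ M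

/-- The operator norm of a matrix with respect to the Euclidean norm. -/
def opNorm {n : ℕ} (B : Matrix (Fin (n + 1)) (Fin (n + 1)) ℝ) : ℝ :=
  ‖Matrix.toEuclideanCLM (n := Fin (n + 1)) (𝕜 := ℝ) B‖

/-- The number `(B ξ, ξ)` for `ξ ∈ ℝ^d`. -/
def quad {n : ℕ} (B : Matrix (Fin (n + 1)) (Fin (n + 1)) ℝ) (ξ : Rd n) : ℝ :=
  inner ℝ (Matrix.toEuclideanLin B ξ) ξ

/-- The assumption on the bulk coefficient: measurable, bounded and uniformly elliptic. -/
def BulkCoefficient {n : ℕ} (Ω : Set (Rd n)) (μ : Rd n → Matrix (Fin (n + 1)) (Fin (n + 1)) ℝ) :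
    Prop :=
  (∀ i j, AEMeasurable (fun x => μ x i j) (volume.restrict Ω)) ∧
  (∃ C : ℝ, ∀ x ∈ Ω, opNorm (μ x) ≤ C) ∧
  ∃ m : ℝ, 0 < m ∧ ∀ x ∈ Ω, ∀ ξ : Rd n, m * ‖ξ‖ ^ 2 ≤ quad (μ x) ξ

/-- The assumption on a surface coefficient: it is measurable and comparable on the tangent spaces
to a measurable, bounded, nonnegative weight `w`, which may vanish anywhere. -/
def SurfaceCoefficient {n : ℕ} (S : Set (Rd n))
    (μ : Rd n → Matrix (Fin (n + 1)) (Fin (n + 1)) ℝ) (w : Rd n → ℝ) : Prop :=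
  (∀ i j, AEMeasurable (fun x => μ x i j) ((surfaceMeasure n).restrict S)) ∧
  AEMeasurable w ((surfaceMeasure n).restrict S) ∧
  (∃ C : ℝ, ∀ x ∈ S, w x ≤ C) ∧ (∀ x ∈ S, 0 ≤ w x) ∧
  ∃ c₁ c₂ : ℝ, 0 < c₁ ∧ 0 < c₂ ∧
    (∀ x ∈ S, ∀ ξ, IsTangent S x ξ → c₁ * w x * ‖ξ‖ ^ 2 ≤ quad (μ x) ξ) ∧
    (∀ x ∈ S, opNorm (μ x) ≤ c₂ * w x)

/-- The assumptions on the coefficients. -/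
structure Data.Coefficients {n : ℕ} (D : Data n) : Prop where
  bulk : BulkCoefficient D.Ω D.μΩ
  boundary : SurfaceCoefficient D.Γd D.μd D.wd
  interface : SurfaceCoefficient D.Sg D.μS D.wS

/-! ### The space `dom(t)`, the space `L²` and the form -/

/-- `u` is (the smooth extension to `ℝ^d` of) an element of `C_D^∞(Ω)`. -/
structure IsTest {n : ℕ} (ΓD : Set (Rd n)) (u : Rd n → ℂ) : Prop where
  smooth : ContDiff ℝ ∞ u
  compact : HasCompactSupport u
  disjoint : Disjoint (tsupport u) ΓD

/-- The gradient of a complex valued function on `ℝ^d`. -/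
def grad {n : ℕ} (u : Rd n → ℂ) (x : Rd n) : Cd n :=
  WithLp.toLp 2 fun i => fderiv ℝ u x (EuclideanSpace.single i 1)

/-- The weighted surface measure `w dH_{d-1}` on `S`. -/
abbrev weighted {n : ℕ} (S : Set (Rd n)) (w : Rd n → ℝ) : Measure (Rd n) :=
  ((surfaceMeasure n).restrict S).withDensity fun x => ENNReal.ofReal (w x)

/-- The Hilbert space `(L²(Ω) ⊕ L²(Ω; ℂ^d)) ⊕ (L²(Γd, wd; ℂ^d) ⊕ L²(Σ, wS; ℂ^d))`. -/
abbrev Data.Ambient {n : ℕ} (D : Data n) : Type :=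
  WithLp 2
    (WithLp 2 (Lp ℂ 2 (volume.restrict D.Ω) × Lp (Cd n) 2 (volume.restrict D.Ω)) ×
      WithLp 2 (Lp (Cd n) 2 (weighted D.Γd D.wd) × Lp (Cd n) 2 (weighted D.Sg D.wS)))

/-- `w` is the quadruple `(u, ∇u, ∇_{Γd} u, ∇_Σ u)`. The norm of the ambient space
is the norm of `dom(t)` for such quadruples. -/
def Data.Represents {n : ℕ} (D : Data n) (w : D.Ambient) (u : Rd n → ℂ) : Prop :=
  w.fst.fst =ᵐ[volume.restrict D.Ω] u ∧
  w.fst.snd =ᵐ[volume.restrict D.Ω] grad u ∧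
  w.snd.fst =ᵐ[weighted D.Γd D.wd] surfaceGrad D.Γd u ∧
  w.snd.snd =ᵐ[weighted D.Sg D.wS] surfaceGrad D.Sg u

theorem IsTest.add {n : ℕ} {ΓD : Set (Rd n)} {u v : Rd n → ℂ} (hu : IsTest ΓD u)
    (hv : IsTest ΓD v) : IsTest ΓD (u + v) :=
  ⟨hu.smooth.add hv.smooth, hu.compact.add hv.compact,
    (hu.disjoint.union_left hv.disjoint).mono_left (tsupport_add u v)⟩

theorem IsTest.smul {n : ℕ} {ΓD : Set (Rd n)} {u : Rd n → ℂ} (a : ℂ) (hu : IsTest ΓD u) :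
    IsTest ΓD (a • u) :=
  ⟨hu.smooth.const_smul a, hu.compact.smul_left (f := fun _ => a),
    hu.disjoint.mono_left (tsupport_smul_subset_right (fun _ => a) u)⟩

theorem IsTest.zero {n : ℕ} (ΓD : Set (Rd n)) : IsTest ΓD (0 : Rd n → ℂ) :=
  ⟨contDiff_const, HasCompactSupport.zero, by simp [tsupport]⟩

theorem IsTest.differentiable {n : ℕ} {ΓD : Set (Rd n)} {u : Rd n → ℂ} (hu : IsTest ΓD u) :
    Differentiable ℝ u :=
  hu.smooth.differentiable (by simp)

theorem grad_add {n : ℕ} {u v : Rd n → ℂ} (hu : Differentiable ℝ u) (hv : Differentiable ℝ v) :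
    grad (u + v) = grad u + grad v := by
  ext x i
  simp [grad, fderiv_add (hu x) (hv x)]

theorem grad_smul {n : ℕ} {u : Rd n → ℂ} (a : ℂ) (hu : Differentiable ℝ u) :
    grad (a • u) = a • grad u := by
  ext x i
  simp [grad, fderiv_const_smul (hu x) a]

theorem surfaceGrad_add {n : ℕ} (S : Set (Rd n)) {u v : Rd n → ℂ} (hu : Differentiable ℝ u)
    (hv : Differentiable ℝ v) : surfaceGrad S (u + v) = surfaceGrad S u + surfaceGrad S v := by
  funext x
  by_cases H : ∃ p : GraphChart S × Rp n, p.1.RegularAt p.2 x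
  · have hd := H.choose_spec.2.2
    have h1 := (hu (H.choose.1.map H.choose.2)).comp H.choose.2 hd
    have h2 := (hv (H.choose.1.map H.choose.2)).comp H.choose.2 hd
    simp only [surfaceGrad, dif_pos H, Pi.add_apply, GraphChart.surfaceGrad]
    ext k
    have e : (u + v) ∘ H.choose.1.map = u ∘ H.choose.1.map + v ∘ H.choose.1.map := rfl
    simp only [e, fderiv_add h1 h2, PiLp.add_apply, ← Finset.sum_add_distrib]
    refine Finset.sum_congr rfl fun i _ => Finset.sum_congr rfl fun j _ => ?_
    simp only [add_apply]
    ring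
  · simp [surfaceGrad, dif_neg H]

theorem surfaceGrad_smul {n : ℕ} (S : Set (Rd n)) {u : Rd n → ℂ} (a : ℂ)
    (hu : Differentiable ℝ u) : surfaceGrad S (a • u) = a • surfaceGrad S u := by
  funext x
  by_cases H : ∃ p : GraphChart S × Rp n, p.1.RegularAt p.2 x
  · have hd := H.choose_spec.2.2
    have h1 := (hu (H.choose.1.map H.choose.2)).comp H.choose.2 hd
    simp only [surfaceGrad, dif_pos H, Pi.smul_apply, GraphChart.surfaceGrad]
    ext k
    have e : (a • u) ∘ H.choose.1.map = a • (u ∘ H.choose.1.map) := rfl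
    simp only [e, fderiv_const_smul h1 a, PiLp.smul_apply, smul_eq_mul, Finset.mul_sum]
    refine Finset.sum_congr rfl fun i _ => Finset.sum_congr rfl fun j _ => ?_
    simp only [smul_apply, smul_eq_mul]
    ring
  · simp [surfaceGrad, dif_neg H]

/-- The space of the quadruples `(u, ∇u, ∇_{Γd} u, ∇_Σ u)` with `u ∈ C_D^∞(Ω)`: an isometric copy
of `C_D^∞(Ω)` with the scalar product of `dom(t)`. -/
def Data.core {n : ℕ} (D : Data n) : Submodule ℂ D.Ambient where
  carrier := {w | ∃ u, IsTest D.ΓD u ∧ D.Represents w u}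
  add_mem' := by
    rintro w w' ⟨u, hu, h1, h2, h3, h4⟩ ⟨v, hv, k1, k2, k3, k4⟩
    refine ⟨u + v, hu.add hv, ?_, ?_, ?_, ?_⟩
    · exact (Lp.coeFn_add _ _).trans (h1.add k1)
    · rw [grad_add hu.differentiable hv.differentiable]
      exact (Lp.coeFn_add _ _).trans (h2.add k2)
    · rw [surfaceGrad_add _ hu.differentiable hv.differentiable]
      exact (Lp.coeFn_add _ _).trans (h3.add k3)
    · rw [surfaceGrad_add _ hu.differentiable hv.differentiable]
      exact (Lp.coeFn_add _ _).trans (h4.add k4)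
  zero_mem' := by
    have g0 : grad (0 : Rd n → ℂ) = 0 := by
      simpa using grad_smul (n := n) (u := 0) 0 (differentiable_const (0 : ℂ))
    have s0 : ∀ S : Set (Rd n), surfaceGrad S (0 : Rd n → ℂ) = 0 := fun S => by
      simpa using surfaceGrad_smul S (u := 0) 0 (differentiable_const (0 : ℂ))
    refine ⟨0, IsTest.zero _, Lp.coeFn_zero _ _ _, ?_, ?_, ?_⟩
    · rw [g0]; exact Lp.coeFn_zero _ _ _
    · rw [s0]; exact Lp.coeFn_zero _ _ _
    · rw [s0]; exact Lp.coeFn_zero _ _ _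
  smul_mem' := by
    rintro a w ⟨u, hu, h1, h2, h3, h4⟩
    refine ⟨a • u, hu.smul a, ?_, ?_, ?_, ?_⟩
    · exact (Lp.coeFn_smul a _).trans (h1.const_smul a)
    · rw [grad_smul a hu.differentiable]
      exact (Lp.coeFn_smul a _).trans (h2.const_smul a)
    · rw [surfaceGrad_smul _ a hu.differentiable]
      exact (Lp.coeFn_smul a _).trans (h3.const_smul a)
    · rw [surfaceGrad_smul _ a hu.differentiable]
      exact (Lp.coeFn_smul a _).trans (h4.const_smul a)

/-- The Hilbert space `dom(t)`: the completion of `C_D^∞(Ω)` with respect to its norm, realized as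
the closure of the isometric copy of `C_D^∞(Ω)` in a Hilbert space. -/
abbrev Data.FormDomain {n : ℕ} (D : Data n) : Type := D.core.topologicalClosure

/-- The measure `dx + H_{d-1}` on `(Ω \ Σ) ∪ Γd ∪ Σ`. -/
abbrev Data.measure {n : ℕ} (D : Data n) : Measure (Rd n) :=
  volume.restrict (D.Ω \ D.Sg) + (surfaceMeasure n).restrict (D.Γd ∪ D.Sg)

/-- The space `𝕃² = L²((Ω \ Σ) ∪ Γd ∪ Σ, dx + H_{d-1})` of complex valued functions. -/
abbrev Data.L2 {n : ℕ} (D : Data n) : Type := Lp ℂ 2 D.measure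

/-- `(B a, b̄)` for `a, b ∈ ℂ^d` and a real matrix `B`. -/
def pairing {n : ℕ} (B : Matrix (Fin (n + 1)) (Fin (n + 1)) ℝ) (a b : Cd n) : ℂ :=
  ∑ i, ∑ j, (B i j : ℂ) * a j * star (b i)

/-- The sesquilinear form `t`. For the quadruples `(u, ∇u, ∇_{Γd} u, ∇_Σ u)` given by test functions
this is the defining integral formula; on `dom(t)` it is the continuous extension. -/
def Data.form {n : ℕ} (D : Data n) (u v : D.FormDomain) : ℂ :=
  (∫ x in D.Ω, pairing (D.μΩ x) (u.1.fst.snd x) (v.1.fst.snd x)) +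
  (∫ x in D.Γd, pairing (D.μd x) (u.1.snd.fst x) (v.1.snd.fst x) ∂(surfaceMeasure n)) +
  (∫ x in D.Sg, pairing (D.μS x) (u.1.snd.snd x) (v.1.snd.snd x) ∂(surfaceMeasure n))

/-- `J` is the continuous extension to `dom(t)` of the map `u ↦ (u, u|_{Γd}, u|_Σ)` on
`C_D^∞(Ω)`. As an element of `𝕃²` this triple is the class of `u` itself. -/
def Data.IsTraceMap {n : ℕ} (D : Data n) (J : D.FormDomain →L[ℂ] D.L2) : Prop :=
  ∀ u, IsTest D.ΓD u → ∃ w : D.FormDomain, D.Represents w.1 u ∧ J w =ᵐ[D.measure] u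

/-! ### Unbounded operators and semigroups -/

section Operators

variable {H : Type*} [NormedAddCommGroup H] [NormedSpace ℂ H]

/-- `R` is the bounded inverse of `z - A`. -/
def IsResolventAt (A : H →ₗ.[ℂ] H) (z : ℂ) (R : H →L[ℂ] H) : Prop :=
  (∀ ψ, ∃ x : A.domain, (x : H) = R ψ ∧ z • (x : H) - A x = ψ) ∧
  ∀ x : A.domain, R (z • (x : H) - A x) = x

/-- The resolvent set of `A` is non-empty and all resolvents are compact. -/
def HasCompactResolvent (A : H →ₗ.[ℂ] H) : Prop :=
  (∃ z R, IsResolventAt A z R) ∧ ∀ z R, IsResolventAt A z R → IsCompactOperator R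

/-- `(T t)_{t ≥ 0}` is a strongly continuous semigroup. -/
structure IsC0Semigroup (T : ℝ → H →L[ℂ] H) : Prop where
  zero : T 0 = ContinuousLinearMap.id ℂ H
  add : ∀ s t, 0 ≤ s → 0 ≤ t → T (s + t) = (T s).comp (T t)
  tendsto : ∀ φ, Tendsto (fun t => T t φ) (𝓝[>] 0) (𝓝 φ)

/-- The open sector of half-angle `θ` around the positive real axis. -/
def sector (θ : ℝ) : Set ℂ := {z | z ≠ 0 ∧ |z.arg| < θ}

/-- `T` extends to an analytic semigroup on a sector, strongly continuous at zero on each smaller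
sector. -/
def IsAnalyticSemigroup (T : ℝ → H →L[ℂ] H) : Prop :=
  IsC0Semigroup T ∧
  ∃ θ : ℝ, 0 < θ ∧ θ ≤ Real.pi / 2 ∧ ∃ S : ℂ → H →L[ℂ] H,
    (∀ t : ℝ, 0 < t → S t = T t) ∧
    DifferentiableOn ℂ S (sector θ) ∧
    (∀ z ∈ sector θ, ∀ w ∈ sector θ, S (z + w) = (S z).comp (S w)) ∧
    ∀ θ' : ℝ, 0 < θ' → θ' < θ → ∀ φ, Tendsto (fun z => S z φ) (𝓝[sector θ'] 0) (𝓝 φ)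

/-- `B`, with its domain, is the infinitesimal generator of `T`. -/
def IsGenerator (B : H →ₗ.[ℂ] H) (T : ℝ → H →L[ℂ] H) : Prop :=
  ∀ φ ψ, (φ, ψ) ∈ B.graph ↔
    Tendsto (fun t : ℝ => (t : ℂ)⁻¹ • (T t φ - φ)) (𝓝[>] 0) (𝓝 ψ)

end Operators

end

end DynBC

/-! The operator comes from the theory of J-elliptic forms, so the main work is the map J: it must
be bounded, compact and of dense range although Ω need not lie on one side of its boundary.

Geometry: let N be the union of the closures of Γ_N and Γ_d. Off N, the extension by zero of a test
function u is locally smooth or zero, since all other boundary points lie in Γ_D, away from the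
support of u. So |∇u| on Ω, extended by zero, is an upper gradient off N
(`isUpperGradientOn_indicator`). Bi-Lipschitz coordinates put N into a hyperplane (`Flattening`),
and each open half ball is then a convex set free of N. Poincaré's inequality on a fine grid bounds
the L²(Ω) norm by finitely many means plus a small multiple of the gradient norm
(`Data.Geometric.exists_functionals`). For traces on S, a neighbourhood is folded into one side of N
and lifted by ε; the folded segments transversal to S avoid N whatever the relative position of S
and N. The resulting bound is uniform in ε, and Fatou's lemma, with both sides of N taken together,
gives the trace estimate (`IsTraceSet.exists_trace_le`). Both estimates together yield the
continuous extension J and its compactness at once (`exists_compact_extension`). Its range is dense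
by the fundamental lemma of the calculus of variations, because Γ_D is a null set.

Form: the surface gradient is the orthogonal projection of ∇u to the tangent space
(`GraphChart.RegularAt.surfaceGrad_eq`), so surface ellipticity applies to test functions and, by
density, on dom(t). Both Re t(u,u) and |t(u,u)| are comparable to the sum of the squared gradient
norms, so t is sectorial with vertex 0. The missing L²(Ω) norm is contained in ‖Ju‖.

Operator: if L represents t, Lax–Milgram solves (L + aJ*J)u = J*ψ for a ≥ 1, and the resolvents
factor through the compact J (`exists_operator_of_form`). The Yosida approximations commute and keep
the numerical range in the same sector; their exponentials are contractions on a complex sector, and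
the strong limits form the analytic semigroup (`exists_analyticSemigroup`). -/

namespace DynBC

noncomputable section

/-! ### Exponentials of dissipative bounded operators -/

section Exponential

variable {H : Type*} [NormedAddCommGroup H] [InnerProductSpace ℂ H] [CompleteSpace H]

/-- `P` is dissipative. -/
def IsDissipative (P : H →L[ℂ] H) : Prop := ∀ x, (inner ℂ x (P x)).re ≤ 0

theorem IsDissipative.add {P Q : H →L[ℂ] H} (hP : IsDissipative P) (hQ : IsDissipative Q) :
    IsDissipative (P + Q) := fun x => by
  have := hP x
  have := hQ x
  simp only [add_apply, inner_add_right, Complex.add_re]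
  linarith

theorem IsDissipative.smul {P : H →L[ℂ] H} (hP : IsDissipative P) {s : ℝ} (hs : 0 ≤ s) :
    IsDissipative (s • P) := fun x => by
  have e : inner ℂ x ((s • P) x) = (s : ℂ) * inner ℂ x (P x) := by
    rw [_root_.smul_apply, ← Complex.coe_smul, inner_smul_right]
  rw [e, Complex.re_ofReal_mul]
  exact mul_nonpos_of_nonneg_of_nonpos hs (hP x)

theorem hasDerivAt_exp_smul_apply (P : H →L[ℂ] H) (x : H) (t : ℝ) :
    HasDerivAt (fun s : ℝ => NormedSpace.exp (s • P) x) (P (NormedSpace.exp (t • P) x)) t := by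
  have h := hasDerivAt_exp_smul_const' (𝕂 := ℝ) P t
  exact (((ContinuousLinearMap.apply ℂ H x).restrictScalars ℝ).hasFDerivAt.comp_hasDerivAt t h)

/-- Along the orbit y(s) = exp(sP)x the squared norm has derivative 2 Re⟪y, Py⟫ ≤ 0, so it does not
increase from s = 0 to s = 1. -/
theorem IsDissipative.norm_exp_apply_le {P : H →L[ℂ] H} (hP : IsDissipative P) (x : H) :
    ‖NormedSpace.exp P x‖ ≤ ‖x‖ := by
  letI : InnerProductSpace ℝ H := InnerProductSpace.complexToReal
  have hd : ∀ t : ℝ, HasDerivAt (fun s : ℝ => ‖NormedSpace.exp (s • P) x‖ ^ 2)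
      (2 * inner ℝ (NormedSpace.exp (t • P) x) (P (NormedSpace.exp (t • P) x))) t := fun t =>
    (hasDerivAt_exp_smul_apply P x t).norm_sq
  have ha : Antitone fun s : ℝ => ‖NormedSpace.exp (s • P) x‖ ^ 2 := by
    refine antitone_of_deriv_nonpos (fun t => (hd t).differentiableAt) fun t => ?_
    rw [(hd t).deriv]
    have := hP (NormedSpace.exp (t • P) x)
    have e : inner ℝ (NormedSpace.exp (t • P) x) (P (NormedSpace.exp (t • P) x)) =
      (inner ℂ (NormedSpace.exp (t • P) x) (P (NormedSpace.exp (t • P) x))).re := rfl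
    rw [e]
    linarith
  have h := ha (zero_le_one' ℝ)
  simp only [one_smul, zero_smul, NormedSpace.exp_zero, ContinuousLinearMap.one_apply] at h
  exact le_of_sq_le_sq h (norm_nonneg x)

theorem IsDissipative.norm_exp_le {P : H →L[ℂ] H} (hP : IsDissipative P) :
    ‖NormedSpace.exp P‖ ≤ 1 :=
  ContinuousLinearMap.opNorm_le_bound _ zero_le_one fun x => by
    simpa using hP.norm_exp_apply_le x

/-- Comparison of the exponentials of two commuting dissipative operators. -/
theorem norm_exp_sub_exp_apply_le {P Q : H →L[ℂ] H} (hP : IsDissipative P) (hQ : IsDissipative Q)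
    (hc : Commute P Q) (x : H) :
    ‖NormedSpace.exp P x - NormedSpace.exp Q x‖ ≤ ‖P x - Q x‖ := by
  letI : NormedAlgebra ℚ (H →L[ℂ] H) := NormedAlgebra.restrictScalars ℚ ℂ _
  -- This path runs from exp(Q)x to exp(P)x. Since P and Q commute, its derivative is exp(Q + s(P -
  -- Q)) applied to (P - Q)x.
  set f : ℝ → H := fun s => NormedSpace.exp Q (NormedSpace.exp (s • (P - Q)) x) with hf
  have hcomm : ∀ s : ℝ, Commute Q (s • (P - Q)) := fun s =>
    (hc.symm.sub_right (Commute.refl Q)).smul_right s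
  have hd : ∀ s : ℝ, HasDerivAt f
      (NormedSpace.exp (Q + s • (P - Q)) ((P - Q) x)) s := by
    intro s
    have h := hasDerivAt_exp_smul_const (𝕂 := ℝ) (P - Q) s
    have h2 := ((ContinuousLinearMap.apply ℂ H x).restrictScalars ℝ).hasFDerivAt.comp_hasDerivAt s h
    have h3 := (((NormedSpace.exp Q)).restrictScalars ℝ).hasFDerivAt.comp_hasDerivAt s h2
    rw [NormedSpace.exp_add_of_commute (hcomm s)]
    exact h3
  have hb : ∀ s ∈ Ico (0 : ℝ) 1,
      ‖NormedSpace.exp (Q + s • (P - Q)) ((P - Q) x)‖ ≤ ‖P x - Q x‖ := by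
    intro s hs
    -- A convex combination of dissipative operators is dissipative, so the exponential in the
    -- derivative is a contraction.
    have e : Q + s • (P - Q) = s • P + (1 - s) • Q := by
      rw [smul_sub, sub_smul, one_smul]; abel
    rw [e]
    exact ((hP.smul hs.1).add (hQ.smul (by linarith [hs.2]))).norm_exp_apply_le _
  have h := norm_image_sub_le_of_norm_deriv_le_segment_01'
    (fun s _ => (hd s).hasDerivWithinAt) hb
  have e1 : f 1 = NormedSpace.exp P x := by
    have : NormedSpace.exp P = NormedSpace.exp Q * NormedSpace.exp (P - Q) := by
      rw [← NormedSpace.exp_add_of_commute (by simpa using hcomm 1)]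
      congr 1; abel
    rw [this]; simp [hf]
  have e0 : f 0 = NormedSpace.exp Q x := by simp [hf]
  rwa [e1, e0] at h

theorem norm_exp_apply_sub_le {P : H →L[ℂ] H} (hP : IsDissipative P) (x : H) :
    ‖NormedSpace.exp P x - x‖ ≤ ‖P x‖ := by
  have h := norm_exp_sub_exp_apply_le hP (Q := 0) (fun x => by simp) (Commute.zero_right P) x
  simpa [NormedSpace.exp_zero] using h

theorem norm_exp_apply_sub_sub_le (P : H →L[ℂ] H) (x : H) {M : ℝ}
    (hM : ∀ s ∈ Icc (0 : ℝ) 1, ‖NormedSpace.exp (s • P) (P x) - P x‖ ≤ M) :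
    ‖NormedSpace.exp P x - x - P x‖ ≤ M := by
  have hd : ∀ s : ℝ, HasDerivAt (fun s : ℝ => NormedSpace.exp (s • P) x - s • P x)
      (NormedSpace.exp (s • P) (P x) - P x) s := by
    intro s
    have h := hasDerivAt_exp_smul_const (𝕂 := ℝ) P s
    have h2 := ((ContinuousLinearMap.apply ℂ H x).restrictScalars ℝ).hasFDerivAt.comp_hasDerivAt s h
    have h3 := (hasDerivAt_id s).smul_const (P x)
    simp only [one_smul, id] at h3
    exact h2.sub h3
  have h := norm_image_sub_le_of_norm_deriv_le_segment_01'
    (fun s _ => (hd s).hasDerivWithinAt) (fun s hs => hM s ⟨hs.1, hs.2.le⟩)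
  have e : NormedSpace.exp P x - x - P x =
    NormedSpace.exp ((1 : ℝ) • P) x - (1 : ℝ) • P x - (NormedSpace.exp ((0 : ℝ) • P) x -
      (0 : ℝ) • P x) := by
    simp [NormedSpace.exp_zero]; abel
  rw [e]
  exact h

end Exponential

/-- A strong limit of uniformly bounded holomorphic operator functions is differentiable in the
operator norm. -/
theorem differentiableAt_of_tendsto_apply {E F : Type*} [NormedAddCommGroup E] [NormedSpace ℂ E]
    [NormedAddCommGroup F] [NormedSpace ℂ F] [CompleteSpace F]
    {f : ℕ → ℂ → E →L[ℂ] F} {g : ℂ → E →L[ℂ] F} {c : ℂ} {r : ℝ} (hr : 0 < r)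
    (hf : ∀ k, DifferentiableOn ℂ (f k) (Metric.ball c r))
    (hb : ∀ k, ∀ z ∈ Metric.ball c r, ‖f k z‖ ≤ 1)
    (hlim : ∀ z ∈ Metric.ball c r, ∀ x, Tendsto (fun k => f k z x) atTop (𝓝 (g z x))) :
    DifferentiableAt ℂ g c := by
  have hc : c ∈ Metric.ball c r := Metric.mem_ball_self hr
  -- The bound 1 keeps `f k` within distance 2 of its central value. Schwarz's lemma, applied to `f
  -- k` and again to its `dslope`, makes the difference quotients Lipschitz at c uniformly in k.
  have hfst : ∀ k, MapsTo (f k) (Metric.ball c r) (Metric.closedBall (f k c) 2) := fun k z hz => by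
    rw [mem_closedBall_iff_norm]
    linarith [norm_sub_le (f k z) (f k c), hb k z hz, hb k c hc]
  have hsl : ∀ k, ∀ z ∈ Metric.ball c r, ‖dslope (f k) c z‖ ≤ 2 / r := fun k z hz =>
    Complex.norm_dslope_le_div_of_mapsTo_ball (hf k) (hfst k) hz
  have hsnd : ∀ k, MapsTo (dslope (f k) c) (Metric.ball c r)
      (Metric.closedBall (dslope (f k) c c) (4 / r)) := fun k z hz => by
    rw [mem_closedBall_iff_norm]
    have h1 := norm_sub_le (dslope (f k) c z) (dslope (f k) c c)
    have h2 := hsl k z hz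
    have h3 := hsl k c hc
    have : 4 / r = 2 / r + 2 / r := by ring
    linarith
  have hlip : ∀ k, ∀ z ∈ Metric.ball c r,
      dist (dslope (f k) c z) (dslope (f k) c c) ≤ 4 / r / r * dist z c := fun k z hz =>
    Complex.dist_le_div_mul_dist_of_mapsTo_ball
      ((Complex.differentiableOn_dslope (Metric.ball_mem_nhds c hr)).2 (hf k)) (hsnd k) hz
  -- The slopes are compared vector by vector with a constant independent of the vector. This turns
  -- strong convergence into a Cauchy estimate in operator norm.
  have key : ∀ z ∈ Metric.ball c r, z ≠ c → ∀ w ∈ Metric.ball c r, w ≠ c →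
      dist (slope g c z) (slope g c w) ≤ 4 / r / r * (dist z c + dist w c) := by
    intro z hz hzc w hw hwc
    rw [dist_eq_norm]
    refine ContinuousLinearMap.opNorm_le_bound _ (by positivity) fun x => ?_
    have ht : ∀ z ∈ Metric.ball c r,
        Tendsto (fun k => slope (f k) c z x) atTop (𝓝 (slope g c z x)) := by
      intro z hz
      simp only [slope_def_module, _root_.smul_apply, _root_.sub_apply]
      exact ((hlim z hz x).sub (hlim c hc x)).const_smul _
    have ht2 := ((ht z hz).sub (ht w hw)).norm
    refine le_of_tendsto ht2 (Eventually.of_forall fun k => ?_)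
    have e := (slope (f k) c z - slope (f k) c w).le_opNorm x
    refine e.trans (mul_le_mul_of_nonneg_right ?_ (norm_nonneg x))
    rw [← dist_eq_norm, ← dslope_of_ne (f k) hzc, ← dslope_of_ne (f k) hwc, mul_add]
    refine (dist_triangle_right _ _ (dslope (f k) c c)).trans ?_
    exact add_le_add (hlip k z hz) (hlip k w hw)
  have hcau : Cauchy (map (slope g c) (𝓝[≠] c)) := by
    rw [Metric.cauchy_iff]
    refine ⟨inferInstance, fun ε hε => ?_⟩
    set δ := min r (ε / (4 / r / r * 2 + 1)) with hδ
    have hpos : 0 < 4 / r / r * 2 + 1 := by positivity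
    have hδ0 : 0 < δ := lt_min hr (by positivity)
    refine ⟨slope g c '' (Metric.ball c δ ∩ {c}ᶜ), image_mem_map
      (inter_comm _ _ ▸ inter_mem_nhdsWithin _ (Metric.ball_mem_nhds c hδ0)), ?_⟩
    rintro _ ⟨z, ⟨hz, hzc⟩, rfl⟩ _ ⟨w, ⟨hw, hwc⟩, rfl⟩
    have hsub := Metric.ball_subset_ball (x := c) (min_le_left r (ε / (4 / r / r * 2 + 1)))
    refine (key z (hsub hz) hzc w (hsub hw) hwc).trans_lt ?_
    have h1 : dist z c < δ := hz
    have h2 : dist w c < δ := hw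
    calc 4 / r / r * (dist z c + dist w c) ≤ 4 / r / r * (δ + δ) := by gcongr
      _ = (4 / r / r * 2) * δ := by ring
      _ < (4 / r / r * 2 + 1) * δ := by nlinarith
      _ ≤ (4 / r / r * 2 + 1) * (ε / (4 / r / r * 2 + 1)) := by
        gcongr
        exact min_le_right _ _
      _ = ε := by field_simp
  obtain ⟨L, hL⟩ := cauchy_map_iff_exists_tendsto.1 hcau
  exact (hasDerivAt_iff_tendsto_slope.2 hL).differentiableAt

end

end DynBC

namespace DynBC

noncomputable section

/-! ### Semigroups generated by sectorial operators -/

/-- The closed sector `C |Im z| ≤ Re z`. -/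
def closedSector (C : ℝ) : Set ℂ := {z | C * |z.im| ≤ z.re}

theorem ofReal_mem_closedSector (C : ℝ) {t : ℝ} (ht : 0 ≤ t) : (t : ℂ) ∈ closedSector C := by
  simpa [closedSector] using ht

theorem add_mem_closedSector {C : ℝ} (hC : 0 ≤ C) {z w : ℂ} (hz : z ∈ closedSector C)
    (hw : w ∈ closedSector C) : z + w ∈ closedSector C := by
  simp only [closedSector, mem_setOf_eq, Complex.add_im, Complex.add_re] at *
  nlinarith [abs_add_le z.im w.im]

/-- This is tan |arg z| = |Im z| / Re z. The slope C + 1 in place of C allows C = 0 and leaves an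
open region inside the closed sector. -/
theorem sector_subset {C : ℝ} (hC : 0 ≤ C) {θ : ℝ} (hθ : θ ≤ Real.arctan (1 / (C + 1))) :
    sector θ ⊆ {z | (C + 1) * |z.im| < z.re} := by
  rintro z ⟨hz0, hz⟩
  have hpi : |z.arg| < Real.pi / 2 := (hz.trans_le hθ).trans (Real.arctan_lt_pi_div_two _)
  have hre : 0 < z.re := (Complex.abs_arg_lt_pi_div_two_iff.1 hpi).resolve_right hz0
  have h1 : Real.tan |z.arg| < 1 / (C + 1) := by
    rw [← Real.tan_arctan (1 / (C + 1))]
    exact Real.tan_lt_tan_of_lt_of_lt_pi_div_two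
      (by linarith [abs_nonneg z.arg, Real.pi_pos]) (Real.arctan_lt_pi_div_two _) (hz.trans_le hθ)
  have h2 : |z.im| / z.re ≤ Real.tan |z.arg| := by
    have : Real.tan |z.arg| = |Real.tan z.arg| := by
      rcases abs_cases z.arg with ⟨h, h'⟩ | ⟨h, h'⟩
      · rw [h, abs_of_nonneg]
        exact Real.tan_nonneg_of_nonneg_of_le_pi_div_two h' (by rw [h] at hpi; exact hpi.le)
      · rw [h, Real.tan_neg, abs_of_nonpos]
        exact Real.tan_nonpos_of_nonpos_of_neg_pi_div_two_le h'.le (by rw [h] at hpi; linarith)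
    rw [this, Complex.tan_arg, abs_div, abs_of_pos hre]
  have h3 := h2.trans_lt h1
  rw [div_lt_div_iff₀ hre (by positivity)] at h3
  simp only [mem_setOf_eq]
  linarith

theorem isOpen_openSector (C : ℝ) : IsOpen {z : ℂ | (C + 1) * |z.im| < z.re} :=
  isOpen_lt (continuous_const.mul Complex.continuous_im.abs) Complex.continuous_re

theorem openSector_subset_closedSector {C : ℝ} :
    {z : ℂ | (C + 1) * |z.im| < z.re} ⊆ closedSector C := fun z hz => by
  simp only [closedSector, mem_setOf_eq] at *
  nlinarith [abs_nonneg z.im]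

variable {H : Type*} [NormedAddCommGroup H] [InnerProductSpace ℂ H]

/-- The numerical range of `B` lies in the sector `|Im| ≤ C Re`. -/
def IsSectorial (C : ℝ) (B : H →L[ℂ] H) : Prop :=
  ∀ x, |(inner ℂ x (B x)).im| ≤ C * (inner ℂ x (B x)).re

/-- The two sectors are dual: for w in the numerical range, |Im z · Im w| ≤ C |Im z| Re w ≤ Re z ·
Re w, so Re(zw) ≥ 0. -/
theorem IsSectorial.isDissipative {C : ℝ} {B : H →L[ℂ] H} (hB : IsSectorial C B)
    (hre : ∀ x, 0 ≤ (inner ℂ x (B x)).re)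
    {z : ℂ} (hz : z ∈ closedSector C) : IsDissipative (-(z • B)) := fun x => by
  have h := hB x
  have h0 := hre x
  have e : inner ℂ x ((-(z • B)) x) = -(z * inner ℂ x (B x)) := by
    simp [inner_smul_right, inner_neg_right]
  rw [e, Complex.neg_re, Complex.mul_re, neg_nonpos, sub_nonneg]
  simp only [closedSector, mem_setOf_eq] at hz
  calc z.im * (inner ℂ x (B x)).im ≤ |z.im| * |(inner ℂ x (B x)).im| := by
        rw [← abs_mul]; exact le_abs_self _
    _ ≤ |z.im| * (C * (inner ℂ x (B x)).re) := by gcongr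
    _ = C * |z.im| * (inner ℂ x (B x)).re := by ring
    _ ≤ z.re * (inner ℂ x (B x)).re := by gcongr

variable [CompleteSpace H]

/-- A commuting sequence of bounded operators that are uniformly sectorial and converge on a dense
set. -/
structure SectorialApprox (C : ℝ) (B : ℕ → H →L[ℂ] H) (D : Set H) (A : H → H) : Prop where
  nonneg : 0 ≤ C
  sectorial : ∀ k, IsSectorial C (B k)
  re_nonneg : ∀ k x, 0 ≤ (inner ℂ x (B k x)).re
  comm : ∀ j k, Commute (B j) (B k)
  dense : Dense D
  tendsto : ∀ x ∈ D, Tendsto (fun k => B k x) atTop (𝓝 (A x))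

namespace SectorialApprox

variable {C : ℝ} {B : ℕ → H →L[ℂ] H} {D : Set H} {A : H → H}

theorem isDissipative (h : SectorialApprox C B D A) (k : ℕ) {z : ℂ} (hz : z ∈ closedSector C) :
    IsDissipative (-(z • B k)) :=
  (h.sectorial k).isDissipative (h.re_nonneg k) hz

theorem commute (h : SectorialApprox C B D A) (j k : ℕ) (z w : ℂ) :
    Commute (-(z • B j)) (-(w • B k)) :=
  (((h.comm j k).smul_left z).smul_right w).neg_left.neg_right

/-- On the dense set two exponentials differ by at most ‖z‖ ‖B_j y - B_k y‖; contractivity carries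
the Cauchy property to all vectors. -/
theorem cauchySeq (h : SectorialApprox C B D A) {z : ℂ} (hz : z ∈ closedSector C) (x : H) :
    CauchySeq fun k => NormedSpace.exp (-(z • B k)) x := by
  rw [Metric.cauchySeq_iff]
  intro ε hε
  obtain ⟨y, hyD, hy⟩ := h.dense.exists_dist_lt x (ε := ε / 4) (by positivity)
  have hcy := (h.tendsto y hyD).cauchySeq
  rw [Metric.cauchySeq_iff] at hcy
  obtain ⟨N, hN⟩ := hcy (ε / (4 * (‖z‖ + 1))) (by positivity)
  refine ⟨N, fun j hj k hk => ?_⟩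
  have h1 : ∀ i, dist (NormedSpace.exp (-(z • B i)) x) (NormedSpace.exp (-(z • B i)) y) < ε / 4 :=
    fun i => by
      rw [dist_eq_norm, ← map_sub]
      exact ((h.isDissipative i hz).norm_exp_apply_le _).trans_lt (by rwa [← dist_eq_norm])
  have h2 : dist (NormedSpace.exp (-(z • B j)) y) (NormedSpace.exp (-(z • B k)) y) ≤ ε / 4 := by
    rw [dist_eq_norm]
    refine (norm_exp_sub_exp_apply_le (h.isDissipative j hz) (h.isDissipative k hz)
      (h.commute j k z z) y).trans ?_
    have e : (-(z • B j)) y - (-(z • B k)) y = -(z • (B j y - B k y)) := by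
      simp [smul_sub]; abel
    rw [e, norm_neg, norm_smul, ← dist_eq_norm]
    calc ‖z‖ * dist (B j y) (B k y) ≤ (‖z‖ + 1) * (ε / (4 * (‖z‖ + 1))) := by
          gcongr
          · linarith
          · exact (hN j hj k hk).le
      _ = ε / 4 := by field_simp
  have h3 := dist_triangle4 (NormedSpace.exp (-(z • B j)) x) (NormedSpace.exp (-(z • B j)) y)
    (NormedSpace.exp (-(z • B k)) y) (NormedSpace.exp (-(z • B k)) x)
  have h4 := h1 j
  have h5 := h1 k
  rw [dist_comm] at h5
  linarith

theorem exists_limit (h : SectorialApprox C B D A) :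
    ∃ S : ℂ → H →L[ℂ] H, ∀ z ∈ closedSector C, ∀ x,
      Tendsto (fun k => NormedSpace.exp (-(z • B k)) x) atTop (𝓝 (S z x)) := by
  have : ∀ z : ℂ, ∃ S : H →L[ℂ] H, z ∈ closedSector C → ∀ x,
      Tendsto (fun k => NormedSpace.exp (-(z • B k)) x) atTop (𝓝 (S x)) := by
    intro z
    by_cases hz : z ∈ closedSector C
    · choose f hf using fun x => cauchySeq_tendsto_of_complete (h.cauchySeq hz x)
      exact ⟨continuousLinearMapOfTendsto (l := atTop) (fun k => NormedSpace.exp (-(z • B k)))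
        (f := f) (tendsto_pi_nhds.2 hf), fun _ => hf⟩
    · exact ⟨0, fun hz' => (hz hz').elim⟩
  choose S hS using this
  exact ⟨S, fun z hz x => hS z hz x⟩

/-- The semigroup on the closed sector generated by the limit operator. -/
def semigroup (h : SectorialApprox C B D A) : ℂ → H →L[ℂ] H := h.exists_limit.choose

theorem tendsto_semigroup (h : SectorialApprox C B D A) {z : ℂ} (hz : z ∈ closedSector C) (x : H) :
    Tendsto (fun k => NormedSpace.exp (-(z • B k)) x) atTop (𝓝 (h.semigroup z x)) :=
  h.exists_limit.choose_spec z hz x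

theorem norm_semigroup_apply_le (h : SectorialApprox C B D A) {z : ℂ} (hz : z ∈ closedSector C)
    (x : H) : ‖h.semigroup z x‖ ≤ ‖x‖ :=
  le_of_tendsto (h.tendsto_semigroup hz x).norm
    (Eventually.of_forall fun k => (h.isDissipative k hz).norm_exp_apply_le x)

theorem norm_semigroup_le (h : SectorialApprox C B D A) {z : ℂ} (hz : z ∈ closedSector C) :
    ‖h.semigroup z‖ ≤ 1 :=
  ContinuousLinearMap.opNorm_le_bound _ zero_le_one fun x => by
    simpa using h.norm_semigroup_apply_le hz x

theorem semigroup_zero (h : SectorialApprox C B D A) :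
    h.semigroup 0 = ContinuousLinearMap.id ℂ H := by
  ext x
  refine tendsto_nhds_unique (h.tendsto_semigroup (by simp [closedSector]) x) ?_
  simp [NormedSpace.exp_zero]

/-- The exponentials split for each k, and the contractivity of the left factor makes the error in
the right factor harmless in the limit. -/
theorem semigroup_add (h : SectorialApprox C B D A) {z w : ℂ} (hz : z ∈ closedSector C)
    (hw : w ∈ closedSector C) : h.semigroup (z + w) = (h.semigroup z).comp (h.semigroup w) := by
  let _ : NormedAlgebra ℚ (H →L[ℂ] H) := NormedAlgebra.restrictScalars ℚ ℂ _
  ext x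
  refine tendsto_nhds_unique
    (h.tendsto_semigroup (add_mem_closedSector h.nonneg hz hw) x) ?_
  have e : ∀ k, NormedSpace.exp (-((z + w) • B k)) x =
      NormedSpace.exp (-(z • B k)) (NormedSpace.exp (-(w • B k)) x - h.semigroup w x) +
      NormedSpace.exp (-(z • B k)) (h.semigroup w x) := by
    intro k
    rw [← map_add, sub_add_cancel, add_smul, neg_add,
      NormedSpace.exp_add_of_commute (h.commute k k z w)]
    rfl
  simp only [e, ContinuousLinearMap.comp_apply]
  rw [← zero_add (h.semigroup z (h.semigroup w x))]
  refine Tendsto.add ?_ (h.tendsto_semigroup hz _)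
  refine squeeze_zero_norm (fun k => (h.isDissipative k hz).norm_exp_apply_le _) ?_
  have := ((h.tendsto_semigroup hw x).sub_const (h.semigroup w x)).norm
  simpa using this

theorem norm_semigroup_apply_sub_le (h : SectorialApprox C B D A) {z : ℂ}
    (hz : z ∈ closedSector C) {x : H} (hx : x ∈ D) : ‖h.semigroup z x - x‖ ≤ ‖z‖ * ‖A x‖ := by
  refine le_of_tendsto_of_tendsto ((h.tendsto_semigroup hz x).sub_const x).norm
    ((h.tendsto x hx).norm.const_mul ‖z‖) (Eventually.of_forall fun k => ?_)
  refine (norm_exp_apply_sub_le (h.isDissipative k hz) x).trans (le_of_eq ?_)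
  simp [norm_smul]

theorem tendsto_semigroup_zero (h : SectorialApprox C B D A) (x : H) :
    Tendsto (fun z => h.semigroup z x) (𝓝[closedSector C] 0) (𝓝 x) := by
  rw [Metric.tendsto_nhds]
  intro ε hε
  obtain ⟨y, hyD, hy⟩ := h.dense.exists_dist_lt x (ε := ε / 3) (by positivity)
  have hev : ∀ᶠ z : ℂ in 𝓝[closedSector C] 0, ‖z‖ * ‖A y‖ < ε / 3 := by
    have : Tendsto (fun z : ℂ => ‖z‖ * ‖A y‖) (𝓝[closedSector C] 0) (𝓝 (‖(0 : ℂ)‖ * ‖A y‖)) :=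
      ((continuous_norm.mul continuous_const).tendsto 0).mono_left nhdsWithin_le_nhds
    refine this.eventually (gt_mem_nhds ?_)
    simp; positivity
  filter_upwards [hev, self_mem_nhdsWithin] with z hz hzC
  have h1 : dist (h.semigroup z x) (h.semigroup z y) < ε / 3 := by
    rw [dist_eq_norm, ← map_sub]
    exact (h.norm_semigroup_apply_le hzC _).trans_lt (by rwa [← dist_eq_norm])
  have h2 : dist (h.semigroup z y) y < ε / 3 := by
    rw [dist_eq_norm]
    exact (h.norm_semigroup_apply_sub_le hzC hyD).trans_lt hz
  have h3 := dist_triangle4 (h.semigroup z x) (h.semigroup z y) y x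
  rw [dist_comm] at hy
  linarith

theorem differentiableAt_semigroup (h : SectorialApprox C B D A) {z : ℂ}
    (hz : (C + 1) * |z.im| < z.re) : DifferentiableAt ℂ h.semigroup z := by
  obtain ⟨r, hr, hsub⟩ := Metric.isOpen_iff.1 (isOpen_openSector C) z hz
  have hsub' : Metric.ball z r ⊆ closedSector C := hsub.trans openSector_subset_closedSector
  refine differentiableAt_of_tendsto_apply (f := fun k w => NormedSpace.exp (-(w • B k))) hr
    (fun k => ?_) (fun k w hw => (h.isDissipative k (hsub' hw)).norm_exp_le)
    fun w hw x => h.tendsto_semigroup (hsub' hw) x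
  have : (fun w : ℂ => NormedSpace.exp (-(w • B k))) =
      fun w : ℂ => NormedSpace.exp (w • -(B k)) := by
    funext w; rw [smul_neg]
  rw [this]
  exact fun w _ =>
    (hasDerivAt_exp_smul_const (𝕂 := ℂ) (-(B k)) w).differentiableAt.differentiableWithinAt

theorem isAnalyticSemigroup (h : SectorialApprox C B D A) :
    IsAnalyticSemigroup fun t : ℝ => h.semigroup t := by
  have hsec : sector (Real.arctan (1 / (C + 1))) ⊆ closedSector C :=
    (sector_subset h.nonneg le_rfl).trans openSector_subset_closedSector
  refine ⟨⟨by simpa using h.semigroup_zero, fun s t hs ht => ?_, fun φ => ?_⟩,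
    Real.arctan (1 / (C + 1)), ?_, (Real.arctan_lt_pi_div_two _).le, h.semigroup,
    fun t _ => rfl, ?_, ?_, ?_⟩
  · simp only [Complex.ofReal_add]
    exact h.semigroup_add (ofReal_mem_closedSector C hs) (ofReal_mem_closedSector C ht)
  · refine (h.tendsto_semigroup_zero φ).comp (tendsto_nhdsWithin_iff.2 ⟨?_, ?_⟩)
    · exact (Complex.continuous_ofReal.tendsto' 0 0 (by simp)).mono_left nhdsWithin_le_nhds
    · filter_upwards [self_mem_nhdsWithin] with t ht
      exact ofReal_mem_closedSector C (le_of_lt ht)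
  · have := h.nonneg
    rw [← Real.arctan_zero]
    exact Real.arctan_strictMono (by positivity)
  · exact fun z hz => (h.differentiableAt_semigroup
      (sector_subset h.nonneg le_rfl hz)).differentiableWithinAt
  · exact fun z hz w hw => h.semigroup_add (hsec hz) (hsec hw)
  · intro θ' _ hθ' φ
    exact (h.tendsto_semigroup_zero φ).mono_left (nhdsWithin_mono 0
      ((sector_subset h.nonneg hθ'.le).trans openSector_subset_closedSector))

/-- The first-order remainder is governed by the motion of B_k x under the approximating semigroup.
As A x need not lie in D, a y in D is inserted: its orbit is controlled through A y, and the
exchange costs 2‖A x - y‖. -/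
theorem norm_semigroup_apply_sub_add_le (h : SectorialApprox C B D A) {t : ℝ} (ht : 0 ≤ t) {x y : H}
    (hx : x ∈ D) (hy : y ∈ D) :
    ‖h.semigroup t x - x + (t : ℂ) • A x‖ ≤ t * (2 * ‖A x - y‖ + t * ‖A y‖) := by
  have hb : ∀ k, ‖NormedSpace.exp (-((t : ℂ) • B k)) x - x + (t : ℂ) • B k x‖ ≤
      t * (2 * ‖B k x - y‖ + t * ‖B k y‖) := by
    intro k
    have hs := norm_exp_apply_sub_sub_le (-((t : ℂ) • B k)) x
      (M := t * (2 * ‖B k x - y‖ + t * ‖B k y‖)) ?_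
    · simpa using hs
    intro s hs
    have e1 : s • (-((t : ℂ) • B k)) = -(((s * t : ℝ) : ℂ) • B k) := by
      rw [smul_neg, ← Complex.coe_smul, smul_smul, Complex.ofReal_mul]
    have e2 : (-((t : ℂ) • B k)) x = -((t : ℂ) • B k x) := by simp
    have hst : 0 ≤ s * t := mul_nonneg hs.1 ht
    have hmem := ofReal_mem_closedSector C hst
    rw [e1, e2]
    set E := NormedSpace.exp (-(((s * t : ℝ) : ℂ) • B k))
    have e3 : E (-((t : ℂ) • B k x)) - -((t : ℂ) • B k x) = -((t : ℂ) • (E (B k x) - B k x)) := by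
      simp [smul_sub]; abel
    rw [e3, norm_neg, norm_smul, Complex.norm_real, Real.norm_of_nonneg ht]
    gcongr
    have e4 : E (B k x) - B k x = E (B k x - y) + (E y - y) - (B k x - y) := by
      rw [map_sub]; abel
    have n1 : ‖E (B k x - y)‖ ≤ ‖B k x - y‖ := (h.isDissipative k hmem).norm_exp_apply_le _
    have n2 : ‖E y - y‖ ≤ t * ‖B k y‖ := by
      refine (norm_exp_apply_sub_le (h.isDissipative k hmem) y).trans ?_
      have : ‖(-(((s * t : ℝ) : ℂ) • B k)) y‖ = s * t * ‖B k y‖ := by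
        simp only [_root_.neg_apply, _root_.smul_apply, norm_neg, norm_smul, Complex.norm_real,
          Real.norm_of_nonneg hst]
      rw [this]
      gcongr
      nlinarith [hs.2]
    rw [e4]
    have n3 := norm_sub_le (E (B k x - y) + (E y - y)) (B k x - y)
    have n4 := norm_add_le (E (B k x - y)) (E y - y)
    linarith
  refine le_of_tendsto_of_tendsto
    (((h.tendsto_semigroup (ofReal_mem_closedSector C ht) x).sub_const x).add
      ((h.tendsto x hx).const_smul (t : ℂ))).norm ?_ (Eventually.of_forall hb)
  exact ((((h.tendsto x hx).sub_const y).norm.const_mul 2).add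
    ((h.tendsto y hy).norm.const_mul t)).const_mul t

theorem tendsto_difference_quotient (h : SectorialApprox C B D A) {x : H} (hx : x ∈ D) :
    Tendsto (fun t : ℝ => (t : ℂ)⁻¹ • (h.semigroup t x - x)) (𝓝[>] 0) (𝓝 (-A x)) := by
  rw [Metric.tendsto_nhds]
  intro ε hε
  obtain ⟨y, hyD, hy⟩ := h.dense.exists_dist_lt (A x) (ε := ε / 4) (by positivity)
  have hev : ∀ᶠ t : ℝ in 𝓝[>] 0, t * ‖A y‖ < ε / 4 := by
    have : Tendsto (fun t : ℝ => t * ‖A y‖) (𝓝[>] 0) (𝓝 (0 * ‖A y‖)) :=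
      ((continuous_id.mul continuous_const).tendsto 0).mono_left nhdsWithin_le_nhds
    refine this.eventually (gt_mem_nhds ?_)
    simp; positivity
  filter_upwards [hev, self_mem_nhdsWithin] with t ht ht0
  have ht0 : 0 < t := ht0
  rw [dist_eq_norm]
  have e : (t : ℂ)⁻¹ • (h.semigroup t x - x) - -A x =
      (t : ℂ)⁻¹ • (h.semigroup t x - x + (t : ℂ) • A x) := by
    rw [smul_add, smul_smul, inv_mul_cancel₀ (by exact_mod_cast ht0.ne'), one_smul]
    abel
  rw [e, norm_smul, norm_inv, Complex.norm_real, Real.norm_of_nonneg ht0.le]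
  have hb := h.norm_semigroup_apply_sub_add_le ht0.le hx hyD
  rw [dist_eq_norm] at hy
  calc t⁻¹ * ‖h.semigroup t x - x + (t : ℂ) • A x‖
      ≤ t⁻¹ * (t * (2 * ‖A x - y‖ + t * ‖A y‖)) := by gcongr
    _ = 2 * ‖A x - y‖ + t * ‖A y‖ := by field_simp
    _ < ε := by linarith

end SectorialApprox

end

end DynBC

namespace DynBC

noncomputable section

/-! ### Generation of semigroups -/

section Generation

variable {H : Type*} [NormedAddCommGroup H] [InnerProductSpace ℂ H]

/-- Accretivity gives a‖x‖² ≤ Re⟪x, (a + A)x⟫ ≤ ‖x‖ ‖(a + A)x‖, so the surjection a + A is injective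
with inverse bounded by 1/a. -/
theorem exists_resolvent_of_accretive {A : H →ₗ.[ℂ] H}
    (hre : ∀ x : A.domain, 0 ≤ (inner ℂ (x : H) (A x)).re) {a : ℝ} (ha : 0 < a)
    (hsurj : ∀ ψ, ∃ x : A.domain, (a : ℂ) • (x : H) + A x = ψ) :
    ∃ R : H →L[ℂ] H, (∀ ψ, ‖R ψ‖ ≤ a⁻¹ * ‖ψ‖) ∧
      (∀ x : A.domain, R ((a : ℂ) • (x : H) + A x) = x) ∧
      ∀ ψ, ∃ x : A.domain, (x : H) = R ψ ∧ (a : ℂ) • (x : H) + A x = ψ := by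
  set f : A.domain →ₗ[ℂ] H := (a : ℂ) • A.domain.subtype + A.toFun with hf
  have hfx : ∀ x : A.domain, f x = (a : ℂ) • (x : H) + A x := fun x => rfl
  have hb : ∀ x : A.domain, ‖(x : H)‖ ≤ a⁻¹ * ‖f x‖ := by
    intro x
    have h1 : a * ‖(x : H)‖ ^ 2 ≤ (inner ℂ (x : H) (f x)).re := by
      rw [hfx, inner_add_right, inner_smul_right, Complex.add_re, Complex.re_ofReal_mul]
      have := hre x
      have e : (inner ℂ (x : H) (x : H)).re = ‖(x : H)‖ ^ 2 := inner_self_eq_norm_sq (𝕜 := ℂ) _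
      rw [e]
      linarith
    have h2 : (inner ℂ (x : H) (f x)).re ≤ ‖(x : H)‖ * ‖f x‖ :=
      (Complex.re_le_norm _).trans (norm_inner_le_norm _ _)
    rcases eq_or_lt_of_le (norm_nonneg (x : H)) with h0 | h0
    · rw [← h0]; positivity
    · rw [inv_mul_eq_div, le_div_iff₀ ha]
      nlinarith
  have hinj : Function.Injective f := by
    rw [← LinearMap.ker_eq_bot, LinearMap.ker_eq_bot']
    intro x hx
    have := hb x
    rw [hx, norm_zero, mul_zero] at this
    exact Subtype.ext (norm_le_zero_iff.1 this)
  set e := LinearEquiv.ofBijective f ⟨hinj, fun ψ => hsurj ψ⟩ with he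
  have hes : ∀ ψ, f (e.symm ψ) = ψ := fun ψ => e.apply_symm_apply ψ
  refine ⟨(A.domain.subtype ∘ₗ e.symm.toLinearMap).mkContinuous a⁻¹ fun ψ => ?_, fun ψ => ?_,
    fun x => ?_, fun ψ => ⟨e.symm ψ, rfl, hes ψ⟩⟩
  · have := hb (e.symm ψ)
    rwa [hes] at this
  · have := hb (e.symm ψ)
    rwa [hes] at this
  · have : e.symm (f x) = x := e.symm_apply_apply x
    rw [← hfx]
    exact congrArg Subtype.val this

variable [CompleteSpace H]

/-- A densely defined sectorial operator `A` such that `k + 1 + A` is onto for all `k` is, up to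
the sign, the generator of an analytic contraction semigroup. -/
theorem exists_analyticSemigroup {A : H →ₗ.[ℂ] H} (hd : Dense (A.domain : Set H)) {C : ℝ}
    (hC : 0 ≤ C) (hre : ∀ x : A.domain, 0 ≤ (inner ℂ (x : H) (A x)).re)
    (him : ∀ x : A.domain, |(inner ℂ (x : H) (A x)).im| ≤ C * (inner ℂ (x : H) (A x)).re)
    (hsurj : ∀ k : ℕ, ∀ ψ, ∃ x : A.domain, (((k : ℝ) + 1 : ℝ) : ℂ) • (x : H) + A x = ψ) :
    ∃ T : ℝ → H →L[ℂ] H,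
      IsAnalyticSemigroup T ∧ (∀ t, 0 ≤ t → ‖T t‖ ≤ 1) ∧ IsGenerator (-A) T := by
  set a : ℕ → ℝ := fun k => (k : ℝ) + 1 with ha
  have ha0 : ∀ k, 0 < a k := fun k => by positivity
  choose R hRb hRl hRr using fun k => exists_resolvent_of_accretive hre (ha0 k) (hsurj k)
  have hlin : ∀ k ψ, a k * ‖R k ψ‖ ≤ ‖ψ‖ := fun k ψ => by
    have := hRb k ψ
    rwa [inv_mul_eq_div, le_div_iff₀ (ha0 k), mul_comm] at this
  -- The resolvent identity. Since the numbers a_k are distinct, it forces the resolvents to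
  -- commute.
  have hres : ∀ j k ψ, R j ψ = R k ψ + ((a k - a j : ℝ) : ℂ) • R j (R k ψ) := by
    intro j k ψ
    obtain ⟨y, hy, hy2⟩ := hRr k ψ
    have h1 := hRl j y
    have e : ψ = ((a j : ℂ) • (y : H) + A y) + ((a k - a j : ℝ) : ℂ) • (y : H) := by
      rw [← hy2, Complex.ofReal_sub, sub_smul]; abel
    rw [← hy]
    conv_lhs => rw [e, map_add, h1, map_smul]
  have hcomm : ∀ j k, Commute (R j) (R k) := by
    intro j k
    ext ψ
    rcases eq_or_ne (a k - a j) 0 with h0 | h0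
    · have : j = k := by
        have : (k : ℝ) = j := by simpa [ha, sub_eq_zero] using h0
        exact_mod_cast this.symm
      rw [this]
    · have h1 := hres j k ψ
      have h2 := hres k j ψ
      have h3 : ((a k - a j : ℝ) : ℂ) • (R j (R k ψ) - R k (R j ψ)) = 0 := by
        have e : ((a j - a k : ℝ) : ℂ) = -((a k - a j : ℝ) : ℂ) := by push_cast; ring
        rw [e, neg_smul, ← sub_eq_add_neg] at h2
        have hP := eq_sub_of_add_eq' h1.symm
        have hQ := sub_eq_of_eq_add (eq_add_of_sub_eq' h2.symm)
        rw [smul_sub, hP, hQ, sub_self]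
      have h4 := (smul_eq_zero.1 h3).resolve_left (by exact_mod_cast h0)
      exact sub_eq_zero.1 h4
  -- The Yosida approximation, formally a_k A (a_k + A)⁻¹.
  set B : ℕ → H →L[ℂ] H := fun k =>
    (a k : ℂ) • ContinuousLinearMap.id ℂ H - ((a k : ℂ) ^ 2) • R k with hB
  have hBy : ∀ k (y : A.domain), B k ((a k : ℂ) • (y : H) + A y) = (a k : ℂ) • A y := by
    intro k y
    simp only [hB, _root_.sub_apply, _root_.smul_apply, ContinuousLinearMap.id_apply, hRl k y]
    rw [smul_add, smul_smul, sq]; abel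
  have hBx : ∀ k (x : A.domain), B k (x : H) = (a k : ℂ) • R k (A x) := by
    intro k x
    have h1 := hRl k x
    simp only [hB, _root_.sub_apply, _root_.smul_apply, ContinuousLinearMap.id_apply]
    nth_rewrite 1 [← h1]
    rw [map_add, map_smul, smul_add, smul_smul, sq]; abel
  -- With ψ = (a + A)y the numerical range splits into a²⟪y, Ay⟫ and a‖Ay‖²; the nonnegative second
  -- term keeps the sum in the sector of A.
  have hinner : ∀ k ψ, ∃ y : A.domain, inner ℂ ψ (B k ψ) =
      ((a k ^ 2 : ℝ) : ℂ) * inner ℂ (y : H) (A y) + ((a k * ‖A y‖ ^ 2 : ℝ) : ℂ) := by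
    intro k ψ
    obtain ⟨y, -, hy⟩ := hRr k ψ
    refine ⟨y, ?_⟩
    rw [← hy, hBy, inner_add_left, inner_smul_left, inner_smul_right, inner_smul_right,
      inner_self_eq_norm_sq_to_K, Complex.conj_ofReal]
    push_cast
    simp
    ring
  -- On the domain aRx - x = -RAx is O(1/a), and the contractions aR carry the convergence to the
  -- closure.
  have hnearid : ∀ φ, Tendsto (fun k => (a k : ℂ) • R k φ) atTop (𝓝 φ) := by
    intro φ
    rw [Metric.tendsto_atTop]
    intro ε hε
    obtain ⟨x, hx, hxφ⟩ := hd.exists_dist_lt φ (ε := ε / 3) (by positivity)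
    obtain ⟨N, hN⟩ := exists_nat_gt (‖A ⟨x, hx⟩‖ / (ε / 3))
    refine ⟨N, fun k hk => ?_⟩
    have h1 : ‖(a k : ℂ) • R k (φ - x)‖ ≤ ‖φ - x‖ := by
      rw [norm_smul, Complex.norm_real, Real.norm_of_nonneg (ha0 k).le]
      exact hlin k _
    have h2 : (a k : ℂ) • R k x - x = -R k (A ⟨x, hx⟩) := by
      have := hRl k ⟨x, hx⟩
      rw [map_add, map_smul] at this
      simp only at this
      nth_rewrite 2 [← this]
      abel
    have h3 : ‖R k (A ⟨x, hx⟩)‖ < ε / 3 := by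
      have hk' : ‖A ⟨x, hx⟩‖ / (ε / 3) < a k := hN.trans_le (by
        have : (N : ℝ) ≤ k := by exact_mod_cast hk
        simp only [ha]; linarith)
      rw [div_lt_iff₀ (by positivity)] at hk'
      have := hlin k (A ⟨x, hx⟩)
      exact lt_of_mul_lt_mul_left (this.trans_lt hk') (ha0 k).le
    have e : (a k : ℂ) • R k φ - φ = (a k : ℂ) • R k (φ - x) + ((a k : ℂ) • R k x - x) - (φ - x) := by
      rw [map_sub, smul_sub]; abel
    rw [dist_eq_norm, e, h2]
    rw [dist_eq_norm] at hxφ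
    have n1 := norm_sub_le ((a k : ℂ) • R k (φ - x) + -R k (A ⟨x, hx⟩)) (φ - x)
    have n2 := norm_add_le ((a k : ℂ) • R k (φ - x)) (-R k (A ⟨x, hx⟩))
    rw [norm_neg] at n2
    linarith
  classical
  set A' : H → H := fun x => if hx : x ∈ A.domain then A ⟨x, hx⟩ else 0 with hA'
  have hA'x : ∀ x : A.domain, A' x = A x := fun x => by simp [hA', x.2]
  have happ : SectorialApprox C B (A.domain : Set H) A' := by
    refine ⟨hC, fun k ψ => ?_, fun k ψ => ?_, fun j k => ?_, hd, fun x hx => ?_⟩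
    · obtain ⟨y, hy⟩ := hinner k ψ
      rw [hy]
      have h1 := him y
      rw [Complex.add_im, Complex.add_re, Complex.im_ofReal_mul, Complex.re_ofReal_mul,
        Complex.ofReal_im, Complex.ofReal_re, add_zero, abs_mul, abs_of_nonneg (sq_nonneg _)]
      have h2 : 0 ≤ C * (a k * ‖A y‖ ^ 2) := by
        have := ha0 k
        positivity
      nlinarith [sq_nonneg (a k)]
    · obtain ⟨y, hy⟩ := hinner k ψ
      rw [hy]
      have h1 := hre y
      have := ha0 k
      rw [Complex.add_re, Complex.re_ofReal_mul, Complex.ofReal_re]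
      positivity
    · have h1 : Commute (ContinuousLinearMap.id ℂ H) (R k) := Commute.one_left (R k)
      have h2 : Commute (R j) (ContinuousLinearMap.id ℂ H) := Commute.one_right (R j)
      have h3 : Commute (ContinuousLinearMap.id ℂ H) (ContinuousLinearMap.id ℂ H) := Commute.refl _
      refine Commute.sub_left (Commute.sub_right ?_ ?_) (Commute.sub_right ?_ ?_)
      · exact (h3.smul_left _).smul_right _
      · exact (h1.smul_left _).smul_right _
      · exact (h2.smul_left _).smul_right _
      · exact ((hcomm j k).smul_left _).smul_right _
    · have e : A' x = A ⟨x, hx⟩ := hA'x ⟨x, hx⟩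
      rw [e]
      simp only [hBx _ ⟨x, hx⟩]
      exact hnearid (A ⟨x, hx⟩)
  refine ⟨fun t => happ.semigroup t, happ.isAnalyticSemigroup,
    fun t ht => happ.norm_semigroup_le (ofReal_mem_closedSector C ht), fun φ ψ => ⟨?_, ?_⟩⟩
  · intro h
    obtain ⟨x, hx, hx2⟩ := (LinearPMap.mem_graph_iff _).1 h
    have hx' : (x : H) = φ := hx
    have hψ : -A' φ = ψ := by
      rw [← hx', hA'x ⟨x, x.2⟩]
      exact hx2
    rw [← hψ]
    exact happ.tendsto_difference_quotient (by rw [← hx']; exact x.2)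
  · intro h
    -- Index 0 means a = 1, so (1 + A)x = φ - ψ. The difference quotients at φ - x then converge to
    -- φ - x itself, which contractivity allows only if φ = x.
    obtain ⟨x, hx⟩ := hsurj 0 (φ - ψ)
    have hx1 : (x : H) + A x = φ - ψ := by simpa using hx
    have h2 := happ.tendsto_difference_quotient x.2
    have h3 := h.sub h2
    have hlim : ψ - -A' (x : H) = φ - x := by
      rw [hA'x, sub_neg_eq_add]
      have : A x = φ - ψ - x := by rw [← hx1]; abel
      rw [this]; abel
    rw [hlim] at h3
    have h4 : Tendsto (fun t : ℝ => (inner ℂ (φ - x)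
        ((t : ℂ)⁻¹ • (happ.semigroup t φ - φ) - (t : ℂ)⁻¹ • (happ.semigroup t x - x))).re)
        (𝓝[>] 0) (𝓝 (inner ℂ (φ - x) (φ - x)).re) :=
      (Complex.continuous_re.tendsto _).comp (tendsto_const_nhds.inner h3)
    have h5 : (inner ℂ (φ - x) (φ - x)).re ≤ 0 := by
      refine le_of_tendsto h4 ?_
      filter_upwards [self_mem_nhdsWithin] with t ht
      have ht : 0 < t := ht
      have e : (t : ℂ)⁻¹ • (happ.semigroup t φ - φ) - (t : ℂ)⁻¹ • (happ.semigroup t x - x) =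
          ((t⁻¹ : ℝ) : ℂ) • (happ.semigroup t (φ - x) - (φ - x)) := by
        rw [← smul_sub, map_sub, Complex.ofReal_inv]; congr 1; abel
      rw [e, inner_smul_right, Complex.re_ofReal_mul, inner_sub_right, Complex.sub_re]
      have n1 : (inner ℂ (φ - x) (happ.semigroup t (φ - x))).re ≤ ‖φ - x‖ * ‖φ - (x : H)‖ :=
        ((Complex.re_le_norm _).trans (norm_inner_le_norm _ _)).trans (by
          gcongr
          exact happ.norm_semigroup_apply_le (ofReal_mem_closedSector C ht.le) _)
      have n2 : (inner ℂ (φ - x) (φ - x)).re = ‖φ - (x : H)‖ ^ 2 := inner_self_eq_norm_sq (𝕜 := ℂ) _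
      refine mul_nonpos_of_nonneg_of_nonpos (by positivity) ?_
      rw [n2]; nlinarith
    have n2 : (inner ℂ (φ - x) (φ - x)).re = ‖φ - (x : H)‖ ^ 2 := inner_self_eq_norm_sq (𝕜 := ℂ) _
    have h6 : φ - x = 0 := by
      rw [n2] at h5
      exact norm_eq_zero.1 (pow_eq_zero_iff (two_ne_zero) |>.1 (le_antisymm h5 (by positivity)))
    have h7 : (x : H) = φ := (sub_eq_zero.1 h6).symm
    refine (LinearPMap.mem_graph_iff _).2 ⟨x, h7, ?_⟩
    have : A x = -ψ := by
      have : A x = φ - ψ - x := by rw [← hx1]; abel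
      rw [this, h7]; abel
    change -(A x) = ψ
    rw [this, neg_neg]

end Generation

/-! ### The operator associated with a form -/

section Form

variable {V : Type*} [NormedAddCommGroup V] [InnerProductSpace ℂ V] [CompleteSpace V]

/-- The Lax–Milgram argument: L is bounded below, so its range is closed, and a vector w orthogonal
to the range satisfies c‖w‖² ≤ Re⟪w, Lw⟫ = 0. -/
theorem surjective_of_coercive {L : V →L[ℂ] V} {c : ℝ} (hc : 0 < c)
    (h : ∀ u, c * ‖u‖ ^ 2 ≤ (inner ℂ u (L u)).re) : Function.Surjective L := by
  have hb : ∀ u, c * ‖u‖ ≤ ‖L u‖ := by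
    intro u
    rcases eq_or_lt_of_le (norm_nonneg u) with h0 | h0
    · rw [← h0]; simp
    · have h2 : (inner ℂ u (L u)).re ≤ ‖u‖ * ‖L u‖ :=
        (Complex.re_le_norm _).trans (norm_inner_le_norm _ _)
      have := h u
      nlinarith
  have hanti : AntilipschitzWith (⟨c, hc.le⟩⁻¹ : ℝ≥0) L := by
    refine AddMonoidHomClass.antilipschitz_of_bound L fun u => ?_
    have := hb u
    change ‖u‖ ≤ c⁻¹ * ‖L u‖
    rw [inv_mul_eq_div, le_div_iff₀ hc]
    linarith
  have hcl : IsClosed (L.range : Set V) := hanti.isClosed_range L.uniformContinuous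
  have htop : L.range = ⊤ := by
    have : CompleteSpace L.range := hcl.completeSpace_coe
    rw [← Submodule.orthogonal_eq_bot_iff, Submodule.eq_bot_iff]
    intro w hw
    have h1 : inner ℂ (L w) w = 0 := (Submodule.mem_orthogonal _ _).1 hw _ ⟨w, rfl⟩
    have h2 : inner ℂ w (L w) = 0 := inner_eq_zero_symm.1 h1
    have h3 := h w
    rw [h2, Complex.zero_re] at h3
    have : ‖w‖ ^ 2 ≤ 0 := by nlinarith
    exact norm_eq_zero.1 (pow_eq_zero_iff (two_ne_zero) |>.1 (le_antisymm this (by positivity)))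
  intro w
  have : w ∈ L.range := htop ▸ Submodule.mem_top
  exact this

variable {H : Type*} [NormedAddCommGroup H] [InnerProductSpace ℂ H] [CompleteSpace H]

/-- The operator associated with a bounded, sectorial, `J`-elliptic form `(u, v) ↦ ⟪v, L u⟫`. -/
theorem exists_operator_of_form {J : V →L[ℂ] H} {L : V →L[ℂ] V} (hJ : IsCompactOperator J)
    (hd : DenseRange J) {c : ℝ} (hc : 0 < c)
    (hell : ∀ u, c * ‖u‖ ^ 2 ≤ (inner ℂ u (L u)).re + ‖J u‖ ^ 2) {C : ℝ} (hC : 0 ≤ C)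
    (hre : ∀ u, 0 ≤ (inner ℂ u (L u)).re)
    (him : ∀ u, |(inner ℂ u (L u)).im| ≤ C * (inner ℂ u (L u)).re) :
    ∃ A : H →ₗ.[ℂ] H, A.IsClosed ∧ Dense (A.domain : Set H) ∧
      (∀ φ ψ : H, (φ, ψ) ∈ A.graph ↔ ∃ u, φ = J u ∧ ∀ v, inner ℂ (J v) ψ = inner ℂ v (L u)) ∧
      (∃ T : ℝ → H →L[ℂ] H,
        IsAnalyticSemigroup T ∧ (∀ t, 0 ≤ t → ‖T t‖ ≤ 1) ∧ IsGenerator (-A) T) ∧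
      HasCompactResolvent A := by
  have hzero : ∀ u : V, ‖u‖ ^ 2 ≤ 0 → u = 0 := fun u hu =>
    norm_eq_zero.1 (pow_eq_zero_iff (two_ne_zero) |>.1 (le_antisymm hu (by positivity)))
  have horth : ∀ ψ : H, (∀ v, inner ℂ (J v) ψ = 0) → ψ = 0 := fun ψ hψ =>
    hd.eq_zero_of_inner_right ℂ hψ
  set G : Submodule ℂ (H × H) :=
    { carrier := {p | ∃ u, p.1 = J u ∧ ∀ v, inner ℂ (J v) p.2 = inner ℂ v (L u)}
      add_mem' := by
        rintro p q ⟨u, hu, hu2⟩ ⟨w, hw, hw2⟩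
        exact ⟨u + w, by simp [hu, hw], fun v => by simp [hu2, hw2]⟩
      zero_mem' := ⟨0, by simp, by simp⟩
      smul_mem' := by
        rintro a p ⟨u, hu, hu2⟩
        exact ⟨a • u, by simp [hu], fun v => by simp [hu2]⟩ } with hG
  have hGmem : ∀ φ ψ : H, (φ, ψ) ∈ G ↔
      ∃ u, φ = J u ∧ ∀ v, inner ℂ (J v) ψ = inner ℂ v (L u) := fun φ ψ => Iff.rfl
  -- The relation is single valued although J may fail to be injective: Ju = 0 gives ⟪u, Lu⟫ = ⟪Ju,
  -- ψ⟫ = 0, ellipticity gives u = 0, and the dense range of J gives ψ = 0.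
  have hgr : G.toLinearPMap.graph = G := by
    refine Submodule.toLinearPMap_graph_eq G ?_
    rintro ⟨φ, ψ⟩ ⟨u, hu, hu2⟩ h0
    simp only at hu hu2 h0 ⊢
    have hJu : J u = 0 := hu.symm.trans h0
    have h1 := hu2 u
    rw [hJu, inner_zero_left] at h1
    have h2 := hell u
    rw [← h1, hJu] at h2
    have hu0 : u = 0 := hzero u (by simp at h2; nlinarith)
    exact horth ψ fun v => by rw [hu2, hu0]; simp
  have hgraph : ∀ x : G.toLinearPMap.domain, ∃ u, (x : H) = J u ∧
      ∀ v, inner ℂ (J v) (G.toLinearPMap x) = inner ℂ v (L u) := by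
    intro x
    have h : ((x : H), G.toLinearPMap x) ∈ G.toLinearPMap.graph := LinearPMap.mem_graph _ x
    rwa [hgr, hGmem] at h
  have hin : ∀ x : G.toLinearPMap.domain, ∃ u, (x : H) = J u ∧
      inner ℂ (x : H) (G.toLinearPMap x) = inner ℂ u (L u) := fun x => by
    obtain ⟨u, hu, hu2⟩ := hgraph x
    exact ⟨u, hu, by rw [hu, hu2]⟩
  -- For a ≥ 1 ellipticity makes L + aJ*J coercive. Solving for the right-hand side J*ψ produces an
  -- element Ju of the domain with (a + A)Ju = ψ.
  have hsol : ∀ (a : ℝ), 1 ≤ a → ∀ ψ : H, ∃ u, (J u, ψ - (a : ℂ) • J u) ∈ G ∧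
      c * ‖u‖ ≤ ‖J‖ * ‖ψ‖ ∧ (L + (a : ℂ) • (J.adjoint ∘L J)) u = J.adjoint ψ := by
    intro a ha ψ
    have hco : ∀ u, c * ‖u‖ ^ 2 ≤ (inner ℂ u ((L + (a : ℂ) • (J.adjoint ∘L J)) u)).re := by
      intro u
      have e : inner ℂ u ((L + (a : ℂ) • (J.adjoint ∘L J)) u) =
          inner ℂ u (L u) + (a : ℂ) * inner ℂ (J u) (J u) := by
        simp [inner_add_right, inner_smul_right, ContinuousLinearMap.adjoint_inner_right]
      have e2 : (inner ℂ (J u) (J u)).re = ‖J u‖ ^ 2 := inner_self_eq_norm_sq (𝕜 := ℂ) _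
      rw [e, Complex.add_re, Complex.re_ofReal_mul, e2]
      nlinarith [hell u, sq_nonneg ‖J u‖]
    obtain ⟨u, hu⟩ := surjective_of_coercive hc hco (J.adjoint ψ)
    refine ⟨u, (hGmem _ _).2 ⟨u, rfl, fun v => ?_⟩, ?_, hu⟩
    · rw [inner_sub_right, ← ContinuousLinearMap.adjoint_inner_right J v ψ, ← hu,
        _root_.add_apply, _root_.smul_apply, inner_add_right, inner_smul_right, inner_smul_right,
        ContinuousLinearMap.comp_apply, ContinuousLinearMap.adjoint_inner_right, add_sub_cancel_right]
    · have h1 := hco u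
      rw [hu, ContinuousLinearMap.adjoint_inner_right] at h1
      have h2 : (inner ℂ (J u) ψ).re ≤ ‖J‖ * ‖u‖ * ‖ψ‖ :=
        ((Complex.re_le_norm _).trans (norm_inner_le_norm _ _)).trans (by
          gcongr; exact J.le_opNorm u)
      rcases eq_or_lt_of_le (norm_nonneg u) with h0 | h0
      · rw [← h0]; simp; positivity
      · nlinarith
  have hmemdom : ∀ p ∈ G, ∃ x : G.toLinearPMap.domain, (x : H) = p.1 ∧ G.toLinearPMap x = p.2 := by
    intro p hp
    rw [← hgr] at hp
    exact (LinearPMap.mem_graph_iff _).1 hp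
  have hre' : ∀ x : G.toLinearPMap.domain, 0 ≤ (inner ℂ (x : H) (G.toLinearPMap x)).re := fun x => by
    obtain ⟨u, -, hu⟩ := hin x
    rw [hu]; exact hre u
  have hsurj : ∀ a : ℝ, 1 ≤ a → ∀ ψ, ∃ x : G.toLinearPMap.domain,
      (a : ℂ) • (x : H) + G.toLinearPMap x = ψ := by
    intro a ha ψ
    obtain ⟨u, hu, -⟩ := hsol a ha ψ
    obtain ⟨x, hx, hx2⟩ := hmemdom _ hu
    exact ⟨x, by rw [hx, hx2]; exact add_sub_cancel _ _⟩
  obtain ⟨R, hRb, hRl, hRr⟩ := exists_resolvent_of_accretive hre' one_pos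
    (by simpa using hsurj 1 le_rfl)
  simp only [Complex.ofReal_one, one_smul] at hRl hRr
  -- If ψ is orthogonal to the domain, the solution u for a = 1 satisfies ⟪u, (L + J*J)u⟫ = ⟪Ju, ψ⟫
  -- = 0. Hence u = 0, then J*ψ = 0, and ψ = 0.
  have hdense : Dense (G.toLinearPMap.domain : Set H) := by
    rw [Submodule.dense_iff_topologicalClosure_eq_top, Submodule.topologicalClosure_eq_top_iff,
      Submodule.eq_bot_iff]
    intro ψ hψ
    obtain ⟨u, hu, -, hu3⟩ := hsol 1 le_rfl ψ
    obtain ⟨x, hx, -⟩ := hmemdom _ hu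
    have h1 : inner ℂ (J u) ψ = 0 := by
      have := (Submodule.mem_orthogonal _ _).1 hψ _ x.2
      rwa [hx] at this
    have h2 := (hGmem _ _).1 hu
    obtain ⟨w, hw, hw2⟩ := h2
    have h3 : inner ℂ u ((L + ((1 : ℝ) : ℂ) • (J.adjoint ∘L J)) u) = 0 := by
      rw [hu3, ContinuousLinearMap.adjoint_inner_right, h1]
    have e : inner ℂ u ((L + ((1 : ℝ) : ℂ) • (J.adjoint ∘L J)) u) =
        inner ℂ u (L u) + inner ℂ (J u) (J u) := by
      simp [inner_add_right, ContinuousLinearMap.adjoint_inner_right]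
    have e2 : (inner ℂ (J u) (J u)).re = ‖J u‖ ^ 2 := inner_self_eq_norm_sq (𝕜 := ℂ) _
    have h4 := hell u
    rw [← e2, ← Complex.add_re, ← e, h3, Complex.zero_re] at h4
    have hu0 : u = 0 := hzero u (by nlinarith)
    refine horth ψ fun v => ?_
    rw [← ContinuousLinearMap.adjoint_inner_right, ← hu3, hu0]; simp
  -- R factors through J: it sends the unit ball into the J-image of the ball of radius ‖J‖/c.
  have hcompact : IsCompactOperator R := by
    choose s hs1 hs2 _ using hsol 1 le_rfl
    have hRs : ∀ ψ, R ψ = J (s ψ) := by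
      intro ψ
      obtain ⟨x, hx, hx2⟩ := hmemdom _ (hs1 ψ)
      have := hRl x
      rw [hx2, hx] at this
      simpa using this
    obtain ⟨K, hK, hKJ⟩ := hJ.image_closedBall_subset_compact (f := (J : V →ₗ[ℂ] H)) (‖J‖ / c)
    refine (isCompactOperator_iff_exists_mem_nhds_image_subset_compact R).2
      ⟨Metric.closedBall 0 1, Metric.closedBall_mem_nhds 0 one_pos, K, hK, ?_⟩
    rintro _ ⟨ψ, hψ, rfl⟩
    rw [hRs]
    refine hKJ ⟨s ψ, ?_, rfl⟩
    rw [mem_closedBall_zero_iff] at hψ ⊢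
    rw [le_div_iff₀ hc, mul_comm]
    refine (hs2 ψ).trans ?_
    exact mul_le_of_le_one_right (norm_nonneg _) hψ
  refine ⟨G.toLinearPMap, ?_, hdense, fun φ ψ => by rw [hgr, hGmem], ?_, ?_, ?_⟩
  -- Membership in the graph is equivalent to a continuous equation, with R = (1 + A)⁻¹, so the
  -- graph is closed.
  · have : (G.toLinearPMap.graph : Set (H × H)) = {p | R (p.1 + p.2) = p.1} := by
      ext ⟨φ, ψ⟩
      constructor
      · intro h
        obtain ⟨x, hx, hx2⟩ := (LinearPMap.mem_graph_iff _).1 h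
        have := hRl x
        rw [hx, hx2] at this
        exact this
      · intro h
        obtain ⟨x, hx, hx2⟩ := hRr (φ + ψ)
        have h' : R (φ + ψ) = φ := h
        rw [h'] at hx
        refine (LinearPMap.mem_graph_iff _).2 ⟨x, hx, ?_⟩
        rw [hx] at hx2
        exact add_left_cancel hx2
    rw [LinearPMap.IsClosed, this]
    exact isClosed_eq (R.continuous.comp (continuous_fst.add continuous_snd)) continuous_fst
  · refine exists_analyticSemigroup hdense hC hre' (fun x => ?_) fun k =>
      hsurj _ (by linarith [(Nat.cast_nonneg k : (0 : ℝ) ≤ k)])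
    obtain ⟨u, -, hu⟩ := hin x
    rw [hu]; exact him u
  · refine ⟨-1, -R, fun ψ => ?_, fun x => ?_⟩
    · obtain ⟨x, hx, hx2⟩ := hRr (-ψ)
      refine ⟨x, by rw [hx]; simp, ?_⟩
      rw [neg_smul, one_smul, ← neg_add', hx2, neg_neg]
    · have := hRl x
      rw [neg_smul, one_smul, ← neg_add', _root_.neg_apply, map_neg, neg_neg, this]
  · intro z S hS
    -- The resolvent identity between z and -1, which transfers compactness from R to every other
    -- resolvent.
    have : S = R ∘L ((1 + z) • S - ContinuousLinearMap.id ℂ H) := by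
      ext ψ
      obtain ⟨x, hx, hx2⟩ := hS.1 ψ
      have h1 := hRl x
      have h2 : (x : H) + G.toLinearPMap x = (1 + z) • S ψ - ψ := by
        rw [← hx, ← hx2, add_smul, one_smul]; abel
      rw [h2] at h1
      rw [← hx, ← h1]
      rfl
    rw [this]
    exact hcompact.comp_clm _

end Form

end

end DynBC

namespace DynBC

noncomputable section

/-! ### Inequalities for lower integrals -/

theorem ENNReal.add_sq_le_two_mul (a b : ℝ≥0∞) : (a + b) ^ 2 ≤ 2 * a ^ 2 + 2 * b ^ 2 := by
  rcases eq_or_ne a ⊤ with rfl | ha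
  · simp
  rcases eq_or_ne b ⊤ with rfl | hb
  · simp
  lift a to ℝ≥0 using ha
  lift b to ℝ≥0 using hb
  rw [← mul_add]
  exact_mod_cast add_sq_le (a := a) (b := b)

/-- The Cauchy–Schwarz inequality against the constant 1. -/
theorem sq_lintegral_le {α : Type*} [MeasurableSpace α] (μ : Measure α) {f : α → ℝ≥0∞}
    (hf : AEMeasurable f μ) : (∫⁻ a, f a ∂μ) ^ 2 ≤ μ univ * ∫⁻ a, f a ^ 2 ∂μ := by
  have h := ENNReal.lintegral_mul_le_Lp_mul_Lq μ Real.HolderConjugate.two_two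
    (f := fun _ => 1) (g := f) aemeasurable_const hf
  have h2 := pow_le_pow_left₀ (zero_le) h 2
  simp only [Pi.mul_apply, one_mul, ENNReal.one_rpow, lintegral_const, mul_pow] at h2
  refine h2.trans (le_of_eq ?_)
  rw [← ENNReal.rpow_natCast, ← ENNReal.rpow_natCast, ← ENNReal.rpow_mul, ← ENNReal.rpow_mul]
  norm_num

/-! ### Upper gradients -/

/-- `g` is an upper gradient of `v` along Lipschitz curves in `O`. -/
def IsUpperGradientOn {E : Type*} [PseudoEMetricSpace E] (v : E → ℂ) (g : E → ℝ≥0∞) (O : Set E) :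
    Prop :=
  ∀ (γ : ℝ → E) (L : ℝ≥0), LipschitzWith L γ → ∀ a b, a ≤ b → (∀ t ∈ Icc a b, γ t ∈ O) →
    ‖v (γ b) - v (γ a)‖ₑ ≤ L * ∫⁻ t in Icc a b, g (γ t)

/-- T ∘ γ is again a Lipschitz curve, with constant KL. This replaces the chain rule under
coordinate changes that are merely Lipschitz. -/
theorem IsUpperGradientOn.comp {E F : Type*} [PseudoEMetricSpace E] [PseudoEMetricSpace F]
    {v : E → ℂ} {g : E → ℝ≥0∞} {O : Set E} (h : IsUpperGradientOn v g O) {T : F → E} {K : ℝ≥0}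
    (hT : LipschitzWith K T) {O' : Set F} (hO : MapsTo T O' O) :
    IsUpperGradientOn (v ∘ T) (fun x => K * g (T x)) O' := by
  intro γ L hγ a b hab hmem
  have h1 := h (T ∘ γ) (K * L) (hT.comp hγ) a b hab fun t ht => hO (hmem t ht)
  refine h1.trans (le_of_eq ?_)
  rw [lintegral_const_mul' _ _ ENNReal.coe_ne_top, ENNReal.coe_mul]
  simp only [Function.comp_apply]
  ring

/-- The real function ‖v(γ t) - v(γ a)‖ is Lipschitz, hence the integral of its derivative. Near γ t
the function v is Lipschitz with every constant above ‖Dv(γ t)‖, which bounds that derivative even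
where γ is not differentiable. -/
theorem isUpperGradientOn_fderiv {E : Type*} [NormedAddCommGroup E] [NormedSpace ℝ E]
    {v : E → ℂ} {O : Set E} (hv : ∀ x ∈ O, ContDiffAt ℝ 1 v x) :
    IsUpperGradientOn v (fun x => ‖fderiv ℝ v x‖ₑ) O := by
  intro γ L hγ a b hab hmem
  have hloc : LocallyLipschitzOn (Icc a b) (v ∘ γ) := by
    intro t ht
    obtain ⟨K, s, hs, hK⟩ := (hv _ (hmem t ht)).exists_lipschitzOnWith
    refine ⟨K * L, γ ⁻¹' s,
      mem_nhdsWithin_of_mem_nhds (hγ.continuous.continuousAt.preimage_mem_nhds hs), ?_⟩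
    exact hK.comp hγ.lipschitzOnWith fun _ h => h
  obtain ⟨M, hM⟩ := hloc.exists_lipschitzOnWith_of_compact isCompact_Icc
  set f : ℝ → ℝ := fun t => ‖v (γ t) - v (γ a)‖ with hf
  have hfL : LipschitzOnWith M f (uIcc a b) := by
    rw [uIcc_of_le hab]
    intro s hs t ht
    refine le_trans ?_ (hM hs ht)
    rw [edist_dist, edist_dist]
    refine ENNReal.ofReal_le_ofReal ?_
    rw [Real.dist_eq, dist_eq_norm]
    refine (abs_norm_sub_norm_le _ _).trans (le_of_eq ?_)
    congr 1
    simp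
  have hint := hfL.absolutelyContinuousOnInterval.integral_deriv_eq_sub
  have hder : ∀ t ∈ Icc a b, ‖deriv f t‖ ≤ L * ‖fderiv ℝ v (γ t)‖ := by
    intro t ht
    have hle : ∀ C : ℝ≥0, ‖fderiv ℝ v (γ t)‖₊ < C → ‖deriv f t‖ ≤ L * C := by
      intro C hC
      obtain ⟨s, hs, hsL⟩ := ((hv _ (hmem t ht)).hasStrictFDerivAt
        one_ne_zero).exists_lipschitzOnWith_of_nnnorm_lt C hC
      refine norm_deriv_le_of_lip' (by positivity) ?_
      filter_upwards [hγ.continuous.continuousAt.preimage_mem_nhds hs] with r hr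
      have h1 := hsL.dist_le_mul _ hr _ (mem_of_mem_nhds hs)
      have h2 := hγ.dist_le_mul r t
      have h3 : ‖f r - f t‖ ≤ dist (v (γ r)) (v (γ t)) := by
        rw [dist_eq_norm]
        refine (abs_norm_sub_norm_le _ _).trans (le_of_eq ?_)
        congr 1
        simp
      rw [← dist_eq_norm r t]
      calc ‖f r - f t‖ ≤ C * dist (γ r) (γ t) := h3.trans h1
        _ ≤ C * (L * dist r t) := by gcongr
        _ = L * C * dist r t := by ring
    have : Tendsto (fun ε : ℝ≥0 => (L : ℝ) * ((‖fderiv ℝ v (γ t)‖₊ + ε : ℝ≥0) : ℝ)) (𝓝[>] 0)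
        (𝓝 (L * ((‖fderiv ℝ v (γ t)‖₊ + 0 : ℝ≥0) : ℝ))) := by
      refine Tendsto.mono_left (Continuous.tendsto ?_ 0) nhdsWithin_le_nhds
      fun_prop
    rw [add_zero] at this
    refine ge_of_tendsto this ?_
    filter_upwards [self_mem_nhdsWithin] with ε hε
    exact hle _ (lt_add_of_pos_right _ hε)
  have e1 : ‖v (γ b) - v (γ a)‖ₑ = ‖f b - f a‖ₑ := by
    simp [hf]
  rw [e1, ← hint, intervalIntegral.integral_of_le hab, ← lintegral_const_mul' _ _ ENNReal.coe_ne_top]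
  refine (enorm_integral_le_lintegral_enorm _).trans ?_
  refine (lintegral_mono_set Ioc_subset_Icc_self).trans ?_
  refine setLIntegral_mono' measurableSet_Icc fun t ht => ?_
  have := hder t ht
  change ‖deriv f t‖ₑ ≤ L * ‖fderiv ℝ v (γ t)‖ₑ
  rw [← ofReal_norm, ← ofReal_norm, ← ENNReal.ofReal_coe_nnreal,
    ← ENNReal.ofReal_mul (by positivity)]
  exact ENNReal.ofReal_le_ofReal this

/-! ### Change of variables with Lipschitz left inverses -/

section ChangeOfVariables

variable {X Y : Type*} [EMetricSpace X] [MeasurableSpace X] [BorelSpace X]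
  [EMetricSpace Y] [MeasurableSpace Y] [BorelSpace Y]

theorem euclideanHausdorffMeasure_image_le {K : ℝ≥0} {R : Y → X} {s : Set Y}
    (hR : LipschitzOnWith K R s) (k : ℕ) :
    (Measure.euclideanHausdorffMeasure k : Measure X) (R '' s) ≤
      (K : ℝ≥0∞) ^ k * (Measure.euclideanHausdorffMeasure k : Measure Y) s := by
  simp only [Measure.euclideanHausdorffMeasure_def, Measure.smul_apply]
  have h := hR.hausdorffMeasure_image_le (d := (k : ℝ)) (by positivity)
  rw [ENNReal.rpow_natCast] at h
  simp only [ENNReal.smul_def, smul_eq_mul]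
  calc _ ≤ _ * ((K : ℝ≥0∞) ^ k * Measure.hausdorffMeasure k s) := by gcongr
    _ = _ := by ring

/-- The part of s that T sends into A is covered by R(A ∩ B), so the image measure is at most K^k
times the target measure. Only the left inverse has to be Lipschitz, and no Jacobian enters. -/
theorem lintegral_comp_le {K : ℝ≥0} {T : X → Y} (hT : Measurable T) {R : Y → X}
    (hR : LipschitzWith K R) {s : Set X} (hs : ∀ p ∈ s, R (T p) = p) {B : Set Y}
    (hB : MapsTo T s B) (k : ℕ) {f : Y → ℝ≥0∞} (hf : Measurable f) :
    ∫⁻ p in s, f (T p) ∂(Measure.euclideanHausdorffMeasure k) ≤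
      (K : ℝ≥0∞) ^ k * ∫⁻ y in B, f y ∂(Measure.euclideanHausdorffMeasure k) := by
  have hle : ((Measure.euclideanHausdorffMeasure k).restrict s).map T ≤
      ((K : ℝ≥0∞) ^ k) • (Measure.euclideanHausdorffMeasure k).restrict B := by
    refine Measure.le_iff.2 fun A hA => ?_
    rw [Measure.map_apply hT hA, Measure.restrict_apply (hT hA), Measure.smul_apply,
      Measure.restrict_apply hA, smul_eq_mul]
    refine le_trans (measure_mono ?_)
      (euclideanHausdorffMeasure_image_le (hR.lipschitzOnWith (s := A ∩ B)) k)
    rintro p ⟨hp, hps⟩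
    exact ⟨T p, ⟨hp, hB hps⟩, hs p hps⟩
  rw [← lintegral_map hf hT]
  refine (lintegral_mono' hle le_rfl).trans (le_of_eq ?_)
  rw [lintegral_smul_measure, smul_eq_mul]

theorem setLIntegral_comp_le {m : ℕ} {K : ℝ≥0}
    {T R : EuclideanSpace ℝ (Fin m) → EuclideanSpace ℝ (Fin m)} (hT : Measurable T)
    (hR : LipschitzWith K R) {s B : Set (EuclideanSpace ℝ (Fin m))} (hs : ∀ p ∈ s, R (T p) = p)
    (hB : MapsTo T s B) {f : EuclideanSpace ℝ (Fin m) → ℝ≥0∞} (hf : Measurable f) :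
    ∫⁻ p in s, f (T p) ≤ (K : ℝ≥0∞) ^ m * ∫⁻ y in B, f y := by
  have h := lintegral_comp_le hT hR hs hB m hf
  simpa only [EuclideanSpace.euclideanHausdorffMeasure_eq_volume] using h

end ChangeOfVariables

/-! ### The Poincaré inequality on small convex sets -/

/-- By convexity |v(p) - v(q)|² is at most δ² times the integral of g² along the segment from p to
q. Integration over P × P controls the deviation from the mean, and the mean stays as a separate
term. -/
theorem setLIntegral_enorm_sq_le {m : ℕ} {P : Set (EuclideanSpace ℝ (Fin m))} (hP : Convex ℝ P)
    (hPm : MeasurableSet P) (hPf : volume P ≠ ⊤) {δ : ℝ≥0} (hδ : ∀ p ∈ P, ∀ q ∈ P, dist p q ≤ δ)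
    {v : EuclideanSpace ℝ (Fin m) → ℂ} (hvm : Measurable v) (hv : IntegrableOn v P)
    {g : EuclideanSpace ℝ (Fin m) → ℝ≥0∞} (hg : Measurable g) (hvg : IsUpperGradientOn v g P) :
    ∫⁻ p in P, ‖v p‖ₑ ^ 2 ≤ 2 * (volume P)⁻¹ * ‖∫ p in P, v p‖ₑ ^ 2 +
      2 ^ (m + 1) * (δ : ℝ≥0∞) ^ 2 * ∫⁻ p in P, g p ^ 2 := by
  rcases eq_or_ne (volume P) 0 with h0 | h0
  · rw [Measure.restrict_eq_zero.2 h0]; simp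
  have : IsFiniteMeasure (volume.restrict P) := ⟨by simpa using hPf.lt_top⟩
  have hm : Measurable fun z : (EuclideanSpace ℝ (Fin m) × EuclideanSpace ℝ (Fin m)) × ℝ =>
      g (z.1.1 + z.2 • (z.1.2 - z.1.1)) ^ 2 := by
    have : Measurable fun z : (EuclideanSpace ℝ (Fin m) × EuclideanSpace ℝ (Fin m)) × ℝ =>
      z.1.1 + z.2 • (z.1.2 - z.1.1) := by fun_prop
    exact (hg.comp this).pow_const 2
  set I := ∫⁻ p in P, g p ^ 2 with hI
  have hseg : ∀ p ∈ P, ∀ q ∈ P, ‖v p - v q‖ₑ ^ 2 ≤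
      (δ : ℝ≥0∞) ^ 2 * ∫⁻ t in Icc (0 : ℝ) 1, g (p + t • (q - p)) ^ 2 := by
    intro p hp q hq
    have hL : LipschitzWith δ fun t : ℝ => p + t • (q - p) := by
      refine LipschitzWith.of_dist_le_mul fun s t => ?_
      rw [dist_add_left, dist_eq_norm, ← sub_smul, norm_smul, mul_comm, ← dist_eq_norm s t,
        ← dist_eq_norm q p]
      gcongr
      exact hδ q hq p hp
    have h1 := hvg _ δ hL 0 1 zero_le_one fun t ht => by
      have : p + t • (q - p) = AffineMap.lineMap p q t := by
        simp [AffineMap.lineMap_apply, add_comm]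
      rw [this]
      exact hP.lineMap_mem hp hq ht
    simp only [one_smul, add_sub_cancel, zero_smul, add_zero] at h1
    have hmt : Measurable fun t : ℝ => g (p + t • (q - p)) :=
      hg.comp (by fun_prop)
    rw [← enorm_neg, neg_sub]
    calc ‖v q - v p‖ₑ ^ 2 ≤ (δ * ∫⁻ t in Icc (0 : ℝ) 1, g (p + t • (q - p))) ^ 2 := by gcongr
      _ = (δ : ℝ≥0∞) ^ 2 * (∫⁻ t in Icc (0 : ℝ) 1, g (p + t • (q - p))) ^ 2 := mul_pow _ _ _
      _ ≤ _ := by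
        gcongr
        refine (sq_lintegral_le _ hmt.aemeasurable).trans (le_of_eq ?_)
        simp
  -- For fixed t the substitution is made in the variable with coefficient at least 1/2: p if t ≤
  -- 1/2, and q otherwise. The inverse affine map is then 2-Lipschitz, whence the factor 2^m.
  have hslice : ∀ t ∈ Icc (0 : ℝ) 1,
      ∫⁻ p in P, ∫⁻ q in P, g (p + t • (q - p)) ^ 2 ≤ volume P * (2 ^ m * I) := by
    intro t ht
    have hmt : Measurable fun z : EuclideanSpace ℝ (Fin m) × EuclideanSpace ℝ (Fin m) =>
        g (z.1 + t • (z.2 - z.1)) ^ 2 := by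
      have : Measurable fun z : EuclideanSpace ℝ (Fin m) × EuclideanSpace ℝ (Fin m) =>
        z.1 + t • (z.2 - z.1) := by fun_prop
      exact (hg.comp this).pow_const 2
    have hmaps : ∀ p ∈ P, ∀ q ∈ P, p + t • (q - p) ∈ P := fun p hp q hq => by
      have : p + t • (q - p) = AffineMap.lineMap p q t := by
        simp [AffineMap.lineMap_apply, add_comm]
      rw [this]
      exact hP.lineMap_mem hp hq ht
    have hconst : ∀ F : EuclideanSpace ℝ (Fin m) → ℝ≥0∞, (∀ p ∈ P, F p ≤ 2 ^ m * I) →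
        ∫⁻ p in P, F p ≤ volume P * (2 ^ m * I) := fun F hF => by
      refine (setLIntegral_mono' hPm hF).trans (le_of_eq ?_)
      rw [setLIntegral_const, mul_comm]
    have hinv : ∀ r : ℝ, 1 / 2 ≤ r → ∀ w : EuclideanSpace ℝ (Fin m),
        LipschitzWith 2 fun y : EuclideanSpace ℝ (Fin m) => r⁻¹ • (y - w) := by
      intro r hr w
      refine LipschitzWith.of_dist_le_mul fun x y => ?_
      rw [dist_smul₀, dist_sub_right, Real.norm_of_nonneg (by positivity)]
      gcongr
      rw [inv_le_comm₀ (by linarith) (by norm_num)]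
      simpa using hr
    rcases le_total t (1 / 2) with h | h
    · rw [lintegral_lintegral_swap hmt.aemeasurable]
      refine hconst _ fun q hq => ?_
      refine setLIntegral_comp_le (f := fun y => g y ^ 2) (K := 2)
        (R := fun y => (1 - t)⁻¹ • (y - t • q)) (by fun_prop) (hinv _ (by linarith) _)
        (fun p _ => ?_) (fun p hp => hmaps p hp q hq) (hg.pow_const 2)
      have : p + t • (q - p) - t • q = (1 - t) • p := by
        rw [smul_sub, sub_smul, one_smul]; abel
      rw [this, smul_smul, inv_mul_cancel₀ (by linarith), one_smul]
    · refine hconst _ fun p hp => ?_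
      refine setLIntegral_comp_le (f := fun y => g y ^ 2) (K := 2)
        (R := fun y => t⁻¹ • (y - (1 - t) • p)) (by fun_prop) (hinv _ h _)
        (fun q _ => ?_) (fun q hq => hmaps p hp q hq) (hg.pow_const 2)
      have : p + t • (q - p) - (1 - t) • p = t • q := by
        rw [smul_sub, sub_smul, one_smul]; abel
      rw [this, smul_smul, inv_mul_cancel₀ (by linarith), one_smul]
  have hdouble : ∫⁻ p in P, ∫⁻ q in P, ‖v p - v q‖ₑ ^ 2 ≤
      (δ : ℝ≥0∞) ^ 2 * (volume P * (2 ^ m * I)) := by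
    calc ∫⁻ p in P, ∫⁻ q in P, ‖v p - v q‖ₑ ^ 2
        ≤ ∫⁻ p in P, ∫⁻ q in P,
          (δ : ℝ≥0∞) ^ 2 * ∫⁻ t in Icc (0 : ℝ) 1, g (p + t • (q - p)) ^ 2 :=
          setLIntegral_mono' hPm fun p hp => setLIntegral_mono' hPm fun q hq => hseg p hp q hq
      _ = (δ : ℝ≥0∞) ^ 2 * ∫⁻ p in P, ∫⁻ q in P, ∫⁻ t in Icc (0 : ℝ) 1,
          g (p + t • (q - p)) ^ 2 := by
          have hne : (δ : ℝ≥0∞) ^ 2 ≠ ⊤ := ENNReal.pow_ne_top ENNReal.coe_ne_top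
          rw [← lintegral_const_mul' _ _ hne]
          simp only [lintegral_const_mul' _ _ hne]
      _ = (δ : ℝ≥0∞) ^ 2 * ∫⁻ t in Icc (0 : ℝ) 1, ∫⁻ p in P, ∫⁻ q in P,
          g (p + t • (q - p)) ^ 2 := by
          congr 1
          rw [lintegral_lintegral_swap (f := fun (t : ℝ) p => ∫⁻ q in P, g (p + t • (q - p)) ^ 2)]
          · refine lintegral_congr fun p => ?_
            rw [lintegral_lintegral_swap]
            have : Measurable fun z : ℝ × EuclideanSpace ℝ (Fin m) =>
                g (p + z.1 • (z.2 - p)) ^ 2 :=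
              (hg.comp (by fun_prop)).pow_const 2
            exact (this.comp measurable_swap).aemeasurable
          · have : Measurable fun z : (ℝ × EuclideanSpace ℝ (Fin m)) × EuclideanSpace ℝ (Fin m) =>
                g (z.1.2 + z.1.1 • (z.2 - z.1.2)) ^ 2 :=
              (hg.comp (by fun_prop)).pow_const 2
            exact this.lintegral_prod_right'.aemeasurable
      _ ≤ (δ : ℝ≥0∞) ^ 2 * ∫⁻ t in Icc (0 : ℝ) 1, volume P * (2 ^ m * I) := by
          exact mul_le_mul' le_rfl (setLIntegral_mono' measurableSet_Icc hslice)
      _ = _ := by simp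
  -- |P| v(p) is the integral of v plus the integral of v(p) - v(q) over q in P.
  have hpt : ∀ p : EuclideanSpace ℝ (Fin m), volume P ^ 2 * ‖v p‖ₑ ^ 2 ≤
      2 * ‖∫ q in P, v q‖ₑ ^ 2 + 2 * (volume P * ∫⁻ q in P, ‖v p - v q‖ₑ ^ 2) := by
    intro p
    have e : (volume.real P : ℂ) * v p = (∫ q in P, v q) + ∫ q in P, (v p - v q) := by
      rw [integral_sub (integrable_const _) hv]
      simp [Complex.real_smul]
    have e2 : volume P * ‖v p‖ₑ = ‖(volume.real P : ℂ) * v p‖ₑ := by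
      rw [enorm_mul]
      congr 1
      rw [← ofReal_norm, Complex.norm_real, Real.norm_of_nonneg measureReal_nonneg,
        measureReal_def, ENNReal.ofReal_toReal hPf]
    rw [← mul_pow, e2, e]
    calc ‖(∫ q in P, v q) + ∫ q in P, (v p - v q)‖ₑ ^ 2
        ≤ (‖∫ q in P, v q‖ₑ + ∫⁻ q in P, ‖v p - v q‖ₑ) ^ 2 := by
          gcongr
          exact (enorm_add_le _ _).trans (add_le_add le_rfl (enorm_integral_le_lintegral_enorm _))
      _ ≤ 2 * ‖∫ q in P, v q‖ₑ ^ 2 + 2 * (∫⁻ q in P, ‖v p - v q‖ₑ) ^ 2 :=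
          ENNReal.add_sq_le_two_mul _ _
      _ ≤ _ := by
          gcongr
          refine (sq_lintegral_le _ ?_).trans (le_of_eq ?_)
          · exact ((measurable_const.sub hvm).enorm).aemeasurable
          · simp
  have htot : volume P ^ 2 * ∫⁻ p in P, ‖v p‖ₑ ^ 2 ≤
      volume P * (2 * ‖∫ q in P, v q‖ₑ ^ 2) +
        2 * (volume P * ((δ : ℝ≥0∞) ^ 2 * (volume P * (2 ^ m * I)))) := by
    calc volume P ^ 2 * ∫⁻ p in P, ‖v p‖ₑ ^ 2 = ∫⁻ p in P, volume P ^ 2 * ‖v p‖ₑ ^ 2 :=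
          (lintegral_const_mul' _ _ (ENNReal.pow_ne_top hPf)).symm
      _ ≤ ∫⁻ p in P, (2 * ‖∫ q in P, v q‖ₑ ^ 2 +
          2 * (volume P * ∫⁻ q in P, ‖v p - v q‖ₑ ^ 2)) := lintegral_mono fun p => hpt p
      _ = volume P * (2 * ‖∫ q in P, v q‖ₑ ^ 2) +
          2 * (volume P * ∫⁻ p in P, ∫⁻ q in P, ‖v p - v q‖ₑ ^ 2) := by
          rw [lintegral_add_left measurable_const, setLIntegral_const, mul_comm (volume P)]
          congr 1
          rw [lintegral_const_mul' _ _ (by simp), lintegral_const_mul' _ _ hPf]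
      _ ≤ _ := by gcongr
  have hcancel : volume P * (volume P)⁻¹ = 1 := ENNReal.mul_inv_cancel h0 hPf
  rw [← ENNReal.mul_le_mul_iff_right (pow_ne_zero 2 h0) (ENNReal.pow_ne_top hPf)]
  refine htot.trans (le_of_eq ?_)
  rw [mul_add]
  congr 1
  · calc volume P * (2 * ‖∫ q in P, v q‖ₑ ^ 2)
        = (volume P * (volume P)⁻¹) * (volume P * (2 * ‖∫ q in P, v q‖ₑ ^ 2)) := by
          rw [hcancel, one_mul]
      _ = _ := by ring
  · ring

/-! ### The trace inequality on a segment -/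

/-- |f(0)|² is at most 2|f(s)|² plus an energy term; integration over s in [0, δ] gives the claim.
The energy carries δ² against a single δ on the left, so its weight becomes small with δ. -/
theorem ofReal_mul_enorm_sq_le {f : ℝ → ℂ} (hf : Measurable f) {g : ℝ → ℝ≥0∞} (hg : Measurable g)
    {δ : ℝ} (hδ : 0 ≤ δ) {L : ℝ≥0}
    (h : ∀ s ∈ Icc 0 δ, ‖f s - f 0‖ₑ ≤ L * ∫⁻ t in Icc 0 s, g t) :
    ENNReal.ofReal δ * ‖f 0‖ₑ ^ 2 ≤ 2 * (∫⁻ t in Icc 0 δ, ‖f t‖ₑ ^ 2) +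
      2 * (L : ℝ≥0∞) ^ 2 * ENNReal.ofReal δ ^ 2 * ∫⁻ t in Icc 0 δ, g t ^ 2 := by
  have hb : ∀ s ∈ Icc 0 δ, ‖f 0‖ₑ ^ 2 ≤ 2 * ‖f s‖ₑ ^ 2 +
      2 * ((L : ℝ≥0∞) ^ 2 * (ENNReal.ofReal δ * ∫⁻ t in Icc 0 δ, g t ^ 2)) := by
    intro s hs
    have h1 : ‖f 0‖ₑ ≤ ‖f s‖ₑ + L * ∫⁻ t in Icc 0 δ, g t := by
      have e : f 0 = f s - (f s - f 0) := by abel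
      rw [e]
      refine (enorm_sub_le).trans (add_le_add le_rfl ((h s hs).trans ?_))
      gcongr
      exact hs.2
    calc ‖f 0‖ₑ ^ 2 ≤ (‖f s‖ₑ + L * ∫⁻ t in Icc 0 δ, g t) ^ 2 := by gcongr
      _ ≤ 2 * ‖f s‖ₑ ^ 2 + 2 * (L * ∫⁻ t in Icc 0 δ, g t) ^ 2 := ENNReal.add_sq_le_two_mul _ _
      _ ≤ _ := by
        rw [mul_pow]
        gcongr
        refine (sq_lintegral_le _ hg.aemeasurable).trans (le_of_eq ?_)
        simp
  have h2 := setLIntegral_mono' (μ := volume) measurableSet_Icc hb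
  rw [lintegral_add_left ((hf.enorm.pow_const 2).const_mul 2), setLIntegral_const,
    setLIntegral_const, lintegral_const_mul' _ _ (by simp), Real.volume_Icc, sub_zero] at h2
  rw [mul_comm]
  refine h2.trans (le_of_eq ?_)
  ring

end

end DynBC

namespace DynBC

noncomputable section

/-! ### The splitting `ℝ^d = ℝ^(d-1) × ℝ` -/

/-- The point `(y, t)` of `ℝ^d`. -/
def emb {n : ℕ} (y : Rp n) (t : ℝ) : Rd n := WithLp.toLp 2 (Fin.snoc (fun i => y i) t)

/-- The first `d - 1` coordinates. -/
def proj {n : ℕ} (z : Rd n) : Rp n := WithLp.toLp 2 fun i => z i.castSucc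

section Splitting

variable {n : ℕ}

@[simp] theorem emb_last (y : Rp n) (t : ℝ) : emb y t (Fin.last n) = t := by simp [emb]

@[simp] theorem emb_castSucc (y : Rp n) (t : ℝ) (i : Fin n) : emb y t i.castSucc = y i := by
  simp [emb]

@[simp] theorem proj_apply (z : Rd n) (i : Fin n) : proj z i = z i.castSucc := rfl

@[simp] theorem proj_emb (y : Rp n) (t : ℝ) : proj (emb y t) = y := by
  ext i; simp

theorem emb_proj (z : Rd n) : emb (proj z) (z (Fin.last n)) = z := by
  ext i
  refine Fin.lastCases ?_ (fun j => ?_) i <;> simp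

theorem dist_emb_sq (y y' : Rp n) (t t' : ℝ) :
    dist (emb y t) (emb y' t') ^ 2 = dist y y' ^ 2 + dist t t' ^ 2 := by
  rw [EuclideanSpace.dist_eq, EuclideanSpace.dist_eq, Real.sq_sqrt (by positivity),
    Real.sq_sqrt (by positivity), Fin.sum_univ_castSucc]
  simp

theorem dist_emb_left (y y' : Rp n) (t : ℝ) : dist (emb y t) (emb y' t) = dist y y' := by
  have h := dist_emb_sq y y' t t
  rw [dist_self, zero_pow two_ne_zero, add_zero] at h
  exact (pow_left_inj₀ dist_nonneg dist_nonneg two_ne_zero).1 h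

theorem dist_emb_right (y : Rp n) (t t' : ℝ) : dist (emb y t) (emb y t') = dist t t' := by
  have h := dist_emb_sq y y t t'
  rw [dist_self, zero_pow two_ne_zero, zero_add] at h
  exact (pow_left_inj₀ dist_nonneg dist_nonneg two_ne_zero).1 h

theorem lipschitzWith_emb_left (t : ℝ) : LipschitzWith 1 fun y : Rp n => emb y t :=
  LipschitzWith.of_dist_le_mul fun y y' => by simp [dist_emb_left]

theorem lipschitzWith_emb_right (y : Rp n) : LipschitzWith 1 (emb y) :=
  LipschitzWith.of_dist_le_mul fun t t' => by simp [dist_emb_right]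

theorem lipschitzWith_proj : LipschitzWith 1 (proj : Rd n → Rp n) :=
  LipschitzWith.of_dist_le_mul fun z w => by
    have h := dist_emb_sq (proj z) (proj w) (z (Fin.last n)) (w (Fin.last n))
    rw [emb_proj, emb_proj] at h
    rw [NNReal.coe_one, one_mul]
    exact le_of_sq_le_sq (by rw [h]; exact le_add_of_nonneg_right (sq_nonneg _)) dist_nonneg

@[simp] theorem emb_zero : emb (0 : Rp n) 0 = 0 := by
  ext i
  refine Fin.lastCases ?_ (fun j => ?_) i <;> simp

theorem norm_emb_le (y : Rp n) (t : ℝ) : ‖emb y t‖ ≤ ‖y‖ + |t| := by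
  have h1 := dist_triangle (emb y t) (emb y 0) (emb 0 0)
  rw [dist_emb_left, dist_emb_right, emb_zero, dist_zero_right, dist_zero_right, dist_zero_right,
    Real.norm_eq_abs] at h1
  linarith

theorem norm_proj_le (z : Rd n) : ‖proj z‖ ≤ ‖z‖ := by
  have := lipschitzWith_proj.dist_le_mul z 0
  have h0 : proj (0 : Rd n) = 0 := by ext i; simp
  simpa [h0] using this

theorem continuous_emb : Continuous fun q : Rp n × ℝ => emb q.1 q.2 := by
  unfold emb
  refine (PiLp.continuous_toLp 2 _).comp (continuous_pi fun i => ?_)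
  refine Fin.lastCases ?_ (fun j => ?_) i
  · simpa using continuous_snd
  · simp only [Fin.snoc_castSucc]; fun_prop

theorem measurePreserving_emb :
    MeasurePreserving (fun q : Rp n × ℝ => emb q.1 q.2) (volume.prod volume) volume := by
  have h1 := (EuclideanSpace.volume_preserving_symm_measurableEquiv_toLp (Fin n)).prod
    (MeasurePreserving.id (volume : Measure ℝ))
  have h2 := (Measure.measurePreserving_swap (μ := (volume : Measure (Fin n → ℝ)))
    (ν := (volume : Measure ℝ)))
  have h3 := (volume_preserving_piFinSuccAbove (fun _ : Fin (n + 1) => ℝ) (Fin.last n)).symm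
  have h4 := (EuclideanSpace.volume_preserving_symm_measurableEquiv_toLp (Fin (n + 1))).symm
  have h := h4.comp (h3.comp (h2.comp h1))
  refine (funext fun q => ?_ : (fun q : Rp n × ℝ => emb q.1 q.2) = _) ▸ h
  ext i
  refine Fin.lastCases ?_ (fun j => ?_) i
  · simp [MeasurableEquiv.piFinSuccAbove, Fin.insertNthEquiv]
  · simp [MeasurableEquiv.piFinSuccAbove, Fin.insertNthEquiv]

/-- The reflection at the hyperplane `{z | z_d = 0}`. -/
def reflLast (n : ℕ) : Rd n ≃ₗᵢ[ℝ] Rd n :=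
  LinearIsometryEquiv.piLpCongrRight 2 fun i =>
    if i = Fin.last n then LinearIsometryEquiv.neg ℝ else LinearIsometryEquiv.refl ℝ ℝ

@[simp] theorem reflLast_last (z : Rd n) : reflLast n z (Fin.last n) = -z (Fin.last n) := by
  simp [reflLast]

@[simp] theorem reflLast_castSucc (z : Rd n) (i : Fin n) :
    reflLast n z i.castSucc = z i.castSucc := by
  simp [reflLast]

@[simp] theorem reflLast_reflLast (z : Rd n) : reflLast n (reflLast n z) = z := by
  ext i
  refine Fin.lastCases ?_ (fun j => ?_) i <;> simp

/-- Folding `ℝ^d` into the half space `{z | ε ≤ z_d}`. -/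
def fold (ε : ℝ) (z : Rd n) : Rd n := emb (proj z) (|z (Fin.last n)| + ε)

theorem lipschitzWith_fold (ε : ℝ) : LipschitzWith 1 (fold ε : Rd n → Rd n) :=
  LipschitzWith.of_dist_le_mul fun z w => by
    have h := dist_emb_sq (proj z) (proj w) (z (Fin.last n)) (w (Fin.last n))
    rw [emb_proj, emb_proj] at h
    rw [NNReal.coe_one, one_mul]
    refine le_of_sq_le_sq ?_ dist_nonneg
    rw [fold, fold, dist_emb_sq, h, dist_add_right]
    gcongr
    rw [Real.dist_eq, Real.dist_eq]
    exact abs_abs_sub_abs_le _ _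

theorem fold_of_nonneg (ε : ℝ) {z : Rd n} (hz : 0 ≤ z (Fin.last n)) : fold ε z = z + emb 0 ε := by
  ext i
  refine Fin.lastCases ?_ (fun j => ?_) i <;> simp [fold, abs_of_nonneg hz]

theorem fold_of_nonpos (ε : ℝ) {z : Rd n} (hz : z (Fin.last n) ≤ 0) :
    fold ε z = reflLast n z + emb 0 ε := by
  ext i
  refine Fin.lastCases ?_ (fun j => ?_) i <;> simp [fold, abs_of_nonpos hz]

theorem norm_fold_le {ε : ℝ} (hε : 0 ≤ ε) (z : Rd n) : ‖fold ε z‖ ≤ ‖z‖ + ε := by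
  have he : ‖(emb 0 ε : Rd n)‖ ≤ ε := by
    simpa [abs_of_nonneg hε] using norm_emb_le (0 : Rp n) ε
  rcases le_total 0 (z (Fin.last n)) with h | h
  · rw [fold_of_nonneg ε h]
    exact (norm_add_le _ _).trans (by gcongr)
  · rw [fold_of_nonpos ε h]
    refine (norm_add_le _ _).trans ?_
    rw [LinearIsometryEquiv.norm_map]
    gcongr

/-- On each closed side of the hyperplane the fold is an isometry, so each side contributes at most
the integral over B. -/
theorem setLIntegral_fold_le (ε : ℝ) {s B : Set (Rd n)}
    (hB : MapsTo (fold ε) s B) {f : Rd n → ℝ≥0∞} (hf : Measurable f) :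
    ∫⁻ z in s, f (fold ε z) ≤ 2 * ∫⁻ z in B, f z := by
  have hcov : s ⊆ s ∩ {z | 0 ≤ z (Fin.last n)} ∪ s ∩ {z | z (Fin.last n) ≤ 0} := fun z hz =>
    (le_total 0 (z (Fin.last n))).imp (fun h => ⟨hz, h⟩) fun h => ⟨hz, h⟩
  have hm : Measurable (fold ε : Rd n → Rd n) := (lipschitzWith_fold ε).continuous.measurable
  have hsub : LipschitzWith 1 fun y : Rd n => y - emb 0 ε :=
    LipschitzWith.of_dist_le_mul fun x y => by simp
  refine (lintegral_mono_set hcov).trans ((lintegral_union_le _ _ _).trans ?_)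
  rw [two_mul]
  refine add_le_add ?_ ?_
  · have := setLIntegral_comp_le (K := 1) hm hsub (s := s ∩ {z | 0 ≤ z (Fin.last n)}) (B := B)
      (fun z hz => by rw [fold_of_nonneg ε hz.2]; simp) (fun z hz => hB hz.1) hf
    simpa using this
  · have := setLIntegral_comp_le (K := 1 * 1) hm ((reflLast n).lipschitz.comp hsub)
      (s := s ∩ {z | z (Fin.last n) ≤ 0}) (B := B)
      (fun z hz => by rw [fold_of_nonpos ε hz.2]; simp) (fun z hz => hB hz.1) hf
    simpa using this

end Splitting

/-! ### Flattening maps -/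

/-- Bi-Lipschitz coordinates near `x` in which the set `A` lies in the hyperplane `{z | z_d = 0}`.
-/
structure Flattening {n : ℕ} (A : Set (Rd n)) (x : Rd n) where
  φ : Rd n → Rd n
  κ : Rd n → Rd n
  K : ℝ≥0
  r : ℝ
  one_le : 1 ≤ K
  r_pos : 0 < r
  lip_φ : LipschitzWith K φ
  lip_κ : LipschitzWith K κ
  left_inv : ∀ p ∈ Metric.ball x r, κ (φ p) = p
  right_inv : ∀ z ∈ Metric.ball 0 r, φ (κ z) = z
  map_x : φ x = 0
  flat : ∀ p ∈ A, p ∈ Metric.ball x r → φ p (Fin.last n) = 0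

/-- The chart and its inverse are Lipschitz only on W and its image; both are extended to the whole
space at the cost of a dimensional constant. As x lies in M, moving its image to the origin
preserves the hyperplane. Openness of the image gives the right inverse on a full ball. -/
theorem exists_flattening_of_submanifold {n : ℕ} {M A : Set (Rd n)} (hM : IsLipschitzSubmanifold M)
    {x : Rd n} (hx : x ∈ M) {V : Set (Rd n)} (hV : V ∈ 𝓝 x) (hA : A ∩ V ⊆ M) :
    Nonempty (Flattening A x) := by
  obtain ⟨W, φ, K, hW, hxW, hφW, hφ, hanti, himg⟩ := hM x hx
  have hinj : InjOn φ W := fun p hp q hq h => by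
    have := hanti p hp q hq
    rw [h, dist_self, mul_zero] at this
    exact dist_le_zero.1 this
  have hinv : ∀ p ∈ W, Function.invFunOn φ W (φ p) = p := fun p hp =>
    hinj.leftInvOn_invFunOn hp
  have hκ : LipschitzOnWith K (Function.invFunOn φ W) (φ '' W) := by
    refine LipschitzOnWith.of_dist_le_mul ?_
    rintro _ ⟨p, hp, rfl⟩ _ ⟨q, hq, rfl⟩
    rw [hinv p hp, hinv q hq]
    exact hanti p hp q hq
  obtain ⟨φ₁, hφ₁, hφeq⟩ := hφ.extend_finite_dimension
  obtain ⟨κ₁, hκ₁, hκeq⟩ := hκ.extend_finite_dimension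
  have hκφ : ∀ p ∈ W, κ₁ (φ₁ p) = p := fun p hp => by
    rw [← hφeq hp, ← hκeq ⟨p, hp, rfl⟩, hinv p hp]
  obtain ⟨r₁, hr₁, h₁⟩ := Metric.mem_nhds_iff.1 (inter_mem (hW.mem_nhds hxW) hV)
  obtain ⟨r₂, hr₂, h₂⟩ := Metric.mem_nhds_iff.1 (hφW.mem_nhds ⟨x, hxW, rfl⟩)
  set C := max 1 (lipschitzExtensionConstant (Rd n) * K)
  have hzero : ∀ p ∈ M, p ∈ W → φ₁ p (Fin.last n) = 0 := fun p hp hpW => by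
    have : φ p ∈ φ '' (M ∩ W) := ⟨p, ⟨hp, hpW⟩, rfl⟩
    rw [himg] at this
    rw [← hφeq hpW]
    exact this.1
  refine ⟨⟨fun p => φ₁ p - φ₁ x, fun z => κ₁ (z + φ₁ x), C, min r₁ r₂, le_max_left _ _,
    lt_min hr₁ hr₂, ?_, ?_, ?_, ?_, sub_self _, ?_⟩⟩
  · refine LipschitzWith.of_dist_le_mul fun p q => ?_
    rw [dist_sub_right]
    exact (hφ₁.weaken (le_max_right _ _)).dist_le_mul p q
  · refine LipschitzWith.of_dist_le_mul fun p q => ?_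
    have := (hκ₁.weaken (le_max_right 1 _)).dist_le_mul (p + φ₁ x) (q + φ₁ x)
    rwa [dist_add_right] at this
  · intro p hp
    rw [sub_add_cancel]
    exact hκφ p (h₁ (Metric.ball_subset_ball (min_le_left _ _) hp)).1
  · intro z hz
    have : z + φ₁ x ∈ φ '' W := by
      refine h₂ (Metric.ball_subset_ball (min_le_right r₁ r₂) ?_)
      rw [hφeq hxW, mem_ball_iff_norm, add_sub_cancel_right]
      simpa using hz
    obtain ⟨p, hp, hpz⟩ := this
    rw [← hpz, hφeq hp, hκφ p hp, ← hφeq hp, hpz, add_sub_cancel_right]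
  · intro p hpA hp
    have hp' := h₁ (Metric.ball_subset_ball (min_le_left _ _) hp)
    simp [hzero p (hA ⟨hpA, hp'.2⟩) hp'.1, hzero x hx hxW]

/-- Near a point outside a closed set the flatness condition is vacuous, so a translation serves. -/
theorem exists_flattening_of_notMem {n : ℕ} {A : Set (Rd n)} (hA : IsClosed A) {x : Rd n}
    (hx : x ∉ A) : Nonempty (Flattening A x) := by
  obtain ⟨r, hr, h⟩ := Metric.mem_nhds_iff.1 (hA.isOpen_compl.mem_nhds hx)
  exact ⟨⟨fun p => p - x, fun z => z + x, 1, r, le_rfl, hr,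
    LipschitzWith.of_dist_le_mul fun p q => by simp,
    LipschitzWith.of_dist_le_mul fun p q => by simp, fun p _ => by simp, fun p _ => by simp,
    sub_self _, fun p hpA hp => (h hp hpA).elim⟩⟩

namespace Flattening

variable {n : ℕ} {A : Set (Rd n)} {x : Rd n}

/-- The coordinates with the two sides of the hyperplane exchanged. -/
def flip (f : Flattening A x) : Flattening A x where
  φ p := reflLast n (f.φ p)
  κ z := f.κ (reflLast n z)
  K := f.K
  r := f.r
  one_le := f.one_le
  r_pos := f.r_pos
  lip_φ := by
    have := (reflLast n).lipschitz.comp f.lip_φ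
    rwa [one_mul] at this
  lip_κ := by
    have := f.lip_κ.comp (reflLast n).lipschitz
    rwa [mul_one] at this
  left_inv p hp := by simp [f.left_inv p hp]
  right_inv z hz := by
    rw [f.right_inv _ (by simpa using hz), reflLast_reflLast]
  map_x := by simp [f.map_x]
  flat p hpA hp := by simp [f.flat p hpA hp]

theorem κ_zero (f : Flattening A x) : f.κ 0 = x := by
  rw [← f.map_x]
  exact f.left_inv x (Metric.mem_ball_self f.r_pos)

theorem K_pos (f : Flattening A x) : 0 < (f.K : ℝ) := zero_lt_one.trans_le f.one_le

theorem κ_mem_ball (f : Flattening A x) {z : Rd n} {s : ℝ} (hz : z ∈ Metric.ball 0 s) :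
    f.κ z ∈ Metric.ball x (f.K * s) := by
  have := f.lip_κ.dist_le_mul z 0
  rw [f.κ_zero] at this
  exact this.trans_lt (mul_lt_mul_of_pos_left hz f.K_pos)

theorem φ_mem_ball (f : Flattening A x) {p : Rd n} {s : ℝ} (hp : p ∈ Metric.ball x s) :
    f.φ p ∈ Metric.ball 0 (f.K * s) := by
  have := f.lip_φ.dist_le_mul p x
  rw [f.map_x] at this
  exact this.trans_lt (mul_lt_mul_of_pos_left hp f.K_pos)

/-- The radius of the half ball on one side of `A`. -/
def ρ (f : Flattening A x) : ℝ := f.r / f.K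

theorem ρ_pos (f : Flattening A x) : 0 < f.ρ := div_pos f.r_pos f.K_pos

theorem ρ_le (f : Flattening A x) : f.ρ ≤ f.r :=
  div_le_self f.r_pos.le f.one_le

theorem K_mul_ρ (f : Flattening A x) : f.K * f.ρ = f.r := by
  have := f.K_pos.ne'
  rw [ρ]; field_simp

/-- The radius of a ball that is mapped into the ball of radius `ρ / 2`. -/
def σ (f : Flattening A x) : ℝ := f.ρ / (2 * f.K)

theorem σ_pos (f : Flattening A x) : 0 < f.σ := div_pos f.ρ_pos (mul_pos two_pos f.K_pos)

theorem K_mul_σ (f : Flattening A x) : f.K * f.σ = f.ρ / 2 := by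
  have := f.K_pos.ne'
  rw [σ]; field_simp

theorem σ_le (f : Flattening A x) : f.σ ≤ f.r := by
  have h1 : f.σ ≤ f.ρ :=
    div_le_self f.ρ_pos.le (by have : (1 : ℝ) ≤ f.K := f.one_le; linarith)
  exact h1.trans f.ρ_le

/-- The half ball on one side of the hyperplane. -/
def half (f : Flattening A x) : Set (Rd n) := Metric.ball 0 f.ρ ∩ {z | 0 < z (Fin.last n)}

theorem isOpen_half (f : Flattening A x) : IsOpen f.half :=
  Metric.isOpen_ball.inter (isOpen_lt continuous_const (by fun_prop))

theorem measurableSet_half (f : Flattening A x) : MeasurableSet f.half :=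
  f.isOpen_half.measurableSet

theorem convex_half (f : Flattening A x) : Convex ℝ f.half := by
  refine (convex_ball 0 _).inter ?_
  exact (convex_halfSpace_gt (f := fun z : Rd n => z (Fin.last n))
    ⟨fun _ _ => rfl, fun _ _ => rfl⟩ 0)

/-- φ inverts κ on the half ball, whereas points of A near x have last flat coordinate 0. So the
half ball is a convex region whose image avoids A. -/
theorem κ_notMem (f : Flattening A x) {z : Rd n} (hz : z ∈ f.half) : f.κ z ∉ A := fun h => by
  have h1 := f.κ_mem_ball hz.1
  rw [K_mul_ρ] at h1
  have h2 := f.flat _ h h1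
  rw [f.right_inv z (Metric.ball_subset_ball f.ρ_le hz.1)] at h2
  exact hz.2.ne' h2

/-- The map that folds a neighbourhood of `x` into one side of `A`. -/
def F (f : Flattening A x) (ε : ℝ) (p : Rd n) : Rd n := f.κ (fold ε (f.φ p))

theorem lip_F (f : Flattening A x) (ε : ℝ) : LipschitzWith (f.K * f.K) (f.F ε) := by
  have := f.lip_κ.comp ((lipschitzWith_fold ε).comp f.lip_φ)
  rwa [one_mul] at this

theorem fold_mem_half (f : Flattening A x) {ε : ℝ} (hε : 0 < ε) (hε2 : ε < f.ρ / 2) {z : Rd n}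
    (hz : z ∈ Metric.ball 0 (f.ρ / 2)) : fold ε z ∈ f.half := by
  refine ⟨?_, ?_⟩
  · rw [mem_ball_zero_iff] at hz ⊢
    linarith [norm_fold_le hε.le z]
  · have := abs_nonneg (z (Fin.last n))
    change 0 < fold ε z (Fin.last n)
    rw [fold, emb_last]
    linarith

theorem φ_mem (f : Flattening A x) {p : Rd n} (hp : p ∈ Metric.ball x f.σ) :
    f.φ p ∈ Metric.ball 0 (f.ρ / 2) := by
  have := f.φ_mem_ball hp
  rwa [K_mul_σ] at this

theorem F_notMem (f : Flattening A x) {ε : ℝ} (hε : 0 < ε) (hε2 : ε < f.ρ / 2) {p : Rd n}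
    (hp : p ∈ Metric.ball x f.σ) : f.F ε p ∉ A :=
  f.κ_notMem (f.fold_mem_half hε hε2 (f.φ_mem hp))

theorem setLIntegral_half_le (f : Flattening A x) {H : Rd n → ℝ≥0∞} (hH : Measurable H)
    {Q : Set (Rd n)} (hQ : Q ⊆ f.half) :
    ∫⁻ z in Q, H (f.κ z) ≤ (f.K : ℝ≥0∞) ^ (n + 1) * ∫⁻ p, H p := by
  have := setLIntegral_comp_le (T := f.κ) (R := f.φ) f.lip_κ.continuous.measurable f.lip_φ
    (s := Q) (B := univ)
    (fun z hz => f.right_inv z (Metric.ball_subset_ball f.ρ_le (hQ hz).1)) (mapsTo_univ _ _) hH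
  rwa [setLIntegral_univ] at this

theorem setLIntegral_ball_le (f : Flattening A x) {H : Rd n → ℝ≥0∞} (hH : Measurable H) :
    ∫⁻ p in Metric.ball x f.σ, H p ≤
      (f.K : ℝ≥0∞) ^ (n + 1) * ∫⁻ z in Metric.ball 0 (f.ρ / 2), H (f.κ z) := by
  have hinv : ∀ p ∈ Metric.ball x f.σ, f.κ (f.φ p) = p := fun p hp =>
    f.left_inv p (Metric.ball_subset_ball f.σ_le hp)
  calc ∫⁻ p in Metric.ball x f.σ, H p = ∫⁻ p in Metric.ball x f.σ, H (f.κ (f.φ p)) := by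
        refine setLIntegral_congr_fun Metric.isOpen_ball.measurableSet fun p hp => ?_
        simp only [hinv p hp]
    _ ≤ _ := setLIntegral_comp_le (f := fun z => H (f.κ z)) f.lip_φ.continuous.measurable f.lip_κ
        hinv (fun p hp => f.φ_mem hp) (hH.comp f.lip_κ.continuous.measurable)

/-- Flattening and its reversal cost K^(n+1) each, and the fold costs 2. The constant does not
depend on ε. -/
theorem setLIntegral_F_le (f : Flattening A x) {ε : ℝ} (hε : 0 < ε) (hε2 : ε < f.ρ / 2)
    {H : Rd n → ℝ≥0∞} (hH : Measurable H) :
    ∫⁻ p in Metric.ball x f.σ, H (f.F ε p) ≤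
      2 * (f.K : ℝ≥0∞) ^ (n + 1) * (f.K : ℝ≥0∞) ^ (n + 1) * ∫⁻ p, H p := by
  have hinv : ∀ p ∈ Metric.ball x f.σ, f.κ (f.φ p) = p := fun p hp =>
    f.left_inv p (Metric.ball_subset_ball f.σ_le hp)
  have hm := hH.comp f.lip_κ.continuous.measurable
  calc ∫⁻ p in Metric.ball x f.σ, H (f.F ε p)
      ≤ (f.K : ℝ≥0∞) ^ (n + 1) * ∫⁻ z in Metric.ball 0 (f.ρ / 2), H (f.κ (fold ε z)) :=
        setLIntegral_comp_le (f := fun z => H (f.κ (fold ε z))) f.lip_φ.continuous.measurable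
          f.lip_κ hinv (fun p hp => f.φ_mem hp)
          (hm.comp (lipschitzWith_fold ε).continuous.measurable)
    _ ≤ (f.K : ℝ≥0∞) ^ (n + 1) * (2 * ∫⁻ z in f.half, H (f.κ z)) := by
        gcongr
        exact setLIntegral_fold_le ε (fun z hz => f.fold_mem_half hε hε2 hz) hm
    _ ≤ (f.K : ℝ≥0∞) ^ (n + 1) * (2 * ((f.K : ℝ≥0∞) ^ (n + 1) * ∫⁻ p, H p)) := by
        gcongr
        exact f.setLIntegral_half_le hH le_rfl
    _ = _ := by ring

end Flattening

end

end DynBC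

/-! ### Trace and Poincaré estimates in flattened coordinates -/

namespace DynBC

noncomputable section

namespace Flattening

variable {n : ℕ} {N S A : Set (Rd n)} {x : Rd n}

/-- On S the last flat coordinate vanishes, so y ↦ κ(y, 0) is a Lipschitz left inverse of the
projected chart, and Hausdorff measure on the parameter space is Lebesgue measure. -/
theorem lintegral_surface_le (e : Flattening S x) (hS : MeasurableSet S) {ρ : ℝ} (hρ : ρ ≤ e.r)
    {H : Rd n → ℝ≥0∞} (hH : Measurable H) :
    ∫⁻ p in S ∩ Metric.ball x ρ, H p ∂(surfaceMeasure n) ≤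
      (e.K : ℝ≥0∞) ^ n * ∫⁻ y in Metric.ball (0 : Rp n) (e.K * ρ), H (e.κ (emb y 0)) := by
  have hinv : ∀ p ∈ S ∩ Metric.ball x ρ, e.κ (emb (proj (e.φ p)) 0) = p := fun p hp => by
    have hp' := Metric.ball_subset_ball hρ hp.2
    rw [← e.flat p hp.1 hp', emb_proj, e.left_inv p hp']
  have hR : LipschitzWith e.K fun y : Rp n => e.κ (emb y 0) := by
    have := e.lip_κ.comp (lipschitzWith_emb_left (n := n) 0)
    rwa [mul_one] at this
  have hT : Measurable fun p => proj (e.φ p) :=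
    (lipschitzWith_proj.continuous.comp e.lip_φ.continuous).measurable
  have h := lintegral_comp_le hT hR (s := S ∩ Metric.ball x ρ)
    (B := Metric.ball (0 : Rp n) (e.K * ρ)) hinv (fun p hp => by
      have := e.φ_mem_ball hp.2
      rw [mem_ball_zero_iff] at this ⊢
      exact (norm_proj_le _).trans_lt this) n (hH.comp hR.continuous.measurable)
  rw [EuclideanSpace.euclideanHausdorffMeasure_eq_volume] at h
  refine le_trans (le_of_eq ?_) h
  refine setLIntegral_congr_fun (hS.inter Metric.isOpen_ball.measurableSet) fun p hp => ?_
  simp only [Function.comp_apply, hinv p hp]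

theorem surfaceMeasure_lt_top (e : Flattening S x) (hS : MeasurableSet S) :
    surfaceMeasure n (S ∩ Metric.ball x e.r) < ⊤ := by
  have h := e.lintegral_surface_le hS le_rfl (H := fun _ => 1) measurable_const
  rw [setLIntegral_one, setLIntegral_one] at h
  exact h.trans_lt (ENNReal.mul_lt_top (ENNReal.pow_lt_top ENNReal.coe_lt_top) measure_ball_lt_top)

theorem volume_hyperplane (n : ℕ) : volume {z : Rd n | z (Fin.last n) = 0} = 0 := by
  set l : Rd n →ₗ[ℝ] ℝ := ⟨⟨fun z => z (Fin.last n), fun _ _ => rfl⟩, fun _ _ => rfl⟩ with hl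
  have h : (LinearMap.ker l : Set (Rd n)) = {z : Rd n | z (Fin.last n) = 0} := rfl
  rw [← h]
  refine Measure.addHaar_submodule _ _ fun htop => ?_
  have h1 : (emb 0 1 : Rd n) ∈ LinearMap.ker l := htop ▸ Submodule.mem_top
  have h2 : (emb 0 1 : Rd n) (Fin.last n) = 0 := h1
  simp at h2

theorem volume_inter_ball (e : Flattening A x) : volume (A ∩ Metric.ball x e.r) = 0 := by
  have h := setLIntegral_comp_le (T := e.φ) (R := e.κ) e.lip_φ.continuous.measurable e.lip_κ
    (s := A ∩ Metric.ball x e.r) (B := {z : Rd n | z (Fin.last n) = 0})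
    (fun p hp => e.left_inv p hp.2) (fun p hp => e.flat p hp.1 hp.2)
    (f := fun _ => 1) measurable_const
  rw [setLIntegral_one, setLIntegral_one, volume_hyperplane, mul_zero] at h
  exact le_antisymm h zero_le

/-- Trace estimate for functions with an upper gradient off `N`, evaluated on a folded copy of a
hypersurface `S`. -/
theorem exists_trace_le (f : Flattening N x) (e : Flattening S x) (hS : MeasurableSet S) :
    ∃ ρ : ℝ, 0 < ρ ∧ ∃ C : ℝ≥0, ∀ (v : Rd n → ℂ) (g : Rd n → ℝ≥0∞), Measurable v → Measurable g →
      IsUpperGradientOn v g Nᶜ → ∀ δ, 0 < δ → δ < ρ → ∀ ε, 0 < ε → ε < ρ →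
      ENNReal.ofReal δ * ∫⁻ p in S ∩ Metric.ball x ρ, ‖v (f.F ε p)‖ₑ ^ 2 ∂(surfaceMeasure n) ≤
        C * ((∫⁻ p, ‖v p‖ₑ ^ 2) + ENNReal.ofReal δ ^ 2 * ∫⁻ p, g p ^ 2) := by
  obtain ⟨E, hE⟩ : ∃ E : ℝ, E = e.K := ⟨_, rfl⟩
  have hE1 : 1 ≤ E := by rw [hE]; exact e.one_le
  -- The points (y, t) with ‖y‖ < Eρ and 0 ≤ t ≤ δ < ρ lie in the ball of radius (E + 1)ρ, which κ
  -- of `e` enlarges by the factor E. The choice E(E + 1)ρ = m keeps their images where both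
  -- flattenings are valid.
  set m : ℝ := min (min e.r f.σ) (f.ρ / 2) with hm
  have hm0 : 0 < m := lt_min (lt_min e.r_pos f.σ_pos) (half_pos f.ρ_pos)
  have hEE : 0 < E * (E + 1) := by positivity
  set ρ : ℝ := m / (E * (E + 1)) with hρ
  have hρ0 : 0 < ρ := div_pos hm0 hEE
  have hmul : E * ((E + 1) * ρ) = m := by rw [hρ]; field_simp
  have h1 : (E + 1) * ρ ≤ m := by rw [← hmul]; exact le_mul_of_one_le_left (by positivity) hE1
  have h2 : ρ ≤ m := by nlinarith
  have hmr : m ≤ e.r := (min_le_left _ _).trans (min_le_left _ _)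
  have hmσ : m ≤ f.σ := (min_le_left _ _).trans (min_le_right _ _)
  have hmρ : m ≤ f.ρ / 2 := min_le_right _ _
  set C₀ : ℝ≥0 := e.K ^ (n + 1) * (2 * f.K ^ (n + 1) * f.K ^ (n + 1)) with hC₀
  set L : ℝ≥0 := f.K * f.K * (e.K * 1) with hL
  refine ⟨ρ, hρ0, e.K ^ n * (2 * C₀ * (1 + L ^ 2)), fun v g hv hg hvg δ hδ hδρ ε hε hερ => ?_⟩
  have hε2 : ε < f.ρ / 2 := hερ.trans_le (h2.trans hmρ)
  set s : Set (Rp n) := Metric.ball 0 (e.K * ρ) with hs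
  have hsm : MeasurableSet s := Metric.isOpen_ball.measurableSet
  have hmem : ∀ y ∈ s, ∀ t ∈ Icc 0 δ, emb y t ∈ Metric.ball (0 : Rd n) ((E + 1) * ρ) := by
    intro y hy t ht
    rw [hs, mem_ball_zero_iff, ← hE] at hy
    rw [mem_ball_zero_iff]
    have := norm_emb_le y t
    rw [abs_of_nonneg ht.1] at this
    linarith [ht.2]
  have hmem2 : ∀ z ∈ Metric.ball (0 : Rd n) ((E + 1) * ρ), e.κ z ∈ Metric.ball x f.σ := by
    intro z hz
    have := e.κ_mem_ball hz
    rw [← hE, hmul] at this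
    exact Metric.ball_subset_ball hmσ this
  -- Segments leave S transversally in the coordinates of `e` and are then folded off N by `f`; the
  -- two flattenings need not be compatible.
  set Φ : Rd n → Rd n := fun z => f.F ε (e.κ z) with hΦ
  have hΦl : LipschitzWith (f.K * f.K * e.K) Φ := (f.lip_F ε).comp e.lip_κ
  -- Fubini's theorem assembles the segments into a region of ℝ^d, where the fold estimate applies
  -- uniformly in ε.
  have hint : ∀ H : Rd n → ℝ≥0∞, Measurable H →
      ∫⁻ y in s, ∫⁻ t in Icc 0 δ, H (Φ (emb y t)) ≤ C₀ * ∫⁻ p, H p := by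
    intro H hH
    have hHm : Measurable fun z => H (Φ z) := hH.comp hΦl.continuous.measurable
    have hHq : Measurable fun q : Rp n × ℝ => H (Φ (emb q.1 q.2)) :=
      hHm.comp continuous_emb.measurable
    have e1 := lintegral_prod (μ := volume.restrict s) (ν := volume.restrict (Icc 0 δ))
      (fun q : Rp n × ℝ => H (Φ (emb q.1 q.2))) hHq.aemeasurable
    rw [← e1, Measure.prod_restrict]
    calc ∫⁻ q in s ×ˢ Icc 0 δ, H (Φ (emb q.1 q.2)) ∂(volume.prod volume)
        ≤ ∫⁻ q in (fun q : Rp n × ℝ => emb q.1 q.2) ⁻¹' Metric.ball (0 : Rd n) ((E + 1) * ρ),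
            H (Φ (emb q.1 q.2)) ∂(volume.prod volume) :=
          lintegral_mono_set fun q hq => hmem q.1 hq.1 q.2 hq.2
      _ = ∫⁻ z in Metric.ball (0 : Rd n) ((E + 1) * ρ), H (Φ z) :=
          measurePreserving_emb.setLIntegral_comp_preimage Metric.isOpen_ball.measurableSet hHm
      _ ≤ (e.K : ℝ≥0∞) ^ (n + 1) * ∫⁻ p in Metric.ball x f.σ, H (f.F ε p) :=
          setLIntegral_comp_le (f := fun p => H (f.F ε p)) e.lip_κ.continuous.measurable e.lip_φ
            (fun z hz => e.right_inv z (Metric.ball_subset_ball (h1.trans hmr) hz)) hmem2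
            (hH.comp (f.lip_F ε).continuous.measurable)
      _ ≤ (e.K : ℝ≥0∞) ^ (n + 1) * (2 * (f.K : ℝ≥0∞) ^ (n + 1) * (f.K : ℝ≥0∞) ^ (n + 1) *
            ∫⁻ p, H p) := by
          gcongr
          exact f.setLIntegral_F_le hε hε2 hH
      _ = C₀ * ∫⁻ p, H p := by
          rw [hC₀]; push_cast; ring
  have hvert : ∀ y ∈ s, ENNReal.ofReal δ * ‖v (Φ (emb y 0))‖ₑ ^ 2 ≤
      2 * (∫⁻ t in Icc 0 δ, ‖v (Φ (emb y t))‖ₑ ^ 2) +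
        2 * (L : ℝ≥0∞) ^ 2 * ENNReal.ofReal δ ^ 2 * ∫⁻ t in Icc 0 δ, g (Φ (emb y t)) ^ 2 := by
    intro y hy
    have hγ : LipschitzWith L fun t => Φ (emb y t) := by
      have := hΦl.comp (lipschitzWith_emb_right y)
      rwa [mul_assoc] at this
    refine ofReal_mul_enorm_sq_le (hv.comp hγ.continuous.measurable)
      (hg.comp hγ.continuous.measurable) hδ.le fun t ht => ?_
    refine hvg _ L hγ 0 t ht.1 fun r hr => ?_
    exact f.F_notMem hε hε2 (hmem2 _ (hmem y hy r ⟨hr.1, hr.2.trans ht.2⟩))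
  have hmv : Measurable fun p : Rd n => ‖v p‖ₑ ^ 2 := hv.enorm.pow_const 2
  have hmg : Measurable fun p : Rd n => g p ^ 2 := hg.pow_const 2
  set a := ∫⁻ p, ‖v p‖ₑ ^ 2
  set b := ∫⁻ p, g p ^ 2
  have hin : ENNReal.ofReal δ * ∫⁻ y in s, ‖v (Φ (emb y 0))‖ₑ ^ 2 ≤
      2 * (C₀ * a) + 2 * (L : ℝ≥0∞) ^ 2 * ENNReal.ofReal δ ^ 2 * (C₀ * b) := by
    rw [← lintegral_const_mul' _ _ ENNReal.ofReal_ne_top]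
    refine (setLIntegral_mono' hsm hvert).trans ?_
    have hmm : Measurable fun q : Rp n × ℝ => ‖v (Φ (emb q.1 q.2))‖ₑ ^ 2 :=
      hmv.comp (hΦl.continuous.comp continuous_emb).measurable
    rw [lintegral_add_left (hmm.lintegral_prod_right'.const_mul 2),
      lintegral_const_mul' _ _ (by simp), lintegral_const_mul' _ _ (by finiteness)]
    gcongr
    · exact hint _ hmv
    · exact hint _ hmg
  calc ENNReal.ofReal δ * ∫⁻ p in S ∩ Metric.ball x ρ, ‖v (f.F ε p)‖ₑ ^ 2 ∂(surfaceMeasure n)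
      ≤ ENNReal.ofReal δ * ((e.K : ℝ≥0∞) ^ n * ∫⁻ y in s, ‖v (Φ (emb y 0))‖ₑ ^ 2) := by
        gcongr
        exact e.lintegral_surface_le hS (h2.trans hmr) (H := fun p => ‖v (f.F ε p)‖ₑ ^ 2)
          (hmv.comp (f.lip_F ε).continuous.measurable)
    _ = (e.K : ℝ≥0∞) ^ n * (ENNReal.ofReal δ * ∫⁻ y in s, ‖v (Φ (emb y 0))‖ₑ ^ 2) := by ring
    _ ≤ (e.K : ℝ≥0∞) ^ n * (2 * (C₀ * a) + 2 * (L : ℝ≥0∞) ^ 2 * ENNReal.ofReal δ ^ 2 * (C₀ * b)) := by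
        gcongr
    -- Nonnegative terms are added so that the sum factors with the constant 2C₀(1 + L²).
    _ ≤ (e.K : ℝ≥0∞) ^ n * (2 * (C₀ * a) + 2 * (L : ℝ≥0∞) ^ 2 * ENNReal.ofReal δ ^ 2 * (C₀ * b)) +
        (e.K : ℝ≥0∞) ^ n * (2 * (L : ℝ≥0∞) ^ 2 * (C₀ * a) +
          2 * ENNReal.ofReal δ ^ 2 * (C₀ * b)) := le_self_add
    _ = _ := by
        push_cast; ring

/-- The grid cell with index `c` and side `η`. -/
def cell {n : ℕ} (η : ℝ) (c : Fin (n + 1) → ℤ) : Set (Rd n) :=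
  ⋂ i, ({z : Rd n | η * c i ≤ z i} ∩ {z | z i < η * (c i + 1)})

theorem mem_cell {η : ℝ} {c : Fin (n + 1) → ℤ} {z : Rd n} :
    z ∈ cell η c ↔ ∀ i, η * c i ≤ z i ∧ z i < η * (c i + 1) := by
  simp [cell]

theorem mem_cell_iff {η : ℝ} (hη : 0 < η) {c : Fin (n + 1) → ℤ} {z : Rd n} :
    z ∈ cell η c ↔ c = fun i => ⌊z i / η⌋ := by
  rw [mem_cell, funext_iff]
  refine forall_congr' fun i => ?_
  rw [eq_comm, Int.floor_eq_iff, le_div_iff₀ hη, div_lt_iff₀ hη, mul_comm, mul_comm η]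

theorem convex_cell (η : ℝ) (c : Fin (n + 1) → ℤ) : Convex ℝ (cell η c : Set (Rd n)) := by
  refine convex_iInter fun i => Convex.inter ?_ ?_
  · exact convex_halfSpace_ge (f := fun z : Rd n => z i) ⟨fun _ _ => rfl, fun _ _ => rfl⟩ _
  · exact convex_halfSpace_lt (f := fun z : Rd n => z i) ⟨fun _ _ => rfl, fun _ _ => rfl⟩ _

theorem measurableSet_cell (η : ℝ) (c : Fin (n + 1) → ℤ) : MeasurableSet (cell η c : Set (Rd n)) := by
  refine MeasurableSet.iInter fun i => MeasurableSet.inter ?_ ?_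
  · exact measurableSet_le measurable_const (by fun_prop)
  · exact measurableSet_lt (by fun_prop) measurable_const

theorem dist_le_of_mem_cell {η : ℝ} (hη : 0 < η) {c : Fin (n + 1) → ℤ} {z w : Rd n}
    (hz : z ∈ cell η c) (hw : w ∈ cell η c) : dist z w ≤ η * (n + 1) := by
  rw [EuclideanSpace.dist_eq]
  refine Real.sqrt_le_iff.2 ⟨by positivity, ?_⟩
  have hi : ∀ i ∈ Finset.univ, dist (z i) (w i) ^ 2 ≤ η ^ 2 := fun i _ => by
    have h1 := mem_cell.1 hz i
    have h2 := mem_cell.1 hw i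
    rw [Real.dist_eq, sq_abs]
    refine sq_le_sq' ?_ ?_ <;> linarith [h1.1, h1.2, h2.1, h2.2]
  refine (Finset.sum_le_card_nsmul _ _ _ hi).trans ?_
  simp only [Finset.card_univ, Fintype.card_fin, nsmul_eq_mul]
  push_cast
  have : (0 : ℝ) ≤ n := Nat.cast_nonneg n
  rw [mul_pow]
  nlinarith [sq_nonneg η, mul_nonneg this (sq_nonneg η)]

/-- On one side of `N` the `L²` norm is controlled by finitely many means and a small multiple of
the norm of the upper gradient. -/
theorem exists_finite_means (f : Flattening N x) {τ : ℝ≥0} (hτ : 0 < τ) :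
    ∃ (s : Finset (Fin (n + 1) → ℤ)) (Q : (Fin (n + 1) → ℤ) → Set (Rd n)),
      (∀ c, MeasurableSet (Q c)) ∧ (∀ c, Q c ⊆ f.half) ∧ ∃ C : ℝ≥0,
      ∀ (v : Rd n → ℂ) (g : Rd n → ℝ≥0∞), Measurable v → (∃ M, ∀ p, ‖v p‖ ≤ M) → Measurable g →
      IsUpperGradientOn v g Nᶜ → ∫⁻ z in f.half, ‖v (f.κ z)‖ₑ ^ 2 ≤
        C * (∑ c ∈ s, ‖∫ z in Q c, v (f.κ z)‖ₑ ^ 2) + τ * ∫⁻ p, g p ^ 2 := by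
  have hK0 : (0 : ℝ≥0) < f.K := zero_lt_one.trans_le f.one_le
  set B : ℝ≥0 := 2 ^ (n + 1 + 1) * (n + 1) ^ 2 * (f.K ^ 2 * f.K ^ (n + 1)) with hB
  have hB0 : 0 < B := by positivity
  -- One factor of η² is bounded by 1 and the other by τ/B. Bη² is the energy constant for cells of
  -- diameter at most η(n + 1), including the change-of-variables factors.
  set η : ℝ≥0 := min 1 (τ / B) with hη
  have hη0 : 0 < η := lt_min one_pos (div_pos hτ hB0)
  have hη0' : (0 : ℝ) < η := hη0
  have hηB : B * η ^ 2 ≤ τ := by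
    calc B * η ^ 2 ≤ B * (1 * (τ / B)) := by
          rw [sq]
          gcongr
          · exact min_le_left _ _
          · exact min_le_right _ _
      _ = τ := by field_simp
  set Q : (Fin (n + 1) → ℤ) → Set (Rd n) := fun c => f.half ∩ cell η c with hQ
  have hQm : ∀ c, MeasurableSet (Q c) := fun c => f.measurableSet_half.inter (measurableSet_cell _ _)
  have hQh : ∀ c, Q c ⊆ f.half := fun c => inter_subset_left
  have hQf : ∀ c, volume (Q c) < ⊤ := fun c =>
    (measure_mono ((hQh c).trans inter_subset_left)).trans_lt measure_ball_lt_top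
  set R : ℤ := ⌈f.ρ / η⌉ + 1 with hR
  set s : Finset (Fin (n + 1) → ℤ) := Fintype.piFinset fun _ => Finset.Icc (-R) R with hs
  have hcov : f.half = ⋃ c ∈ s, Q c := by
    refine Subset.antisymm (fun z hz => ?_) (iUnion₂_subset fun c _ => hQh c)
    refine mem_iUnion₂.2 ⟨fun i => ⌊z i / η⌋, ?_, hz, (mem_cell_iff hη0').2 rfl⟩
    rw [hs, Fintype.mem_piFinset]
    intro i
    have h1 : |z i| < f.ρ := by
      have := hz.1
      rw [mem_ball_zero_iff] at this
      exact (PiLp.norm_apply_le z i).trans_lt this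
    have h2 : |z i / η| < f.ρ / η := by
      rw [abs_div, abs_of_pos hη0']
      gcongr
    have h3 := Int.le_ceil (f.ρ / η)
    have h4 := Int.floor_le (z i / η)
    have h5 := Int.lt_floor_add_one (z i / η)
    rw [abs_lt] at h2
    rw [Finset.mem_Icc]
    constructor
    · have : (-R : ℝ) < (⌊z i / η⌋ : ℤ) + 1 := by rw [hR]; push_cast; linarith
      have : -R < ⌊z i / η⌋ + 1 := by exact_mod_cast this
      linarith
    · have : ((⌊z i / η⌋ : ℤ) : ℝ) ≤ R := by rw [hR]; push_cast; linarith
      exact_mod_cast this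
  have hdisj : (s : Set (Fin (n + 1) → ℤ)).PairwiseDisjoint Q := by
    intro c _ c' _ hcc
    refine Set.disjoint_left.2 fun z hz hz' => hcc ?_
    rw [(mem_cell_iff hη0').1 hz.2, (mem_cell_iff hη0').1 hz'.2]
  have hloc : ∀ c, ∃ C : ℝ≥0, ∀ (v : Rd n → ℂ) (g : Rd n → ℝ≥0∞), Measurable v →
      (∃ M, ∀ p, ‖v p‖ ≤ M) → Measurable g → IsUpperGradientOn v g Nᶜ →
      ∫⁻ z in Q c, ‖v (f.κ z)‖ₑ ^ 2 ≤ C * ‖∫ z in Q c, v (f.κ z)‖ₑ ^ 2 +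
        2 ^ (n + 1 + 1) * ((η * (n + 1) : ℝ≥0) : ℝ≥0∞) ^ 2 *
          ∫⁻ z in Q c, (f.K * g (f.κ z)) ^ 2 := by
    intro c
    rcases eq_or_ne (volume (Q c)) 0 with h0 | h0
    -- A null cell contributes nothing; treating it apart avoids an infinite inverse volume.
    · refine ⟨0, fun v g _ _ _ _ => ?_⟩
      rw [Measure.restrict_eq_zero.2 h0]; simp
    · refine ⟨(2 * (volume (Q c))⁻¹).toNNReal, fun v g hv hvb hg hvg => ?_⟩
      rw [ENNReal.coe_toNNReal (ENNReal.mul_ne_top (by simp) (ENNReal.inv_ne_top.2 h0))]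
      obtain ⟨M, hM⟩ := hvb
      have hmκ := f.lip_κ.continuous.measurable
      have hfin : IsFiniteMeasure (volume.restrict (Q c)) := ⟨by simpa using hQf c⟩
      exact setLIntegral_enorm_sq_le (v := v ∘ f.κ) (g := fun z => f.K * g (f.κ z))
        (f.convex_half.inter (convex_cell _ _)) (hQm c) (hQf c).ne
        (fun p hp q hq => by
          have := dist_le_of_mem_cell hη0' hp.2 hq.2
          push_cast; exact this) (hv.comp hmκ)
        (Integrable.of_bound (hv.comp hmκ).aestronglyMeasurable M
          (Eventually.of_forall fun z => hM _))
        ((hg.comp hmκ).const_mul _)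
        (hvg.comp f.lip_κ fun z hz => f.κ_notMem (hQh c hz))
  choose C hC using hloc
  refine ⟨s, Q, hQm, hQh, ∑ c ∈ s, C c, fun v g hv hvb hg hvg => ?_⟩
  have hmκ := f.lip_κ.continuous.measurable
  have hsum : ∀ H : Rd n → ℝ≥0∞, ∫⁻ z in f.half, H z = ∑ c ∈ s, ∫⁻ z in Q c, H z := fun H => by
    conv_lhs => rw [hcov]
    exact lintegral_biUnion_finset hdisj (fun c _ => hQm c) H
  rw [hsum]
  refine (Finset.sum_le_sum fun c _ => hC c v g hv hvb hg hvg).trans ?_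
  rw [Finset.sum_add_distrib, ← Finset.mul_sum, ← hsum]
  refine add_le_add ?_ ?_
  · rw [Finset.mul_sum]
    refine Finset.sum_le_sum fun c hc => ?_
    gcongr
    exact Finset.single_le_sum (f := C) (fun _ _ => zero_le) hc
  · calc 2 ^ (n + 1 + 1) * ((η * (n + 1) : ℝ≥0) : ℝ≥0∞) ^ 2 * ∫⁻ z in f.half, (f.K * g (f.κ z)) ^ 2
        = 2 ^ (n + 1 + 1) * ((η * (n + 1) : ℝ≥0) : ℝ≥0∞) ^ 2 *
          ((f.K : ℝ≥0∞) ^ 2 * ∫⁻ z in f.half, (g (f.κ z)) ^ 2) := by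
          have : ∫⁻ z in f.half, (f.K * g (f.κ z)) ^ 2 =
              (f.K : ℝ≥0∞) ^ 2 * ∫⁻ z in f.half, (g (f.κ z)) ^ 2 := by
            rw [← lintegral_const_mul' _ _ (by finiteness)]
            simp only [mul_pow]
          rw [this]
      _ ≤ 2 ^ (n + 1 + 1) * ((η * (n + 1) : ℝ≥0) : ℝ≥0∞) ^ 2 *
          ((f.K : ℝ≥0∞) ^ 2 * ((f.K : ℝ≥0∞) ^ (n + 1) * ∫⁻ p, g p ^ 2)) := by
          gcongr
          exact f.setLIntegral_half_le (H := fun p => g p ^ 2) (hg.pow_const 2) le_rfl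
      _ = ((B * η ^ 2 : ℝ≥0) : ℝ≥0∞) * ∫⁻ p, g p ^ 2 := by
          rw [hB]; push_cast; ring
      _ ≤ τ * ∫⁻ p, g p ^ 2 := by
          gcongr

/-- In flat coordinates the ball is covered by two open half balls and a null hyperplane; the lower
half is the upper half of `f.flip`. -/
theorem setLIntegral_ball_le_add (f : Flattening N x) {H : Rd n → ℝ≥0∞} (hH : Measurable H) :
    ∫⁻ p in Metric.ball x f.σ, H p ≤ (f.K : ℝ≥0∞) ^ (n + 1) *
      ((∫⁻ z in f.half, H (f.κ z)) + ∫⁻ z in f.flip.half, H (f.flip.κ z)) := by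
  refine (f.setLIntegral_ball_le hH).trans ?_
  gcongr
  have hρ : f.ρ / 2 ≤ f.ρ := by linarith [f.ρ_pos]
  have hcov : Metric.ball (0 : Rd n) (f.ρ / 2) ⊆ (f.half ∪
      Metric.ball 0 f.ρ ∩ {z | z (Fin.last n) < 0}) ∪ {z | z (Fin.last n) = 0} := by
    intro z hz
    have hz' := Metric.ball_subset_ball hρ hz
    rcases lt_trichotomy (z (Fin.last n)) 0 with h | h | h
    · exact Or.inl (Or.inr ⟨hz', h⟩)
    · exact Or.inr h
    · exact Or.inl (Or.inl ⟨hz', h⟩)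
  refine (lintegral_mono_set hcov).trans ((lintegral_union_le _ _ _).trans ?_)
  have h0 : ∫⁻ z in {z : Rd n | z (Fin.last n) = 0}, H (f.κ z) = 0 := by
    rw [Measure.restrict_eq_zero.2 (volume_hyperplane n), lintegral_zero_measure]
  rw [h0, add_zero]
  refine (lintegral_union_le _ _ _).trans (add_le_add le_rfl ?_)
  have hm : Measurable fun z => H (f.κ (reflLast n z)) :=
    hH.comp (f.lip_κ.continuous.comp (reflLast n).continuous).measurable
  have := setLIntegral_comp_le (T := reflLast n) (R := reflLast n)
    (reflLast n).continuous.measurable (reflLast n).lipschitz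
    (s := Metric.ball 0 f.ρ ∩ {z : Rd n | z (Fin.last n) < 0}) (B := f.flip.half)
    (fun z _ => reflLast_reflLast z) (fun z hz => ⟨?_, ?_⟩) hm
  · simp at this
    exact this
  · have : f.flip.ρ = f.ρ := rfl
    rw [this]
    simpa using hz.1
  · change 0 < (reflLast n z) (Fin.last n)
    rw [reflLast_last]
    exact neg_pos.2 hz.2

end Flattening

end

end DynBC

/-! ### Extension by zero and one-sided limits at N -/

namespace DynBC

noncomputable section

theorem IsUpperGradientOn.mono {E : Type*} [PseudoEMetricSpace E] {v : E → ℂ} {g g' : E → ℝ≥0∞}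
    {O : Set E} (h : IsUpperGradientOn v g O) (hg : ∀ x ∈ O, g x ≤ g' x) :
    IsUpperGradientOn v g' O := fun γ L hγ a b hab hmem =>
  (h γ L hγ a b hab hmem).trans <| mul_le_mul_right
    (setLIntegral_mono' measurableSet_Icc fun t ht => hg _ (hmem t ht)) _

theorem fderiv_apply_eq_sum {n : ℕ} (u : Rd n → ℂ) (x ξ : Rd n) :
    fderiv ℝ u x ξ = ∑ l, (ξ l : ℂ) * grad u x l := by
  conv_lhs => rw [← (EuclideanSpace.basisFun (Fin (n + 1)) ℝ).sum_repr ξ]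
  simp [map_sum, grad]

theorem norm_fderiv_le_norm_grad {n : ℕ} (u : Rd n → ℂ) (x : Rd n) :
    ‖fderiv ℝ u x‖ ≤ ‖grad u x‖ := by
  refine ContinuousLinearMap.opNorm_le_bound _ (norm_nonneg _) fun ξ => ?_
  have h1 : fderiv ℝ u x ξ = inner ℂ (WithLp.toLp 2 fun i => (ξ i : ℂ) : Cd n) (grad u x) := by
    simp [fderiv_apply_eq_sum, PiLp.inner_apply, mul_comm]
  have h2 : ‖(WithLp.toLp 2 fun i => (ξ i : ℂ) : Cd n)‖ = ‖ξ‖ := by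
    simp [EuclideanSpace.norm_eq]
  rw [h1, mul_comm, ← h2]
  exact norm_inner_le_norm _ _

/-- The extension by zero of a smooth function on `Ω` whose support avoids the part of the boundary
outside of `N`. -/
theorem isUpperGradientOn_indicator {n : ℕ} {Ω ΓD N : Set (Rd n)} (hΩ : IsOpen Ω)
    (hfr : frontier Ω ⊆ ΓD ∪ N) {u : Rd n → ℂ} (hu : IsTest ΓD u) :
    IsUpperGradientOn (Ω.indicator u) (Ω.indicator fun p => ‖grad u p‖ₑ) Nᶜ := by
  have hloc : ∀ p ∈ Nᶜ, (p ∈ Ω ∧ Ω.indicator u =ᶠ[𝓝 p] u) ∨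
      (p ∉ Ω ∧ Ω.indicator u =ᶠ[𝓝 p] fun _ => 0) := by
    intro p hp
    by_cases hpΩ : p ∈ Ω
    · refine Or.inl ⟨hpΩ, ?_⟩
      filter_upwards [hΩ.mem_nhds hpΩ] with q hq using indicator_of_mem hq _
    refine Or.inr ⟨hpΩ, ?_⟩
    by_cases hpc : p ∈ closure Ω
    -- A boundary point off N lies in Γ_D, which the closed support of u avoids, so u vanishes in a
    -- whole neighbourhood.
    · have hpD : p ∈ ΓD :=
        (hfr (hΩ.frontier_eq ▸ ⟨hpc, hpΩ⟩)).resolve_right hp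
      have : p ∉ tsupport u := fun h => disjoint_left.1 hu.disjoint h hpD
      filter_upwards [notMem_tsupport_iff_eventuallyEq.1 this] with q hq
      by_cases hqΩ : q ∈ Ω
      · rw [indicator_of_mem hqΩ, hq]; rfl
      · exact indicator_of_notMem hqΩ _
    · filter_upwards [isClosed_closure.isOpen_compl.mem_nhds hpc] with q hq
      exact indicator_of_notMem (fun h => hq (subset_closure h)) _
  refine (isUpperGradientOn_fderiv fun p hp => ?_).mono fun p hp => ?_
  · rcases hloc p hp with ⟨_, h⟩ | ⟨_, h⟩
    · exact ((hu.smooth.of_le (by simp)).contDiffAt).congr_of_eventuallyEq h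
    · exact contDiffAt_const.congr_of_eventuallyEq h
  · rcases hloc p hp with ⟨hpΩ, h⟩ | ⟨hpΩ, h⟩
    · rw [h.fderiv_eq, indicator_of_mem hpΩ, ← ofReal_norm, ← ofReal_norm]
      exact ENNReal.ofReal_le_ofReal (norm_fderiv_le_norm_grad u p)
    · rw [h.fderiv_eq, fderiv_const_apply, ← ofReal_norm, norm_zero, ENNReal.ofReal_zero]
      exact zero_le

namespace Flattening

variable {n : ℕ} {Ω ΓD N A : Set (Rd n)} {x y : Rd n}

theorem F_eq (f : Flattening A x) (hy : 0 ≤ f.φ y (Fin.last n)) (ε : ℝ) :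
    f.F ε y = f.κ (f.φ y + emb 0 ε) := by
  rw [F, fold_of_nonneg ε hy]

theorem tendsto_add_emb (z : Rd n) : Tendsto (fun ε : ℝ => z + emb 0 ε) (𝓝[>] 0) (𝓝 z) := by
  have : Tendsto (fun ε : ℝ => z + emb 0 ε) (𝓝 0) (𝓝 (z + emb 0 0)) :=
    (continuous_const.add (lipschitzWith_emb_right 0).continuous).tendsto 0
  rw [emb_zero, add_zero] at this
  exact this.mono_left nhdsWithin_le_nhds

theorem tendsto_F (f : Flattening A x) (hyx : y ∈ Metric.ball x f.σ)
    (hy : 0 ≤ f.φ y (Fin.last n)) : Tendsto (fun ε => f.F ε y) (𝓝[>] 0) (𝓝 y) := by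
  simp only [f.F_eq hy]
  have := (f.lip_κ.continuous.tendsto (f.φ y)).comp (tendsto_add_emb (f.φ y))
  rwa [f.left_inv y (Metric.ball_subset_ball f.σ_le hyx)] at this

/-- If `Ω` accumulates at a boundary point `y` from one side of `N`, then it fills this side. -/
theorem eventually_F_mem (f : Flattening N x) (hΩ : IsOpen Ω) (hD : IsClosed ΓD)
    (hfr : frontier Ω ⊆ ΓD ∪ N) (hyx : y ∈ Metric.ball x f.σ) (hyN : y ∈ N) (hyD : y ∉ ΓD)
    (hcl : y ∈ closure (Ω ∩ {q | 0 ≤ f.φ q (Fin.last n)})) : ∀ᶠ ε in 𝓝[>] 0, f.F ε y ∈ Ω := by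
  have hy0 : f.φ y (Fin.last n) = 0 := f.flat y hyN (Metric.ball_subset_ball f.σ_le hyx)
  have hκy : f.κ (f.φ y) = y := f.left_inv y (Metric.ball_subset_ball f.σ_le hyx)
  have hU : f.κ ⁻¹' ΓDᶜ ∩ Metric.ball 0 f.ρ ∈ 𝓝 (f.φ y) := by
    refine inter_mem (f.lip_κ.continuous.continuousAt.preimage_mem_nhds ?_)
      (Metric.isOpen_ball.mem_nhds ?_)
    · rw [hκy]; exact hD.isOpen_compl.mem_nhds hyD
    · exact Metric.ball_subset_ball (by linarith [f.ρ_pos]) (f.φ_mem hyx)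
  obtain ⟨s, hs, hsub⟩ := Metric.mem_nhds_iff.1 hU
  set P : Set (Rd n) := Metric.ball (f.φ y) s ∩ {z | 0 < z (Fin.last n)} with hP
  have hPc : Convex ℝ P := (convex_ball _ _).inter
    (convex_halfSpace_gt (f := fun z : Rd n => z (Fin.last n)) ⟨fun _ _ => rfl, fun _ _ => rfl⟩ 0)
  -- The image of P is connected. It misses N, being on one side, and Γ_D, being near y, hence the
  -- whole boundary of Ω. So it lies either in Ω or outside the closure of Ω.
  have hpre : IsPreconnected (f.κ '' P) :=
    hPc.isPreconnected.image _ f.lip_κ.continuous.continuousOn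
  have hnf : ∀ q ∈ f.κ '' P, q ∈ Ω ∪ (closure Ω)ᶜ := by
    rintro _ ⟨z, hz, rfl⟩
    by_contra hq
    rw [mem_union, not_or, mem_compl_iff, not_not] at hq
    have hq' : f.κ z ∈ frontier Ω := hΩ.frontier_eq ▸ ⟨hq.2, hq.1⟩
    have hzz := hsub hz.1
    exact (hfr hq').elim hzz.1 (f.κ_notMem ⟨hzz.2, hz.2⟩)
  have hPmem : ∀ z ∈ Metric.ball (f.φ y) s, 0 ≤ z (Fin.last n) →
      ∀ᶠ ε in 𝓝[>] 0, z + emb 0 ε ∈ P := by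
    intro z hz hz0
    filter_upwards [(tendsto_add_emb z).eventually (Metric.isOpen_ball.mem_nhds hz),
      self_mem_nhdsWithin] with ε h1 h2
    refine ⟨h1, ?_⟩
    have : (0 : ℝ) < ε := h2
    simp only [Set.mem_ofPred_eq, PiLp.add_apply, emb_last]
    linarith
  have hsubΩ : f.κ '' P ⊆ Ω := by
    have hV : f.φ ⁻¹' Metric.ball (f.φ y) s ∩ Metric.ball x f.σ ∈ 𝓝 y :=
      inter_mem (f.lip_φ.continuous.continuousAt.preimage_mem_nhds (Metric.ball_mem_nhds _ hs))
        (Metric.isOpen_ball.mem_nhds hyx)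
    obtain ⟨q, ⟨hq1, hq2⟩, hqΩ, hq0⟩ := mem_closure_iff_nhds.1 hcl _ hV
    -- A point q of Ω close to y may sit on the hyperplane itself. A small lift moves it into P
    -- without leaving the open set Ω, and this decides the alternative.
    have hev : ∀ᶠ ε in 𝓝[>] (0 : ℝ), f.F ε q ∈ Ω :=
      (f.tendsto_F hq2 hq0).eventually (hΩ.mem_nhds hqΩ)
    obtain ⟨ε, h1, h2⟩ := (hev.and (hPmem _ hq1 hq0)).exists
    rw [f.F_eq hq0] at h1
    refine hpre.subset_left_of_subset_union hΩ isClosed_closure.isOpen_compl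
      (disjoint_compl_right.mono_left subset_closure) hnf ⟨_, ⟨_, h2, rfl⟩, h1⟩
  filter_upwards [hPmem _ (Metric.mem_ball_self hs) hy0.ge] with ε hε
  rw [f.F_eq hy0.ge]
  exact hsubΩ ⟨_, hε, rfl⟩

/-- The side of approach depends on the point. An interior point is approached from its own side; at
a boundary point Ω accumulates from at least one side and then fills it locally. -/
theorem tendsto_indicator_F_or (f : Flattening N x) (hΩ : IsOpen Ω) (hD : IsClosed ΓD)
    (hfr : frontier Ω ⊆ ΓD ∪ N) (hyx : y ∈ Metric.ball x f.σ)
    (hy : y ∈ Ω ∨ y ∈ closure Ω ∧ y ∈ N ∧ y ∉ ΓD) {u : Rd n → ℂ} (hu : Continuous u) :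
    Tendsto (fun ε => Ω.indicator u (f.F ε y)) (𝓝[>] 0) (𝓝 (u y)) ∨
      Tendsto (fun ε => Ω.indicator u (f.flip.F ε y)) (𝓝[>] 0) (𝓝 (u y)) := by
  have key : ∀ f : Flattening N x, y ∈ Metric.ball x f.σ → 0 ≤ f.φ y (Fin.last n) →
      (∀ᶠ ε in 𝓝[>] 0, f.F ε y ∈ Ω) →
      Tendsto (fun ε => Ω.indicator u (f.F ε y)) (𝓝[>] 0) (𝓝 (u y)) := by
    intro f h1 h2 h3
    refine ((hu.tendsto y).comp (f.tendsto_F h1 h2)).congr' ?_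
    filter_upwards [h3] with ε hε
    exact (indicator_of_mem hε _).symm
  have hlast : ∀ q, f.flip.φ q (Fin.last n) = -f.φ q (Fin.last n) := fun q => reflLast_last _
  have hyx' : y ∈ Metric.ball x f.flip.σ := hyx
  rcases hy with hy | ⟨hyc, hyN, hyD⟩
  · rcases le_total 0 (f.φ y (Fin.last n)) with h | h
    · exact Or.inl (key f hyx h ((f.tendsto_F hyx h).eventually (hΩ.mem_nhds hy)))
    · have h' : 0 ≤ f.flip.φ y (Fin.last n) := by rw [hlast]; linarith
      exact Or.inr (key f.flip hyx' h' ((f.flip.tendsto_F hyx' h').eventually (hΩ.mem_nhds hy)))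
  · have hy0 : f.φ y (Fin.last n) = 0 := f.flat y hyN (Metric.ball_subset_ball f.σ_le hyx)
    have hcov : Ω ⊆ (Ω ∩ {q | 0 ≤ f.φ q (Fin.last n)}) ∪
        (Ω ∩ {q | 0 ≤ f.flip.φ q (Fin.last n)}) := fun q hq => by
      rcases le_total 0 (f.φ q (Fin.last n)) with h | h
      · exact Or.inl ⟨hq, h⟩
      · exact Or.inr ⟨hq, by simp only [Set.mem_ofPred_eq, hlast]; linarith⟩
    have := closure_mono hcov hyc
    rw [closure_union] at this
    refine this.imp (fun h => ?_) fun h => ?_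
    · exact key f hyx hy0.ge (f.eventually_F_mem hΩ hD hfr hyx hyN hyD h)
    · exact key f.flip hyx' (by rw [hlast, hy0, neg_zero])
        (f.flip.eventually_F_mem hΩ hD hfr hyx' hyN hyD h)

end Flattening

/-! ### Hypersurfaces -/

theorem IsLipschitzHypersurface.exists_countable_cover {n : ℕ} {S : Set (Rd n)}
    (hS : IsLipschitzHypersurface S) :
    ∃ T : Set (GraphChart S), T.Countable ∧ S = ⋃ c ∈ T, S ∩ c.V := by
  obtain ⟨T, hT, hTu⟩ := TopologicalSpace.isOpen_iUnion_countable
    (fun c : GraphChart S => c.V) fun c => c.isOpen_V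
  refine ⟨T, hT, ?_⟩
  refine subset_antisymm (fun x hx => ?_) (iUnion₂_subset fun c _ => inter_subset_left)
  obtain ⟨c, hc⟩ := hS x hx
  have : x ∈ ⋃ c ∈ T, c.V := by
    rw [hTu]; exact mem_iUnion.2 ⟨c, hc⟩
  obtain ⟨c', hc', hx'⟩ := mem_iUnion₂.1 this
  exact mem_iUnion₂.2 ⟨c', hc', hx, hx'⟩

/-- By the Lindelöf property S is a countable union of continuous images of open, hence σ-compact,
parameter sets. -/
theorem IsLipschitzHypersurface.measurableSet {n : ℕ} {S : Set (Rd n)}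
    (hS : IsLipschitzHypersurface S) : MeasurableSet S := by
  have hc : ∀ c : GraphChart S, MeasurableSet (S ∩ c.V) := by
    intro c
    rw [← c.bijOn.image_eq]
    obtain ⟨K, hK⟩ := c.lipschitz
    have hcont : ContinuousOn c.map c.U := by
      unfold GraphChart.map
      refine ContinuousOn.add (c.Q.continuous.comp_continuousOn ?_) continuousOn_const
      have : Continuous fun q : Rp n × ℝ => emb q.1 q.2 := continuous_emb
      exact this.comp_continuousOn (continuousOn_id.prodMk hK.continuousOn)
    have hσ : IsSigmaCompact c.U := by
      have : SigmaCompactSpace c.U := by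
        have := c.isOpen_U.locallyCompactSpace
        infer_instance
      exact isSigmaCompact_iff_sigmaCompactSpace.2 this
    obtain ⟨k, hk, hk'⟩ := hσ.image_of_continuousOn hcont
    change MeasurableSet (c.map '' c.U)
    rw [← hk']
    exact MeasurableSet.iUnion fun i => (hk i).measurableSet
  obtain ⟨T, hT, hcov⟩ := hS.exists_countable_cover
  rw [hcov]
  exact MeasurableSet.biUnion hT fun c _ => hc c

/-! ### Consequences of the geometric assumptions -/

namespace Data

variable {n : ℕ} {D : Data n}

/-- The closed part of the boundary where test functions need not vanish. -/
def N (D : Data n) : Set (Rd n) := closure D.ΓN ∪ closure D.Γd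

namespace Geometric

variable (hgeo : D.Geometric)

include hgeo

theorem frontier_subset : frontier D.Ω ⊆ D.ΓD ∪ D.N := by
  rw [hgeo.frontier_eq, union_assoc]
  exact union_subset_union_right _ (union_subset_union subset_closure subset_closure)

/-- Away from one of the two closures, the submanifold containing the other serves; at common points
the meeting assumption provides one submanifold for both. -/
theorem nonempty_flattening_N (x : Rd n) : Nonempty (Flattening D.N x) := by
  by_cases hN : x ∈ closure D.ΓN <;> by_cases hd : x ∈ closure D.Γd
  · obtain ⟨V, hV, M, hM, hsub⟩ := hgeo.meeting x ⟨hN, hd⟩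
    exact exists_flattening_of_submanifold hM (hsub ⟨Or.inl hN, mem_of_mem_nhds hV⟩) hV hsub
  · obtain ⟨M, hM, hsub⟩ := hgeo.closure_N
    exact exists_flattening_of_submanifold hM (hsub hN) (isClosed_closure.isOpen_compl.mem_nhds hd)
      fun p hp => hsub (hp.1.resolve_right hp.2)
  · obtain ⟨M, hM, hsub⟩ := hgeo.closure_d
    exact exists_flattening_of_submanifold hM (hsub hd) (isClosed_closure.isOpen_compl.mem_nhds hN)
      fun p hp => hsub (hp.1.resolve_left hp.2)
  · exact exists_flattening_of_notMem (isClosed_closure.union isClosed_closure)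
      fun h => h.elim hN hd

end Geometric

end Data

/-- The properties of `Γd` and `Σ` used for the trace. -/
structure IsTraceSet {n : ℕ} (D : Data n) (S : Set (Rd n)) : Prop where
  hypersurface : IsLipschitzHypersurface S
  submanifold : ∃ M, IsLipschitzSubmanifold M ∧ closure S ⊆ M
  mem : ∀ y ∈ S, y ∈ D.Ω ∨ y ∈ closure D.Ω ∧ y ∈ D.N ∧ y ∉ D.ΓD

namespace Data.Geometric

variable {n : ℕ} {D : Data n} (hgeo : D.Geometric)

include hgeo

theorem isTraceSet_Γd : IsTraceSet D D.Γd :=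
  ⟨hgeo.hypersurface_d, hgeo.closure_d, fun _ hy => Or.inr
    ⟨frontier_subset_closure (hgeo.frontier_eq ▸ Or.inr hy), Or.inr (subset_closure hy),
      fun h => disjoint_left.1 hgeo.disjoint_Dd h hy⟩⟩

theorem isTraceSet_Sg : IsTraceSet D D.Sg :=
  ⟨hgeo.hypersurface_S, hgeo.closure_S, fun _ hy => Or.inl (hgeo.interface_subset hy)⟩

end Data.Geometric

namespace IsTraceSet

variable {n : ℕ} {D : Data n} {S : Set (Rd n)} (hS : IsTraceSet D S)

include hS

theorem measurableSet : MeasurableSet S := hS.hypersurface.measurableSet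

theorem subset_closure : S ⊆ closure D.Ω := fun y hy =>
  (hS.mem y hy).elim (fun h => _root_.subset_closure h) fun h => h.1

theorem isCompact_closure (hgeo : D.Geometric) : IsCompact (closure S) :=
  (Metric.isCompact_of_isClosed_isBounded isClosed_closure
    (hgeo.isBounded.closure.subset (closure_minimal hS.subset_closure isClosed_closure)))

theorem nonempty_flattening {x : Rd n} (hx : x ∈ closure S) : Nonempty (Flattening S x) := by
  obtain ⟨M, hM, hsub⟩ := hS.submanifold
  exact exists_flattening_of_submanifold hM (hsub hx) univ_mem
    fun p hp => hsub (_root_.subset_closure hp.1)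

theorem surfaceMeasure_lt_top (hgeo : D.Geometric) : surfaceMeasure n S < ⊤ := by
  have h : surfaceMeasure n (S ∩ closure S) < ⊤ := by
    refine (hS.isCompact_closure hgeo).induction_on (p := fun T => surfaceMeasure n (S ∩ T) < ⊤)
      (by simp) (fun T T' hT h => (measure_mono (inter_subset_inter_right _ hT)).trans_lt h)
      (fun T T' h h' => ?_) fun x hx => ?_
    · rw [inter_union_distrib_left]
      exact (measure_union_le _ _).trans_lt (ENNReal.add_lt_top.2 ⟨h, h'⟩)
    · obtain ⟨e⟩ := hS.nonempty_flattening hx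
      exact ⟨_, mem_nhdsWithin_of_mem_nhds (Metric.ball_mem_nhds x e.r_pos),
        e.surfaceMeasure_lt_top hS.measurableSet⟩
  rwa [inter_eq_left.2 _root_.subset_closure] at h

theorem volume_eq_zero (hgeo : D.Geometric) : volume S = 0 := by
  have h : volume (S ∩ closure S) = 0 := by
    refine (hS.isCompact_closure hgeo).induction_on (p := fun T => volume (S ∩ T) = 0)
      (by simp) (fun T T' hT h => measure_mono_null (inter_subset_inter_right _ hT) h)
      (fun T T' h h' => ?_) fun x hx => ?_
    · rw [inter_union_distrib_left]
      exact measure_union_null h h'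
    · obtain ⟨e⟩ := hS.nonempty_flattening hx
      exact ⟨_, mem_nhdsWithin_of_mem_nhds (Metric.ball_mem_nhds x e.r_pos), e.volume_inter_ball⟩
  rwa [inter_eq_left.2 _root_.subset_closure] at h

end IsTraceSet

end

end DynBC

namespace DynBC

noncomputable section

theorem measurable_grad {n : ℕ} (u : Rd n → ℂ) : Measurable (grad u) := by
  unfold grad
  refine (PiLp.continuous_toLp 2 _).measurable.comp (measurable_pi_lambda _ fun i => ?_)
  exact measurable_fderiv_apply_const ℝ u _

namespace Data.Geometric

variable {n : ℕ} {D : Data n} (hgeo : D.Geometric) {u : Rd n → ℂ}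

include hgeo

theorem measurableSet : MeasurableSet D.Ω := hgeo.isOpen.measurableSet

theorem measurable_indicator (hu : IsTest D.ΓD u) : Measurable (D.Ω.indicator u) :=
  hu.smooth.continuous.measurable.indicator hgeo.measurableSet

theorem measurable_indicator_grad (u : Rd n → ℂ) :
    Measurable (D.Ω.indicator fun p => ‖grad u p‖ₑ) :=
  (measurable_grad u).enorm.indicator hgeo.measurableSet

theorem lintegral_indicator_sq (u : Rd n → ℂ) :
    ∫⁻ p, ‖D.Ω.indicator u p‖ₑ ^ 2 = ∫⁻ p in D.Ω, ‖u p‖ₑ ^ 2 := by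
  rw [← lintegral_indicator hgeo.measurableSet]
  congr 1 with p
  by_cases hp : p ∈ D.Ω <;> simp [hp]

theorem lintegral_indicator_grad_sq (u : Rd n → ℂ) :
    ∫⁻ p, D.Ω.indicator (fun p => ‖grad u p‖ₑ) p ^ 2 = ∫⁻ p in D.Ω, ‖grad u p‖ₑ ^ 2 := by
  rw [← lintegral_indicator hgeo.measurableSet]
  congr 1 with p
  by_cases hp : p ∈ D.Ω <;> simp [hp]

end Data.Geometric

theorem IsTest.exists_bound {n : ℕ} {ΓD : Set (Rd n)} {u : Rd n → ℂ} (hu : IsTest ΓD u) :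
    ∃ M, ∀ p, ‖u p‖ ≤ M :=
  hu.compact.exists_bound_of_continuous hu.smooth.continuous

/-! ### The trace estimate -/

/-- The folded estimates for the two sides of N are added, since the side from which u(p) is
recovered depends on p. The bound is uniform in ε, so Fatou's lemma passes to the limit. -/
theorem IsTraceSet.exists_local_trace_le {n : ℕ} {D : Data n} {S : Set (Rd n)}
    (hS : IsTraceSet D S) (hgeo : D.Geometric) {x : Rd n} (hx : x ∈ closure S) :
    ∃ ρ : ℝ, 0 < ρ ∧ ∃ C : ℝ≥0, ∀ u, IsTest D.ΓD u → ∀ δ, 0 < δ → δ < ρ →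
      ENNReal.ofReal δ * ∫⁻ p in S ∩ Metric.ball x ρ, ‖u p‖ₑ ^ 2 ∂(surfaceMeasure n) ≤
        C * ((∫⁻ p in D.Ω, ‖u p‖ₑ ^ 2) +
          ENNReal.ofReal δ ^ 2 * ∫⁻ p in D.Ω, ‖grad u p‖ₑ ^ 2) := by
  obtain ⟨f⟩ := hgeo.nonempty_flattening_N x
  obtain ⟨e⟩ := hS.nonempty_flattening hx
  obtain ⟨ρ₁, hρ₁, C₁, h₁⟩ := f.exists_trace_le e hS.measurableSet
  obtain ⟨ρ₂, hρ₂, C₂, h₂⟩ := f.flip.exists_trace_le e hS.measurableSet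
  set ρ := min f.σ (min ρ₁ ρ₂) with hρ
  have hρ0 : 0 < ρ := lt_min f.σ_pos (lt_min hρ₁ hρ₂)
  have hle₁ : ρ ≤ ρ₁ := (min_le_right _ _).trans (min_le_left _ _)
  have hle₂ : ρ ≤ ρ₂ := (min_le_right _ _).trans (min_le_right _ _)
  refine ⟨ρ, hρ0, C₁ + C₂, fun u hu δ hδ hδρ => ?_⟩
  set v := D.Ω.indicator u with hv
  have hvm : Measurable v := hgeo.measurable_indicator hu
  have hgm := hgeo.measurable_indicator_grad u
  have hug := isUpperGradientOn_indicator hgeo.isOpen hgeo.frontier_subset hu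
  have hFm : ∀ (f : Flattening D.N x) (ε : ℝ), Measurable fun p => ‖v (f.F ε p)‖ₑ ^ 2 :=
    fun f ε => ((hvm.comp (f.lip_F ε).continuous.measurable).enorm).pow_const 2
  set E := (∫⁻ p in D.Ω, ‖u p‖ₑ ^ 2) + ENNReal.ofReal δ ^ 2 * ∫⁻ p in D.Ω, ‖grad u p‖ₑ ^ 2
  set T := S ∩ Metric.ball x ρ with hT
  have hTm : MeasurableSet T := hS.measurableSet.inter Metric.isOpen_ball.measurableSet
  have hδ0 : ENNReal.ofReal δ ≠ 0 := by simpa using hδ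
  have hbound : ∀ ε, 0 < ε → ε < ρ →
      ∫⁻ p in T, (‖v (f.F ε p)‖ₑ ^ 2 + ‖v (f.flip.F ε p)‖ₑ ^ 2) ∂(surfaceMeasure n) ≤
        (ENNReal.ofReal δ)⁻¹ * ((C₁ + C₂ : ℝ≥0) * E) := by
    intro ε hε hερ
    rw [← ENNReal.mul_le_iff_le_inv hδ0 ENNReal.ofReal_ne_top, lintegral_add_left (hFm f ε),
      mul_add, ENNReal.coe_add, add_mul]
    have k₁ := h₁ v _ hvm hgm hug δ hδ (hδρ.trans_le hle₁) ε hε (hερ.trans_le hle₁)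
    have k₂ := h₂ v _ hvm hgm hug δ hδ (hδρ.trans_le hle₂) ε hε (hερ.trans_le hle₂)
    rw [hgeo.lintegral_indicator_sq, hgeo.lintegral_indicator_grad_sq] at k₁ k₂
    refine add_le_add (le_trans ?_ k₁) (le_trans ?_ k₂)
    · gcongr
      exact inter_subset_inter_right _ (Metric.ball_subset_ball hle₁)
    · gcongr
      exact inter_subset_inter_right _ (Metric.ball_subset_ball hle₂)
  rw [ENNReal.mul_le_iff_le_inv hδ0 ENNReal.ofReal_ne_top]
  calc ∫⁻ p in T, ‖u p‖ₑ ^ 2 ∂(surfaceMeasure n)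
      ≤ ∫⁻ p in T, liminf (fun ε => ‖v (f.F ε p)‖ₑ ^ 2 + ‖v (f.flip.F ε p)‖ₑ ^ 2) (𝓝[>] 0)
          ∂(surfaceMeasure n) := by
        refine setLIntegral_mono' hTm fun p hp => ?_
        have hpx : p ∈ Metric.ball x f.σ := Metric.ball_subset_ball (min_le_left _ _) hp.2
        have hcont : Continuous fun z : ℂ => ‖z‖ₑ ^ 2 := by fun_prop
        rcases f.tendsto_indicator_F_or hgeo.isOpen hgeo.isClosed_D hgeo.frontier_subset hpx
          (hS.mem p hp.1) hu.smooth.continuous with h | h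
        · rw [← ((hcont.tendsto _).comp h).liminf_eq]
          exact liminf_le_liminf (Eventually.of_forall fun ε => le_self_add)
        · rw [← ((hcont.tendsto _).comp h).liminf_eq]
          exact liminf_le_liminf (Eventually.of_forall fun ε => le_add_self)
    _ ≤ liminf (fun ε => ∫⁻ p in T, (‖v (f.F ε p)‖ₑ ^ 2 + ‖v (f.flip.F ε p)‖ₑ ^ 2)
          ∂(surfaceMeasure n)) (𝓝[>] 0) :=
        lintegral_liminf_le fun ε => (hFm f ε).add (hFm f.flip ε)
    _ ≤ _ := by
        refine liminf_le_of_frequently_le' (Eventually.frequently ?_)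
        filter_upwards [Ioo_mem_nhdsGT hρ0] with ε hε using hbound ε hε.1 hε.2

/-- The trace estimate: the `L²(S)` norm is controlled by the `L²(Ω)` norm and a small multiple
of the norm of the gradient. -/
theorem IsTraceSet.exists_trace_le {n : ℕ} {D : Data n} {S : Set (Rd n)}
    (hS : IsTraceSet D S) (hgeo : D.Geometric) :
    ∃ ρ : ℝ, 0 < ρ ∧ ∃ C : ℝ≥0, ∀ u, IsTest D.ΓD u → ∀ δ, 0 < δ → δ < ρ →
      ENNReal.ofReal δ * ∫⁻ p in S, ‖u p‖ₑ ^ 2 ∂(surfaceMeasure n) ≤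
        C * ((∫⁻ p in D.Ω, ‖u p‖ₑ ^ 2) +
          ENNReal.ofReal δ ^ 2 * ∫⁻ p in D.Ω, ‖grad u p‖ₑ ^ 2) := by
  -- Over a finite cover of the closure the radii go to their minimum and the constants add up.
  have key := (hS.isCompact_closure hgeo).induction_on (p := fun T =>
    ∃ ρ : ℝ, 0 < ρ ∧ ∃ C : ℝ≥0, ∀ u, IsTest D.ΓD u → ∀ δ, 0 < δ → δ < ρ →
      ENNReal.ofReal δ * ∫⁻ p in S ∩ T, ‖u p‖ₑ ^ 2 ∂(surfaceMeasure n) ≤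
        C * ((∫⁻ p in D.Ω, ‖u p‖ₑ ^ 2) +
          ENNReal.ofReal δ ^ 2 * ∫⁻ p in D.Ω, ‖grad u p‖ₑ ^ 2))
    ⟨1, one_pos, 0, fun u _ δ _ _ => by simp⟩
    (fun T T' hT ⟨ρ, hρ, C, h⟩ => ⟨ρ, hρ, C, fun u hu δ hδ hδρ =>
      le_trans (by gcongr) (h u hu δ hδ hδρ)⟩)
    (fun T T' ⟨ρ, hρ, C, h⟩ ⟨ρ', hρ', C', h'⟩ => ⟨min ρ ρ', lt_min hρ hρ', C + C',
      fun u hu δ hδ hδρ => ?_⟩)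
    fun x hx => ?_
  · rwa [inter_eq_left.2 _root_.subset_closure] at key
  · rw [inter_union_distrib_left, ENNReal.coe_add, add_mul]
    refine le_trans (mul_le_mul_right (lintegral_union_le _ _ _) _) ?_
    rw [mul_add]
    exact add_le_add (h u hu δ hδ (hδρ.trans_le (min_le_left _ _)))
      (h' u hu δ hδ (hδρ.trans_le (min_le_right _ _)))
  · obtain ⟨ρ, hρ, h⟩ := hS.exists_local_trace_le hgeo hx
    exact ⟨_, mem_nhdsWithin_of_mem_nhds (Metric.ball_mem_nhds x hρ), ρ, hρ, h⟩

/-! ### Finitely many functionals control the `L²` norm -/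

/-- The space `C_D^∞(Ω)`, as a space of functions on `ℝ^d`. -/
def testSpace {n : ℕ} (ΓD : Set (Rd n)) : Submodule ℂ (Rd n → ℂ) where
  carrier := {u | IsTest ΓD u}
  add_mem' := IsTest.add
  zero_mem' := IsTest.zero ΓD
  smul_mem' a _ hu := hu.smul a

namespace Flattening

variable {n : ℕ} {D : Data n} {x : Rd n}

theorem volume_lt_top_of_subset_half (f : Flattening D.N x) {Q : Set (Rd n)} (hQ : Q ⊆ f.half) :
    volume Q < ⊤ :=
  (measure_mono (hQ.trans inter_subset_left)).trans_lt measure_ball_lt_top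

theorem integrableOn_indicator (f : Flattening D.N x) (hgeo : D.Geometric) {Q : Set (Rd n)}
    (hQ : Q ⊆ f.half) {u : Rd n → ℂ} (hu : IsTest D.ΓD u) :
    IntegrableOn (fun z => D.Ω.indicator u (f.κ z)) Q := by
  obtain ⟨M, hM⟩ := hu.exists_bound
  refine Measure.integrableOn_of_bounded (M := M) (f.volume_lt_top_of_subset_half hQ).ne
    ((hgeo.measurable_indicator hu).comp f.lip_κ.continuous.measurable).aestronglyMeasurable ?_
  exact Eventually.of_forall fun z => (norm_indicator_le_norm_self _ _).trans (hM _)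

/-- The mean over `Q`, in flattened coordinates, of the extension by zero. -/
def mean (f : Flattening D.N x) (hgeo : D.Geometric) {Q : Set (Rd n)} (hQ : Q ⊆ f.half) :
    testSpace D.ΓD →ₗ[ℂ] ℂ where
  toFun u := ∫ z in Q, D.Ω.indicator u.1 (f.κ z)
  map_add' u v := by
    rw [← integral_add (f.integrableOn_indicator hgeo hQ u.2)
      (f.integrableOn_indicator hgeo hQ v.2)]
    congr 1 with z
    exact congrFun (indicator_add D.Ω u.1 v.1) _
  map_smul' a u := by
    rw [RingHom.id_apply, smul_eq_mul, ← integral_const_mul]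
    congr 1 with z
    exact congrFun (indicator_const_smul D.Ω a u.1) _

theorem enorm_mean_sq_le (f : Flattening D.N x) (hgeo : D.Geometric) {Q : Set (Rd n)}
    (hQ : Q ⊆ f.half) (u : testSpace D.ΓD) :
    ‖f.mean hgeo hQ u‖ₑ ^ 2 ≤
      volume Q * f.K ^ (n + 1) * ∫⁻ p in D.Ω, ‖u.1 p‖ₑ ^ 2 := by
  have hm := hgeo.measurable_indicator u.2
  calc ‖f.mean hgeo hQ u‖ₑ ^ 2 ≤ (∫⁻ z in Q, ‖D.Ω.indicator u.1 (f.κ z)‖ₑ) ^ 2 := by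
        gcongr
        exact enorm_integral_le_lintegral_enorm _
    _ ≤ volume Q * ∫⁻ z in Q, ‖D.Ω.indicator u.1 (f.κ z)‖ₑ ^ 2 := by
        refine (sq_lintegral_le _
          (hm.comp f.lip_κ.continuous.measurable).enorm.aemeasurable).trans (le_of_eq ?_)
        rw [Measure.restrict_apply_univ]
        rfl
    _ ≤ volume Q * (f.K ^ (n + 1) * ∫⁻ p, ‖D.Ω.indicator u.1 p‖ₑ ^ 2) := by
        gcongr
        exact f.setLIntegral_half_le (H := fun p => ‖D.Ω.indicator u.1 p‖ₑ ^ 2)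
          (hm.enorm.pow_const 2) hQ
    _ = _ := by rw [hgeo.lintegral_indicator_sq, mul_assoc]

/-- The functionals are the integrals over the grid cells; Cauchy–Schwarz and the change of
variables bound them in L²(Ω). -/
theorem exists_functionals_half (f : Flattening D.N x) (hgeo : D.Geometric) {τ : ℝ≥0}
    (hτ : 0 < τ) :
    ∃ (ι : Type) (_ : Fintype ι) (Λ : ι → testSpace D.ΓD →ₗ[ℂ] ℂ) (C : ℝ≥0),
      (∀ i u, ‖Λ i u‖ₑ ^ 2 ≤ C * ∫⁻ p in D.Ω, ‖u.1 p‖ₑ ^ 2) ∧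
      ∀ u : testSpace D.ΓD, ∫⁻ z in f.half, ‖D.Ω.indicator u.1 (f.κ z)‖ₑ ^ 2 ≤
        C * ∑ i, ‖Λ i u‖ₑ ^ 2 + τ * ∫⁻ p in D.Ω, ‖grad u.1 p‖ₑ ^ 2 := by
  obtain ⟨s, Q, -, hQ, C, h⟩ := f.exists_finite_means hτ
  have hfin : volume f.half ≠ ⊤ := (f.volume_lt_top_of_subset_half le_rfl).ne
  refine ⟨s, inferInstance, fun c => f.mean hgeo (hQ c),
    max C ((volume f.half).toNNReal * f.K ^ (n + 1)), fun c u => ?_, fun u => ?_⟩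
  · refine (f.enorm_mean_sq_le hgeo (hQ c) u).trans ?_
    gcongr
    refine le_trans ?_ (ENNReal.coe_le_coe.2 (le_max_right _ _))
    rw [ENNReal.coe_mul, ENNReal.coe_toNNReal hfin, ENNReal.coe_pow]
    gcongr
    exact hQ c
  · obtain ⟨M, hM⟩ := u.2.exists_bound
    have := h _ _ (hgeo.measurable_indicator u.2)
      ⟨M, fun p => (norm_indicator_le_norm_self _ _).trans (hM p)⟩
      (hgeo.measurable_indicator_grad u.1)
      (isUpperGradientOn_indicator hgeo.isOpen hgeo.frontier_subset u.2)
    rw [hgeo.lintegral_indicator_grad_sq] at this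
    refine this.trans ?_
    gcongr
    · exact le_max_left _ _
    · rw [← Finset.sum_coe_sort]
      exact le_rfl

end Flattening

theorem Data.Geometric.exists_functionals {n : ℕ} {D : Data n} (hgeo : D.Geometric) {τ : ℝ≥0}
    (hτ : 0 < τ) :
    ∃ (ι : Type) (_ : Fintype ι) (Λ : ι → testSpace D.ΓD →ₗ[ℂ] ℂ) (C : ℝ≥0),
      (∀ i u, ‖Λ i u‖ₑ ^ 2 ≤ C * ∫⁻ p in D.Ω, ‖u.1 p‖ₑ ^ 2) ∧
      ∀ u : testSpace D.ΓD, ∫⁻ p in D.Ω, ‖u.1 p‖ₑ ^ 2 ≤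
        C * ∑ i, ‖Λ i u‖ₑ ^ 2 + τ * ∫⁻ p in D.Ω, ‖grad u.1 p‖ₑ ^ 2 := by
  have hcomp : IsCompact (closure D.Ω) :=
    Metric.isCompact_of_isClosed_isBounded isClosed_closure hgeo.isBounded.closure
  -- The local property is stated for all τ at once, so that a union of two sets can spend τ/2 on
  -- each.
  have key := hcomp.induction_on (p := fun T => ∀ τ : ℝ≥0, 0 < τ →
    ∃ (ι : Type) (_ : Fintype ι) (Λ : ι → testSpace D.ΓD →ₗ[ℂ] ℂ) (C : ℝ≥0),
      (∀ i u, ‖Λ i u‖ₑ ^ 2 ≤ C * ∫⁻ p in D.Ω, ‖u.1 p‖ₑ ^ 2) ∧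
      ∀ u : testSpace D.ΓD, ∫⁻ p in T, ‖D.Ω.indicator u.1 p‖ₑ ^ 2 ≤
        C * ∑ i, ‖Λ i u‖ₑ ^ 2 + τ * ∫⁻ p in D.Ω, ‖grad u.1 p‖ₑ ^ 2)
    (fun τ _ => ⟨Fin 0, inferInstance, 0, 0, fun i => i.elim0, fun u => by simp⟩)
    (fun T T' hT h τ hτ => ?_) (fun T T' h h' τ hτ => ?_) fun x _ => ?_
  · obtain ⟨ι, _, Λ, C, h₁, h₂⟩ := key τ hτ
    refine ⟨ι, inferInstance, Λ, C, h₁, fun u => le_trans ?_ (h₂ u)⟩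
    rw [← hgeo.lintegral_indicator_sq, ← setLIntegral_univ, ← union_compl_self (closure D.Ω)]
    refine (lintegral_union_le _ _ _).trans (le_of_eq ?_)
    convert add_zero _
    refine setLIntegral_eq_zero isClosed_closure.measurableSet.compl fun p hp => ?_
    simp [indicator_of_notMem fun h => hp (subset_closure h)]
  · obtain ⟨ι, i, Λ, C, h₁, h₂⟩ := h τ hτ
    exact ⟨ι, i, Λ, C, h₁, fun u => (lintegral_mono_set hT).trans (h₂ u)⟩
  · obtain ⟨ι, i, Λ, C, h₁, h₂⟩ := h (τ / 2) (half_pos hτ)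
    obtain ⟨ι', i', Λ', C', h₁', h₂'⟩ := h' (τ / 2) (half_pos hτ)
    refine ⟨ι ⊕ ι', inferInstance, Sum.elim Λ Λ', max C C', ?_, fun u => ?_⟩
    · rintro (i | i) u
      · refine (h₁ i u).trans ?_
        gcongr
        exact le_max_left _ _
      · refine (h₁' i u).trans ?_
        gcongr
        exact le_max_right _ _
    · refine (lintegral_union_le _ _ _).trans ((add_le_add (h₂ u) (h₂' u)).trans ?_)
      rw [Fintype.sum_sum_type]
      simp only [Sum.elim_inl, Sum.elim_inr]
      rw [mul_add]
      have hτ2 : (τ : ℝ≥0∞) = (τ / 2 : ℝ≥0) + (τ / 2 : ℝ≥0) := by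
        rw [← ENNReal.coe_add, add_halves]
      rw [hτ2, add_mul, add_add_add_comm]
      gcongr
      · exact le_max_left _ _
      · exact le_max_right _ _
  · obtain ⟨f⟩ := hgeo.nonempty_flattening_N x
    refine ⟨_, mem_nhdsWithin_of_mem_nhds (Metric.ball_mem_nhds x f.σ_pos), fun τ hτ => ?_⟩
    have hK : 0 < f.K ^ (n + 1) := pow_pos (zero_lt_one.trans_le f.one_le) _
    -- Two sides of N contribute, and leaving the flat coordinates costs K^(n+1).
    have hτ' : 0 < τ / (2 * f.K ^ (n + 1)) := div_pos hτ (mul_pos two_pos hK)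
    obtain ⟨ι, i, Λ, C, h₁, h₂⟩ := f.exists_functionals_half hgeo hτ'
    obtain ⟨ι', i', Λ', C', h₁', h₂'⟩ := f.flip.exists_functionals_half hgeo hτ'
    have hKC : ∀ A : ℝ≥0, A ≤ f.K ^ (n + 1) * A := fun A =>
      le_mul_of_one_le_left (zero_le) (one_le_pow₀ f.one_le)
    refine ⟨ι ⊕ ι', inferInstance, Sum.elim Λ Λ', f.K ^ (n + 1) * max C C', ?_, fun u => ?_⟩
    · rintro (i | i) u
      · refine (h₁ i u).trans ?_
        gcongr
        exact (le_max_left _ _).trans (hKC _)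
      · refine (h₁' i u).trans ?_
        gcongr
        exact (le_max_right _ _).trans (hKC _)
    · have hm := (hgeo.measurable_indicator u.2).enorm.pow_const 2
      refine (f.setLIntegral_ball_le_add hm).trans ?_
      refine (mul_le_mul_right (add_le_add (h₂ u) (h₂' u)) _).trans ?_
      have hτ2 : (τ : ℝ≥0∞) = (f.K ^ (n + 1) : ℝ≥0) * ((τ / (2 * f.K ^ (n + 1)) : ℝ≥0) +
          (τ / (2 * f.K ^ (n + 1)) : ℝ≥0)) := by
        rw [← ENNReal.coe_add, ← ENNReal.coe_mul, ENNReal.coe_inj]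
        field_simp
        norm_num
      rw [Fintype.sum_sum_type, ENNReal.coe_mul, mul_assoc, hτ2, mul_assoc, ← mul_add]
      rw [ENNReal.coe_pow, add_mul, add_add_add_comm, mul_add ((max C C' : ℝ≥0) : ℝ≥0∞)]
      simp only [Sum.elim_inl, Sum.elim_inr]
      gcongr
      · exact le_max_left _ _
      · exact le_max_right _ _

end

end DynBC

namespace DynBC

noncomputable section

/-! ### The surface gradient as a projection of the gradient -/

namespace GraphChart

variable {n : ℕ} {S : Set (Rd n)} (c : GraphChart S)

/-- The Jacobian matrix of the coordinate map. -/
def jacobian (y : Rp n) : Matrix (Fin (n + 1)) (Fin n) ℝ :=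
  Matrix.of fun k i => c.partialMap y i k

theorem metricTensor_eq (y : Rp n) :
    c.metricTensor y = (c.jacobian y).transpose * c.jacobian y := by
  ext i j
  simp [metricTensor, jacobian, Matrix.mul_apply, PiLp.inner_apply, mul_comm]

/-- The projection matrix onto the tangent space. -/
def tangentProj (y : Rp n) : Matrix (Fin (n + 1)) (Fin (n + 1)) ℝ :=
  c.jacobian y * (c.metricTensor y)⁻¹ * (c.jacobian y).transpose

/-- The inverse of the coordinate map. -/
def param (x : Rd n) : Rp n := proj (c.Q.symm (x - c.x₀))

theorem map_eq (y : Rp n) : c.map y = c.Q (emb y (c.h y)) + c.x₀ := rfl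

theorem param_map (y : Rp n) : c.param (c.map y) = y := by
  simp [param, map_eq]

/-- The linear part of `param`. -/
def paramLin : Rd n →L[ℝ] Rp n :=
  LinearMap.toContinuousLinearMap
    (⟨⟨proj, fun _ _ => rfl⟩, fun _ _ => rfl⟩ : Rd n →ₗ[ℝ] Rp n) ∘L
    (c.Q.symm.toContinuousLinearEquiv : Rd n →L[ℝ] Rd n)

theorem hasFDerivAt_param (x : Rd n) : HasFDerivAt c.param c.paramLin x := by
  have h : c.param = fun x => c.paramLin (x - c.x₀) := rfl
  rw [h]
  exact c.paramLin.hasFDerivAt.comp x ((hasFDerivAt_id x).sub_const c.x₀)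

theorem lipschitzOnWith_map : ∃ K : ℝ≥0, LipschitzOnWith K c.map c.U := by
  obtain ⟨K, hK⟩ := c.lipschitz
  refine ⟨1 + K, LipschitzOnWith.of_dist_le_mul fun y hy y' hy' => ?_⟩
  rw [map_eq, map_eq, dist_add_right, LinearIsometryEquiv.dist_map, NNReal.coe_add, add_mul,
    NNReal.coe_one, one_mul]
  refine (dist_triangle _ (emb y' (c.h y)) _).trans (add_le_add ?_ ?_)
  · rw [dist_emb_left]
  · rw [dist_emb_right]
    exact hK.dist_le_mul y hy y' hy'

variable {c}

/-- The parameter of a graph point is recovered by an affine map, so the derivative of a chart has a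
linear left inverse. This makes the Jacobian injective and the metric tensor invertible. -/
theorem RegularAt.paramLin_fderiv {y : Rp n} {x : Rd n} (h : c.RegularAt y x) :
    c.paramLin ∘L fderiv ℝ c.map y = ContinuousLinearMap.id ℝ (Rp n) := by
  have h1 := (c.hasFDerivAt_param (c.map y)).comp y h.2.2.hasFDerivAt
  have h2 : c.param ∘ c.map = id := funext c.param_map
  rw [h2] at h1
  exact h1.unique (hasFDerivAt_id y)

theorem fderiv_map_apply (y η : Rp n) (k : Fin (n + 1)) :
    fderiv ℝ c.map y η k = (c.jacobian y).mulVec η k := by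
  conv_lhs => rw [← (EuclideanSpace.basisFun (Fin n) ℝ).sum_repr η]
  simp [map_sum, jacobian, partialMap, Matrix.mulVec, dotProduct, mul_comm]

theorem RegularAt.isUnit_det {y : Rp n} {x : Rd n} (h : c.RegularAt y x) :
    IsUnit (c.metricTensor y).det := by
  have hinj : Function.Injective (c.jacobian y).mulVec := by
    intro a b hab
    have h1 : fderiv ℝ c.map y (WithLp.toLp 2 a) = fderiv ℝ c.map y (WithLp.toLp 2 b) := by
      ext k
      rw [fderiv_map_apply, fderiv_map_apply]
      exact congrFun hab k
    have h2 := congrArg c.paramLin h1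
    have h3 : ∀ η, c.paramLin (fderiv ℝ c.map y η) = η := fun η => by
      rw [← ContinuousLinearMap.comp_apply, h.paramLin_fderiv]; rfl
    rw [h3, h3] at h2
    exact congrArg WithLp.ofLp h2
  have := (Matrix.PosDef.conjTranspose_mul_self (c.jacobian y) hinj).isUnit
  rw [Matrix.conjTranspose_eq_transpose_of_trivial, ← metricTensor_eq] at this
  exact (Matrix.isUnit_iff_isUnit_det _).1 this

theorem RegularAt.tangentProj_mul_jacobian {y : Rp n} {x : Rd n} (h : c.RegularAt y x) :
    c.tangentProj y * c.jacobian y = c.jacobian y := by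
  rw [tangentProj, Matrix.mul_assoc, Matrix.mul_assoc, ← metricTensor_eq,
    Matrix.nonsing_inv_mul _ h.isUnit_det, Matrix.mul_one]

theorem transpose_tangentProj (y : Rp n) : (c.tangentProj y).transpose = c.tangentProj y := by
  have : (c.metricTensor y).transpose = c.metricTensor y := by
    rw [metricTensor_eq, Matrix.transpose_mul, Matrix.transpose_transpose]
  rw [tangentProj, Matrix.transpose_mul, Matrix.transpose_mul, Matrix.transpose_transpose,
    Matrix.transpose_nonsing_inv, this, Matrix.mul_assoc]

theorem RegularAt.tangentProj_mul_of_jacobian_eq {c' : GraphChart S} {y y' : Rp n} {x : Rd n}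
    (h : c.RegularAt y x) {R : Matrix (Fin n) (Fin n) ℝ}
    (hR : c'.jacobian y' = c.jacobian y * R) :
    c.tangentProj y * c'.tangentProj y' = c'.tangentProj y' := by
  have : c.tangentProj y * c'.jacobian y' = c'.jacobian y' := by
    rw [hR, ← Matrix.mul_assoc, h.tangentProj_mul_jacobian]
  rw [tangentProj.eq_1 c', ← Matrix.mul_assoc, ← Matrix.mul_assoc, this]

/-- Near y' the chart c' factors as `c.map ∘ c.param ∘ c'.map`. As `c.param` is affine, the chain
rule needs differentiability only at the two given parameters. -/
theorem RegularAt.exists_jacobian_eq {c' : GraphChart S} {y y' : Rp n} {x : Rd n}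
    (h : c.RegularAt y x) (h' : c'.RegularAt y' x) :
    ∃ R : Matrix (Fin n) (Fin n) ℝ, c'.jacobian y' = c.jacobian y * R := by
  have hev : c'.map =ᶠ[𝓝 y'] fun z => c.map (c.param (c'.map z)) := by
    have hV : x ∈ c.V := by
      have := c.bijOn.mapsTo h.1
      exact h.2.1 ▸ this.2
    have h1 : ∀ᶠ z in 𝓝 y', c'.map z ∈ c.V :=
      h'.2.2.continuousAt.eventually (c.isOpen_V.mem_nhds (h'.2.1 ▸ hV))
    filter_upwards [h1, c'.isOpen_U.mem_nhds h'.1] with z hz hzU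
    obtain ⟨w, -, hw⟩ := c.bijOn.surjOn ⟨(c'.bijOn.mapsTo hzU).1, hz⟩
    change c.map w = c'.map z at hw
    rw [← hw, param_map]
  have hpy : c.param (c'.map y') = y := by rw [h'.2.1, ← h.2.1, param_map]
  have hd : HasFDerivAt c'.map
      (fderiv ℝ c.map y ∘L (c.paramLin ∘L fderiv ℝ c'.map y')) y' := by
    refine HasFDerivAt.congr_of_eventuallyEq ?_ hev
    have h2 := (c.hasFDerivAt_param (c'.map y')).comp y' h'.2.2.hasFDerivAt
    refine HasFDerivAt.comp (g := c.map) y' ?_ h2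
    rw [hpy]
    exact h.2.2.hasFDerivAt
  refine ⟨Matrix.of fun i j => c.paramLin (c'.partialMap y' j) i, ?_⟩
  ext k j
  have h3 : c'.jacobian y' k j = fderiv ℝ c.map y (c.paramLin (c'.partialMap y' j)) k := by
    change c'.partialMap y' j k = _
    conv_lhs => rw [partialMap, hd.fderiv]
    rfl
  rw [h3, fderiv_map_apply]
  rfl

/-- Each projection fixes the columns of the other Jacobian: PP' = P' and P'P = P. Transposing the
first identity gives P'P = P', since both matrices are symmetric, hence P = P'. -/
theorem RegularAt.tangentProj_eq {c' : GraphChart S} {y y' : Rp n} {x : Rd n}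
    (h : c.RegularAt y x) (h' : c'.RegularAt y' x) : c.tangentProj y = c'.tangentProj y' := by
  obtain ⟨R, hR⟩ := h.exists_jacobian_eq h'
  obtain ⟨R', hR'⟩ := h'.exists_jacobian_eq h
  have h1 := congrArg Matrix.transpose (h.tangentProj_mul_of_jacobian_eq hR)
  rw [Matrix.transpose_mul, transpose_tangentProj, transpose_tangentProj] at h1
  rw [← h1, h'.tangentProj_mul_of_jacobian_eq hR']

/-- Application of a real matrix to a complex vector. -/
def _root_.DynBC.realMul {n : ℕ} (B : Matrix (Fin (n + 1)) (Fin (n + 1)) ℝ) (a : Cd n) : Cd n :=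
  WithLp.toLp 2 fun k => ∑ l, (B k l : ℂ) * a l

/-- The chain rule turns the coordinate derivatives into Jᵀ∇u for the Jacobian J, so the formula
becomes JG⁻¹Jᵀ∇u. In this form the surface gradient no longer depends on the chosen chart. -/
theorem RegularAt.surfaceGrad_eq {y : Rp n} {x : Rd n} (h : c.RegularAt y x) {u : Rd n → ℂ}
    (hu : DifferentiableAt ℝ u x) : c.surfaceGrad u y = realMul (c.tangentProj y) (grad u x) := by
  ext k
  have h1 : ∀ j, fderiv ℝ (u ∘ c.map) y (EuclideanSpace.single j 1) =
      ∑ l, (c.jacobian y l j : ℂ) * grad u x l := by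
    intro j
    rw [fderiv_comp y (h.2.1 ▸ hu) h.2.2, h.2.1, ContinuousLinearMap.comp_apply,
      fderiv_apply_eq_sum]
    rfl
  simp only [surfaceGrad, h1, realMul, tangentProj, Matrix.mul_apply, Finset.sum_mul,
    Finset.mul_sum, Complex.ofReal_sum, Complex.ofReal_mul, Matrix.transpose_apply]
  rw [Finset.sum_comm]
  conv_lhs => enter [2, j]; rw [Finset.sum_comm]
  rw [Finset.sum_comm]
  refine Finset.sum_congr rfl fun l _ => Finset.sum_congr rfl fun j _ =>
    Finset.sum_congr rfl fun i _ => ?_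
  change _ * _ * ((c.jacobian y k i : ℝ) : ℂ) = _
  ring

/-- The complexified matrix is a self-adjoint idempotent, hence of operator norm at most 1. -/
theorem RegularAt.norm_realMul_le {y : Rp n} {x : Rd n} (h : c.RegularAt y x) (a : Cd n) :
    ‖realMul (c.tangentProj y) a‖ ≤ ‖a‖ := by
  set P : Matrix (Fin (n + 1)) (Fin (n + 1)) ℂ := (c.tangentProj y).map Complex.ofRealHom with hP
  have hstar : IsStarProjection P := by
    refine ⟨?_, ?_⟩
    · change P * P = P
      rw [hP, ← Matrix.map_mul, h.tangentProj_mul_of_jacobian_eq (R := 1) (Matrix.mul_one _).symm]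
    · change P.conjTranspose = P
      conv_rhs => rw [hP, ← transpose_tangentProj]
      ext i j
      simp [hP]
  have h2 : IsStarProjection (Matrix.toEuclideanCLM (n := Fin (n + 1)) (𝕜 := ℂ) P) :=
    ⟨hstar.isIdempotentElem.map _, hstar.isSelfAdjoint.map _⟩
  have h3 : realMul (c.tangentProj y) a = Matrix.toEuclideanCLM (n := Fin (n + 1)) (𝕜 := ℂ) P a := by
    ext k
    simp [realMul, hP, Matrix.mulVec, dotProduct]
  rw [h3]
  exact ((ContinuousLinearMap.le_opNorm _ _).trans
    (mul_le_mul_of_nonneg_right h2.norm_le (norm_nonneg _))).trans_eq (one_mul _)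

variable (c)

/-- Rademacher's theorem leaves a null set of parameters, and the Lipschitz coordinate map sends it
to a null set of the surface. -/
theorem ae_regularAt (hS : MeasurableSet S) :
    ∀ᵐ x ∂(surfaceMeasure n).restrict (S ∩ c.V), c.RegularAt (c.param x) x := by
  obtain ⟨K, hK⟩ := c.lipschitzOnWith_map
  have h1 := hK.ae_differentiableWithinAt c.isOpen_U.measurableSet (μ := volume)
  rw [ae_restrict_iff' c.isOpen_U.measurableSet, ae_iff] at h1
  set Z : Set (Rp n) := {y | ¬(y ∈ c.U → DifferentiableWithinAt ℝ c.map c.U y)} with hZ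
  have hZU : Z ⊆ c.U := fun y hy => by
    by_contra h
    exact hy fun h' => (h h').elim
  have h2 := euclideanHausdorffMeasure_image_le (hK.mono hZU) n
  rw [EuclideanSpace.euclideanHausdorffMeasure_eq_volume, h1, mul_zero] at h2
  have h3 : surfaceMeasure n (c.map '' Z) = 0 := le_antisymm h2 zero_le
  rw [ae_restrict_iff' (hS.inter c.isOpen_V.measurableSet)]
  refine measure_mono_null (fun x hx => ?_) h3
  have hx' : ¬(x ∈ S ∩ c.V → c.RegularAt (c.param x) x) := hx
  rw [Classical.not_imp] at hx'
  obtain ⟨y, hyU, hyx⟩ := c.bijOn.surjOn hx'.1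
  change c.map y = x at hyx
  refine ⟨y, fun hy => hx'.2 ?_, hyx⟩
  rw [← hyx, param_map]
  exact ⟨hyU, rfl, (hy hyU).differentiableAt (c.isOpen_U.mem_nhds hyU)⟩

theorem measurable_jacobian (k : Fin (n + 1)) (i : Fin n) :
    Measurable fun y => c.jacobian y k i := by
  have h1 := measurable_fderiv_apply_const ℝ c.map (EuclideanSpace.single i 1)
  have h2 : Continuous fun z : Rd n => z k := by fun_prop
  exact h2.measurable.comp h1

theorem measurable_metricTensor_inv (i j : Fin n) :
    Measurable fun y => (c.metricTensor y)⁻¹ i j := by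
  have hG : Measurable fun y => (fun i j => c.metricTensor y i j : Fin n → Fin n → ℝ) := by
    refine measurable_pi_lambda _ fun i => measurable_pi_lambda _ fun j => ?_
    simp only [metricTensor_eq, Matrix.mul_apply, Matrix.transpose_apply]
    exact Finset.measurable_sum _ fun k _ => (c.measurable_jacobian k i).mul
      (c.measurable_jacobian k j)
  have hc : Continuous fun A : Fin n → Fin n → ℝ => (Matrix.of A).det :=
    Continuous.matrix_det continuous_id
  have ha : Continuous fun A : Fin n → Fin n → ℝ => (Matrix.of A).adjugate i j :=
    (Continuous.matrix_adjugate (A := fun A : Fin n → Fin n → ℝ => Matrix.of A)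
      continuous_id).matrix_elem i j
  have : (fun y => (c.metricTensor y)⁻¹ i j) = fun y =>
      (c.metricTensor y).det⁻¹ * (c.metricTensor y).adjugate i j := by
    funext y
    rw [Matrix.inv_def, Ring.inverse_eq_inv', Matrix.smul_apply, smul_eq_mul]
  rw [this]
  exact (hc.measurable.comp hG).inv.mul (ha.measurable.comp hG)

theorem measurable_tangentProj (k l : Fin (n + 1)) : Measurable fun y => c.tangentProj y k l := by
  simp only [tangentProj, Matrix.mul_apply, Matrix.transpose_apply]
  refine Finset.measurable_sum _ fun j _ => (Finset.measurable_sum _ fun i _ => ?_).mul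
    (c.measurable_jacobian l j)
  exact (c.measurable_jacobian k i).mul (c.measurable_metricTensor_inv i j)

theorem continuous_param : Continuous c.param :=
  continuous_iff_continuousAt.2 fun x => (c.hasFDerivAt_param x).continuousAt

end GraphChart

section SurfaceGrad

variable {n : ℕ} {S : Set (Rd n)}

theorem surfaceGrad_eq_of_regularAt {c : GraphChart S} {y : Rp n} {x : Rd n}
    (h : c.RegularAt y x) {u : Rd n → ℂ} (hu : DifferentiableAt ℝ u x) :
    surfaceGrad S u x = realMul (c.tangentProj y) (grad u x) := by
  have H : ∃ p : GraphChart S × Rp n, p.1.RegularAt p.2 x := ⟨(c, y), h⟩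
  rw [surfaceGrad, dif_pos H, H.choose_spec.surfaceGrad_eq hu, H.choose_spec.tangentProj_eq h]

theorem norm_surfaceGrad_le (S : Set (Rd n)) {u : Rd n → ℂ} {x : Rd n}
    (hu : DifferentiableAt ℝ u x) : ‖surfaceGrad S u x‖ ≤ ‖grad u x‖ := by
  by_cases H : ∃ p : GraphChart S × Rp n, p.1.RegularAt p.2 x
  · obtain ⟨p, hp⟩ := H
    rw [surfaceGrad_eq_of_regularAt hp hu]
    exact hp.norm_realMul_le _
  · rw [surfaceGrad, dif_neg H, norm_zero]
    exact norm_nonneg _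

/-- Pointwise choice of charts gives no measurability by itself; on each of countably many charts
the result agrees almost everywhere with the measurable projection of ∇u. -/
theorem aestronglyMeasurable_surfaceGrad (hS : IsLipschitzHypersurface S) {u : Rd n → ℂ}
    (hu : Differentiable ℝ u) :
    AEStronglyMeasurable (surfaceGrad S u) ((surfaceMeasure n).restrict S) := by
  obtain ⟨T, hT, hcov⟩ := hS.exists_countable_cover
  have := hT.to_subtype
  suffices h : ∀ c : T, AEStronglyMeasurable (surfaceGrad S u)
      ((surfaceMeasure n).restrict (S ∩ c.1.V)) by
    have h2 := AEStronglyMeasurable.iUnion h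
    rwa [← biUnion_eq_iUnion T fun c _ => S ∩ c.V, ← hcov] at h2
  intro c
  have hm : Measurable fun x => realMul (c.1.tangentProj (c.1.param x)) (grad u x) := by
    unfold realMul
    refine (PiLp.continuous_toLp 2 _).measurable.comp (measurable_pi_lambda _ fun k => ?_)
    refine Finset.measurable_sum _ fun l _ => ?_
    refine (Complex.measurable_ofReal.comp
      ((c.1.measurable_tangentProj k l).comp c.1.continuous_param.measurable)).mul ?_
    have h2 : Continuous fun z : Cd n => z l := by fun_prop
    exact h2.measurable.comp (measurable_grad u)
  refine hm.aestronglyMeasurable.congr ?_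
  filter_upwards [c.1.ae_regularAt hS.measurableSet] with x hx
  exact (surfaceGrad_eq_of_regularAt hx (hu x)).symm

/-- The real and the imaginary part of the surface gradient are tangent vectors. -/
theorem exists_isTangent_surfaceGrad {u : Rd n → ℂ} {x : Rd n} :
    surfaceGrad S u x = 0 ∨ ∃ ξ ζ : Rd n, IsTangent S x ξ ∧ IsTangent S x ζ ∧
      ∀ k, surfaceGrad S u x k = ξ k + ζ k * Complex.I := by
  by_cases H : ∃ p : GraphChart S × Rp n, p.1.RegularAt p.2 x
  · right
    set c := H.choose.1
    set y := H.choose.2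
    have hreg : c.RegularAt y x := H.choose_spec
    -- These are the complex coefficients with respect to the vectors ∂ᵢg; their real and imaginary
    -- parts define the two tangent vectors.
    obtain ⟨a, ha⟩ : ∃ a : Fin n → ℂ, a = fun i => ∑ j, (((c.metricTensor y)⁻¹ i j : ℝ) : ℂ) *
      fderiv ℝ (u ∘ c.map) y (EuclideanSpace.single j 1) := ⟨_, rfl⟩
    have hk : ∀ k, surfaceGrad S u x k = ∑ i, a i * ((c.jacobian y k i : ℝ) : ℂ) := fun k => by
      rw [surfaceGrad, dif_pos H]
      rw [ha]
      simp only [Finset.sum_mul]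
      rfl
    refine ⟨fderiv ℝ c.map y (WithLp.toLp 2 fun i => (a i).re),
      fderiv ℝ c.map y (WithLp.toLp 2 fun i => (a i).im), ⟨c, y, _, hreg, rfl⟩,
      ⟨c, y, _, hreg, rfl⟩, fun k => ?_⟩
    rw [hk, GraphChart.fderiv_map_apply, GraphChart.fderiv_map_apply]
    simp only [Matrix.mulVec, dotProduct, Complex.ofReal_sum, Complex.ofReal_mul, Finset.sum_mul,
      ← Finset.sum_add_distrib]
    refine Finset.sum_congr rfl fun i _ => ?_
    conv_lhs => rw [← Complex.re_add_im (a i)]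
    ring
  · exact Or.inl (by rw [surfaceGrad, dif_neg H])

end SurfaceGrad

end

end DynBC

namespace DynBC

noncomputable section

/-! ### Compact extensions -/

/-- The unit ball is sorted into finitely many classes by the values of the functionals up to a
small error. Two vectors of one class have J-images within ε, so the image of the ball is totally
bounded. -/
theorem isCompactOperator_of_forall_functionals {V H : Type*} [NormedAddCommGroup V]
    [NormedSpace ℂ V] [NormedAddCommGroup H] [NormedSpace ℂ H] [CompleteSpace H]
    (J : V →L[ℂ] H)
    (h : ∀ τ : ℝ, 0 < τ → ∃ (ι : Type) (_ : Fintype ι) (Λ : ι → V →L[ℂ] ℂ) (C : ℝ), 0 ≤ C ∧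
      ∀ v, ‖J v‖ ^ 2 ≤ C * ∑ i, ‖Λ i v‖ ^ 2 + τ * ‖v‖ ^ 2) : IsCompactOperator J := by
  refine (isCompactOperator_iff_isCompact_closure_image_closedBall J.toLinearMap one_pos).2 ?_
  refine TotallyBounded.isCompact_of_isClosed (TotallyBounded.closure ?_) isClosed_closure
  refine Metric.totallyBounded_of_finite_discretization fun ε hε => ?_
  -- As ‖v - w‖ ≤ 2, this τ contributes at most ε²/4; η is chosen so that the functionals contribute
  -- at most ε²/4 as well.
  obtain ⟨ι, _, Λ, C, hC, hJ⟩ := h (ε ^ 2 / 16) (by positivity)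
  set B := C * Fintype.card ι with hB
  have hB0 : 0 ≤ B := by positivity
  set η := ε / (4 * (B + 1)) with hη
  have hη0 : 0 < η := by positivity
  have hηB : B * (2 * η) ^ 2 ≤ ε ^ 2 / 4 := by
    have h1 : η * (4 * (B + 1)) = ε := by rw [hη]; field_simp
    have h2 : B ≤ (B + 1) ^ 2 := by nlinarith
    rw [← h1]
    nlinarith [sq_nonneg η]
  set Φ : V →L[ℂ] (ι → ℂ) := ContinuousLinearMap.pi Λ with hΦ
  have htb : TotallyBounded (Φ '' Metric.closedBall 0 1) := by
    refine (isCompact_closedBall (0 : ι → ℂ) ‖Φ‖).totallyBounded.subset ?_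
    rintro _ ⟨v, hv, rfl⟩
    rw [mem_closedBall_zero_iff] at hv ⊢
    exact (Φ.le_opNorm v).trans (mul_le_of_le_one_right (norm_nonneg _) hv)
  obtain ⟨t, ht, hcov⟩ := Metric.totallyBounded_iff.1 htb η hη0
  have hsel : ∀ v ∈ Metric.closedBall (0 : V) 1, ∃ a ∈ t, dist (Φ v) a < η := fun v hv => by
    obtain ⟨a, ha, h⟩ := mem_iUnion₂.1 (hcov ⟨v, hv, rfl⟩)
    exact ⟨a, ha, h⟩
  have : ∀ x : J.toLinearMap '' Metric.closedBall 0 1, ∃ v ∈ Metric.closedBall (0 : V) 1,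
      J v = x.1 := fun x => x.2
  choose v hv hvx using this
  choose a ha hav using fun x => hsel (v x) (hv x)
  have := ht.fintype
  refine ⟨ULift t, inferInstance, fun x => ⟨⟨a x, ha x⟩⟩, fun x y hxy => ?_⟩
  have hxy' : a x = a y := congrArg (fun z : ULift t => z.down.1) hxy
  have hd : ∀ i, ‖Λ i (v x - v y)‖ ≤ 2 * η := fun i => by
    have h1 : dist (Φ (v x)) (Φ (v y)) ≤ 2 * η := by
      refine (dist_triangle_right _ _ (a x)).trans ?_
      have h2 := hav x
      have h3 := hav y
      rw [← hxy'] at h3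
      linarith
    rw [map_sub, ← dist_eq_norm]
    exact (dist_le_pi_dist (Φ (v x)) (Φ (v y)) i).trans h1
  have hs : ∑ i, ‖Λ i (v x - v y)‖ ^ 2 ≤ Fintype.card ι * (2 * η) ^ 2 := by
    refine (Finset.sum_le_card_nsmul _ _ ((2 * η) ^ 2) fun i _ => ?_).trans (le_of_eq ?_)
    · exact pow_le_pow_left₀ (norm_nonneg _) (hd i) 2
    · rw [nsmul_eq_mul, Finset.card_univ]
  have hn : ‖v x - v y‖ ≤ 2 := by
    have h1 := hv x
    have h2 := hv y
    rw [mem_closedBall_zero_iff] at h1 h2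
    linarith [norm_sub_le (v x) (v y)]
  have hfin : ‖J (v x - v y)‖ ^ 2 ≤ ε ^ 2 / 2 := by
    have h1 := hJ (v x - v y)
    have h2 := mul_le_mul_of_nonneg_left hs hC
    have h3 : ‖v x - v y‖ ^ 2 ≤ 2 ^ 2 := pow_le_pow_left₀ (norm_nonneg _) hn 2
    nlinarith [sq_nonneg ε]
  rw [dist_eq_norm, ← hvx x, ← hvx y, ← map_sub]
  refine lt_of_pow_lt_pow_left₀ 2 hε.le (hfin.trans_lt ?_)
  have : 0 < ε ^ 2 := by positivity
  linarith

/-- The case τ = 1 already bounds j by the norm of e and gives the extension. The functionals extend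
too, the estimate persists by density, and compactness follows. -/
theorem exists_compact_extension {X V H : Type*} [AddCommGroup X] [Module ℂ X]
    [NormedAddCommGroup V] [NormedSpace ℂ V] [NormedAddCommGroup H] [NormedSpace ℂ H]
    [CompleteSpace H] {e : X →ₗ[ℂ] V} (he : DenseRange e) (j : X →ₗ[ℂ] H)
    (h : ∀ τ : ℝ, 0 < τ → ∃ (ι : Type) (_ : Fintype ι) (Λ : ι → X →ₗ[ℂ] ℂ) (C : ℝ), 0 ≤ C ∧
      (∀ i u, ‖Λ i u‖ ≤ C * ‖e u‖) ∧
      ∀ u, ‖j u‖ ^ 2 ≤ C * ∑ i, ‖Λ i u‖ ^ 2 + τ * ‖e u‖ ^ 2) :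
    ∃ J : V →L[ℂ] H, (∀ u, J (e u) = j u) ∧ IsCompactOperator J := by
  have hb : ∃ M, ∀ u, ‖j u‖ ≤ M * ‖e u‖ := by
    obtain ⟨ι, _, Λ, C, hC, hΛ, hj⟩ := h 1 one_pos
    set B := C * (Fintype.card ι * C ^ 2) + 1
    have hB : 0 ≤ B := by positivity
    refine ⟨√B, fun u => ?_⟩
    have hs : ∑ i, ‖Λ i u‖ ^ 2 ≤ Fintype.card ι * (C * ‖e u‖) ^ 2 := by
      refine (Finset.sum_le_card_nsmul _ _ ((C * ‖e u‖) ^ 2) fun i _ => ?_).trans (le_of_eq ?_)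
      · exact pow_le_pow_left₀ (norm_nonneg _) (hΛ i u) 2
      · rw [nsmul_eq_mul, Finset.card_univ]
    refine le_of_sq_le_sq ?_ (by positivity)
    rw [mul_pow, Real.sq_sqrt hB]
    refine (hj u).trans ((add_le_add_left (mul_le_mul_of_nonneg_left hs hC) _).trans (le_of_eq ?_))
    ring
  have hJ := LinearMap.extendOfNorm_eq he hb
  refine ⟨j.extendOfNorm e, hJ, isCompactOperator_of_forall_functionals _ fun τ hτ => ?_⟩
  obtain ⟨ι, hι, Λ, C, hC, hΛ, hj⟩ := h τ hτ
  refine ⟨ι, hι, fun i => (Λ i).extendOfNorm e, C, hC, fun v => ?_⟩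
  refine he.induction_on v (isClosed_le (by fun_prop) (by fun_prop)) fun u => ?_
  simp only [hJ, LinearMap.extendOfNorm_eq he ⟨C, hΛ _⟩]
  exact hj u

/-! ### Linear maps into `L²` -/

/-- A linear family of square integrable functions as a linear map to `L²`. -/
def toL2 {α X F : Type*} [MeasurableSpace α] {μ : Measure α} [AddCommGroup X] [Module ℂ X]
    [NormedAddCommGroup F] [NormedSpace ℂ F] (A : X →ₗ[ℂ] (α → F)) (h : ∀ u, MemLp (A u) 2 μ) :
    X →ₗ[ℂ] Lp F 2 μ where
  toFun u := (h u).toLp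
  map_add' u v := by
    rw [← MemLp.toLp_add]
    exact MemLp.toLp_congr _ _ (by rw [map_add])
  map_smul' a u := by
    rw [RingHom.id_apply, ← MemLp.toLp_const_smul]
    exact MemLp.toLp_congr _ _ (by rw [map_smul])

theorem coeFn_toL2 {α X F : Type*} [MeasurableSpace α] {μ : Measure α} [AddCommGroup X]
    [Module ℂ X] [NormedAddCommGroup F] [NormedSpace ℂ F] (A : X →ₗ[ℂ] (α → F))
    (h : ∀ u, MemLp (A u) 2 μ) (u : X) : toL2 A h u =ᵐ[μ] A u := (h u).coeFn_toLp

theorem lintegral_enorm_sq_eq {α X F : Type*} [MeasurableSpace α] {μ : Measure α} [AddCommGroup X]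
    [Module ℂ X] [NormedAddCommGroup F] [NormedSpace ℂ F] (A : X →ₗ[ℂ] (α → F))
    (h : ∀ u, MemLp (A u) 2 μ) (u : X) :
    ∫⁻ x, ‖A u x‖ₑ ^ 2 ∂μ = ENNReal.ofReal (‖toL2 A h u‖ ^ 2) := by
  rw [ENNReal.ofReal_pow (norm_nonneg _), ofReal_norm]
  change _ = ‖(h u).toLp‖ₑ ^ 2
  rw [Lp.enorm_toLp, eLpNorm_eq_lintegral_rpow_enorm_toReal two_ne_zero ENNReal.ofNat_ne_top,
    ← ENNReal.rpow_natCast, ← ENNReal.rpow_mul]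
  simp

/-- The gradient as a linear map. -/
def gradLin {n : ℕ} (ΓD : Set (Rd n)) : testSpace ΓD →ₗ[ℂ] (Rd n → Cd n) where
  toFun u := grad u.1
  map_add' u v := grad_add u.2.differentiable v.2.differentiable
  map_smul' a u := grad_smul a u.2.differentiable

/-- The surface gradient as a linear map. -/
def surfaceGradLin {n : ℕ} (ΓD S : Set (Rd n)) : testSpace ΓD →ₗ[ℂ] (Rd n → Cd n) where
  toFun u := surfaceGrad S u.1
  map_add' u v := surfaceGrad_add S u.2.differentiable v.2.differentiable
  map_smul' a u := surfaceGrad_smul S a u.2.differentiable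

theorem IsTest.exists_bound_grad {n : ℕ} {ΓD : Set (Rd n)} {u : Rd n → ℂ} (hu : IsTest ΓD u) :
    ∃ M, ∀ p, ‖grad u p‖ ≤ M := by
  have hcont : Continuous (grad u) := by
    unfold grad
    refine (PiLp.continuous_toLp 2 _).comp (continuous_pi fun i => ?_)
    exact (hu.smooth.continuous_fderiv (by simp)).clm_apply continuous_const
  refine HasCompactSupport.exists_bound_of_continuous ?_ hcont
  refine (hu.compact.fderiv (𝕜 := ℝ)).mono' ?_
  refine subset_trans (fun p hp => ?_) subset_closure
  intro h
  refine hp ?_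
  ext i
  simp [grad, h]

/-! ### Square integrability of test functions and their gradients -/

namespace Data.Geometric

variable {n : ℕ} {D : Data n} (hgeo : D.Geometric)

include hgeo

theorem isFiniteMeasure_bulk : IsFiniteMeasure (volume.restrict D.Ω) :=
  ⟨by rw [Measure.restrict_apply_univ]; exact hgeo.isBounded.measure_lt_top⟩

theorem memLp_bulk (u : testSpace D.ΓD) : MemLp u.1 2 (volume.restrict D.Ω) := by
  have := hgeo.isFiniteMeasure_bulk
  obtain ⟨M, hM⟩ := u.2.exists_bound
  exact MemLp.of_bound u.2.smooth.continuous.aestronglyMeasurable M (Eventually.of_forall hM)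

theorem memLp_grad (u : testSpace D.ΓD) : MemLp (grad u.1) 2 (volume.restrict D.Ω) := by
  have := hgeo.isFiniteMeasure_bulk
  obtain ⟨M, hM⟩ := u.2.exists_bound_grad
  exact MemLp.of_bound (measurable_grad u.1).aestronglyMeasurable M (Eventually.of_forall hM)

end Data.Geometric

namespace IsTraceSet

variable {n : ℕ} {D : Data n} {S : Set (Rd n)} (hS : IsTraceSet D S) (hgeo : D.Geometric)

include hS hgeo

theorem isFiniteMeasure : IsFiniteMeasure ((surfaceMeasure n).restrict S) :=
  ⟨by rw [Measure.restrict_apply_univ]; exact hS.surfaceMeasure_lt_top hgeo⟩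

theorem memLp (u : testSpace D.ΓD) : MemLp u.1 2 ((surfaceMeasure n).restrict S) := by
  have := hS.isFiniteMeasure hgeo
  obtain ⟨M, hM⟩ := u.2.exists_bound
  exact MemLp.of_bound u.2.smooth.continuous.aestronglyMeasurable M (Eventually.of_forall hM)

theorem memLp_surfaceGrad {μ : Rd n → Matrix (Fin (n + 1)) (Fin (n + 1)) ℝ} {w : Rd n → ℝ}
    (hμ : SurfaceCoefficient S μ w) (u : testSpace D.ΓD) :
    MemLp (surfaceGrad S u.1) 2 (weighted S w) := by
  have := hS.isFiniteMeasure hgeo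
  obtain ⟨-, -, ⟨C, hC⟩, -⟩ := hμ
  have : IsFiniteMeasure (weighted S w) := by
    refine ⟨?_⟩
    rw [withDensity_apply _ MeasurableSet.univ, Measure.restrict_univ]
    have h1 : ∫⁻ x in S, ENNReal.ofReal (w x) ∂(surfaceMeasure n) ≤
        ∫⁻ _ in S, ENNReal.ofReal C ∂(surfaceMeasure n) :=
      setLIntegral_mono' hS.measurableSet fun x hx => ENNReal.ofReal_le_ofReal (hC x hx)
    refine h1.trans_lt ?_
    rw [setLIntegral_const]
    exact ENNReal.mul_lt_top ENNReal.ofReal_lt_top (hS.surfaceMeasure_lt_top hgeo)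
  obtain ⟨M, hM⟩ := u.2.exists_bound_grad
  refine MemLp.of_bound ((aestronglyMeasurable_surfaceGrad hS.hypersurface
    u.2.differentiable).mono_ac (withDensity_absolutelyContinuous _ _)) M
    (Eventually.of_forall fun x => ?_)
  exact (norm_surfaceGrad_le S (u.2.differentiable x)).trans (hM x)

end IsTraceSet

end

end DynBC

namespace DynBC

noncomputable section

namespace Data

variable {n : ℕ} {D : Data n}

/-! ### The embeddings of `C_D^∞(Ω)` -/

/-- The class of `u` in `L²(Ω)`. -/
def Geometric.bulk (hgeo : D.Geometric) :
    testSpace D.ΓD →ₗ[ℂ] Lp ℂ 2 (volume.restrict D.Ω) :=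
  toL2 (testSpace D.ΓD).subtype hgeo.memLp_bulk

/-- The class of `∇u` in `L²(Ω)`. -/
def Geometric.bulkGrad (hgeo : D.Geometric) :
    testSpace D.ΓD →ₗ[ℂ] Lp (Cd n) 2 (volume.restrict D.Ω) :=
  toL2 (gradLin D.ΓD) hgeo.memLp_grad

/-- The class of `u` in `L²(S)`. -/
def _root_.DynBC.IsTraceSet.trace {S : Set (Rd n)} (hS : IsTraceSet D S) (hgeo : D.Geometric) :
    testSpace D.ΓD →ₗ[ℂ] Lp ℂ 2 ((surfaceMeasure n).restrict S) :=
  toL2 (testSpace D.ΓD).subtype (hS.memLp hgeo)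

/-- The class of `∇_S u` in the weighted space `L²(S)`. -/
def _root_.DynBC.IsTraceSet.traceGrad {S : Set (Rd n)} (hS : IsTraceSet D S) (hgeo : D.Geometric)
    {μ : Rd n → Matrix (Fin (n + 1)) (Fin (n + 1)) ℝ} {w : Rd n → ℝ}
    (hμ : SurfaceCoefficient S μ w) : testSpace D.ΓD →ₗ[ℂ] Lp (Cd n) 2 (weighted S w) :=
  toL2 (surfaceGradLin D.ΓD S) (hS.memLp_surfaceGrad hgeo hμ)

theorem Geometric.isFiniteMeasure (hgeo : D.Geometric) : IsFiniteMeasure D.measure := by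
  have h1 : IsFiniteMeasure (volume.restrict (D.Ω \ D.Sg)) :=
    ⟨by
      rw [Measure.restrict_apply_univ]
      exact (hgeo.isBounded.subset sdiff_subset).measure_lt_top⟩
  have h2 : IsFiniteMeasure ((surfaceMeasure n).restrict (D.Γd ∪ D.Sg)) :=
    ⟨by
      rw [Measure.restrict_apply_univ]
      exact (measure_union_le _ _).trans_lt (ENNReal.add_lt_top.2
        ⟨hgeo.isTraceSet_Γd.surfaceMeasure_lt_top hgeo,
          hgeo.isTraceSet_Sg.surfaceMeasure_lt_top hgeo⟩)⟩
  infer_instance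

theorem Geometric.memLp (hgeo : D.Geometric) (u : testSpace D.ΓD) : MemLp u.1 2 D.measure := by
  have := hgeo.isFiniteMeasure
  obtain ⟨M, hM⟩ := u.2.exists_bound
  exact MemLp.of_bound u.2.smooth.continuous.aestronglyMeasurable M (Eventually.of_forall hM)

theorem Geometric.lintegral_bulk (hgeo : D.Geometric) (u : testSpace D.ΓD) :
    ∫⁻ x in D.Ω, ‖u.1 x‖ₑ ^ 2 = ENNReal.ofReal (‖hgeo.bulk u‖ ^ 2) :=
  lintegral_enorm_sq_eq (testSpace D.ΓD).subtype hgeo.memLp_bulk u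

theorem Geometric.lintegral_bulkGrad (hgeo : D.Geometric) (u : testSpace D.ΓD) :
    ∫⁻ x in D.Ω, ‖grad u.1 x‖ₑ ^ 2 = ENNReal.ofReal (‖hgeo.bulkGrad u‖ ^ 2) :=
  lintegral_enorm_sq_eq (gradLin D.ΓD) hgeo.memLp_grad u

theorem _root_.DynBC.IsTraceSet.lintegral_trace {S : Set (Rd n)} (hS : IsTraceSet D S)
    (hgeo : D.Geometric) (u : testSpace D.ΓD) :
    ∫⁻ x in S, ‖u.1 x‖ₑ ^ 2 ∂(surfaceMeasure n) = ENNReal.ofReal (‖hS.trace hgeo u‖ ^ 2) :=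
  lintegral_enorm_sq_eq (testSpace D.ΓD).subtype (hS.memLp hgeo) u

/-- The class of `u` in `𝕃²`. -/
def Geometric.toLpMeasure (hgeo : D.Geometric) : testSpace D.ΓD →ₗ[ℂ] D.L2 :=
  toL2 (testSpace D.ΓD).subtype hgeo.memLp

theorem Geometric.coeFn_toLpMeasure (hgeo : D.Geometric) (u : testSpace D.ΓD) :
    hgeo.toLpMeasure u =ᵐ[D.measure] u.1 :=
  coeFn_toL2 (testSpace D.ΓD).subtype hgeo.memLp u

theorem Geometric.lintegral_measure (hgeo : D.Geometric) (u : testSpace D.ΓD) :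
    ∫⁻ x, ‖u.1 x‖ₑ ^ 2 ∂D.measure = ENNReal.ofReal (‖hgeo.toLpMeasure u‖ ^ 2) :=
  lintegral_enorm_sq_eq (testSpace D.ΓD).subtype hgeo.memLp u

theorem Geometric.norm_toLpMeasure_sq_le (hgeo : D.Geometric) (u : testSpace D.ΓD) :
    ‖hgeo.toLpMeasure u‖ ^ 2 ≤ ‖hgeo.bulk u‖ ^ 2 +
      (‖hgeo.isTraceSet_Γd.trace hgeo u‖ ^ 2 + ‖hgeo.isTraceSet_Sg.trace hgeo u‖ ^ 2) := by
  rw [← ENNReal.ofReal_le_ofReal_iff (by positivity), ENNReal.ofReal_add (by positivity)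
    (by positivity), ENNReal.ofReal_add (by positivity) (by positivity),
    ← lintegral_measure, ← lintegral_bulk, ← IsTraceSet.lintegral_trace,
    ← IsTraceSet.lintegral_trace, lintegral_add_measure]
  exact add_le_add (lintegral_mono_set sdiff_subset) (lintegral_union_le _ _ _)

/-- Removing Σ from Ω loses only a Lebesgue null set. Hence the 𝕃² norm controls the L²(Ω) norm, the
term that t lacks for ellipticity. -/
theorem Geometric.restrict_le_measure (hgeo : D.Geometric) :
    volume.restrict D.Ω ≤ D.measure := by
  have : (D.Ω \ D.Sg : Set (Rd n)) =ᵐ[volume] D.Ω :=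
    sdiff_null_ae_eq_self (hgeo.isTraceSet_Sg.volume_eq_zero hgeo)
  rw [Data.measure, Measure.restrict_congr_set this]
  exact Measure.le_add_right le_rfl

theorem Geometric.norm_bulk_le (hgeo : D.Geometric) (u : testSpace D.ΓD) :
    ‖hgeo.bulk u‖ ≤ ‖hgeo.toLpMeasure u‖ := by
  refine le_of_sq_le_sq ?_ (norm_nonneg _)
  rw [← ENNReal.ofReal_le_ofReal_iff (by positivity), ← lintegral_measure,
    ← lintegral_bulk]
  exact lintegral_mono' hgeo.restrict_le_measure le_rfl

theorem _root_.DynBC.IsTraceSet.exists_norm_trace_le {S : Set (Rd n)} (hS : IsTraceSet D S)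
    (hgeo : D.Geometric) : ∃ ρ : ℝ, 0 < ρ ∧ ∃ C : ℝ, 0 ≤ C ∧ ∀ (u : testSpace D.ΓD) (δ : ℝ),
      0 < δ → δ < ρ →
      δ * ‖hS.trace hgeo u‖ ^ 2 ≤ C * (‖hgeo.bulk u‖ ^ 2 + δ ^ 2 * ‖hgeo.bulkGrad u‖ ^ 2) := by
  obtain ⟨ρ, hρ, C, h⟩ := hS.exists_trace_le hgeo
  refine ⟨ρ, hρ, C, C.2, fun u δ hδ hδρ => ?_⟩
  have h1 := h u.1 u.2 δ hδ hδρ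
  rw [hS.lintegral_trace hgeo, hgeo.lintegral_bulk, hgeo.lintegral_bulkGrad,
    ← ENNReal.ofReal_pow hδ.le, ← ENNReal.ofReal_mul hδ.le,
    ← ENNReal.ofReal_mul (by positivity), ← ENNReal.ofReal_add (by positivity) (by positivity),
    ← ENNReal.ofReal_coe_nnreal, ← ENNReal.ofReal_mul (NNReal.coe_nonneg C)] at h1
  exact (ENNReal.ofReal_le_ofReal_iff (by positivity)).1 h1

theorem _root_.DynBC.IsTraceSet.exists_norm_trace_sq_le {S : Set (Rd n)} (hS : IsTraceSet D S)
    (hgeo : D.Geometric) {τ : ℝ} (hτ : 0 < τ) : ∃ K : ℝ, 0 ≤ K ∧ ∀ u : testSpace D.ΓD,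
      ‖hS.trace hgeo u‖ ^ 2 ≤ K * ‖hgeo.bulk u‖ ^ 2 + τ * ‖hgeo.bulkGrad u‖ ^ 2 := by
  obtain ⟨ρ, hρ, C, hC, h⟩ := hS.exists_norm_trace_le hgeo
  -- After division by δ the gradient term has coefficient Cδ ≤ τ.
  obtain ⟨δ, hδ⟩ : ∃ δ, δ = min (ρ / 2) (τ / (C + 1)) := ⟨_, rfl⟩
  have hδ0 : 0 < δ := hδ ▸ lt_min (half_pos hρ) (by positivity)
  have hδρ : δ < ρ := hδ ▸ (min_le_left _ _).trans_lt (half_lt_self hρ)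
  have hCδ : C * δ ≤ τ := by
    have h3 : δ * (C + 1) ≤ τ := by
      rw [← le_div_iff₀ (by positivity), hδ]; exact min_le_right _ _
    linarith
  refine ⟨C / δ, by positivity, fun u => ?_⟩
  have h1 := h u δ hδ0 hδρ
  generalize ‖hS.trace hgeo u‖ ^ 2 = T at h1 ⊢
  have hB : 0 ≤ ‖hgeo.bulkGrad u‖ ^ 2 := sq_nonneg _
  generalize ‖hgeo.bulk u‖ ^ 2 = A at h1 ⊢
  generalize ‖hgeo.bulkGrad u‖ ^ 2 = B at h1 hB ⊢
  have e : C * (A + δ ^ 2 * B) = δ * (C / δ * A + C * δ * B) := by field_simp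
  rw [e] at h1
  exact (le_of_mul_le_mul_left h1 hδ0).trans
    (add_le_add_right (mul_le_mul_of_nonneg_right hCδ hB) _)

theorem Geometric.exists_norm_bulk_le (hgeo : D.Geometric) {τ : ℝ} (hτ : 0 < τ) :
    ∃ (ι : Type) (_ : Fintype ι) (Λ : ι → testSpace D.ΓD →ₗ[ℂ] ℂ) (C : ℝ), 0 ≤ C ∧
      (∀ i u, ‖Λ i u‖ ^ 2 ≤ C * ‖hgeo.bulk u‖ ^ 2) ∧
      ∀ u, ‖hgeo.bulk u‖ ^ 2 ≤ C * ∑ i, ‖Λ i u‖ ^ 2 + τ * ‖hgeo.bulkGrad u‖ ^ 2 := by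
  lift τ to ℝ≥0 using hτ.le
  obtain ⟨ι, hι, Λ, C, h1, h2⟩ := hgeo.exists_functionals (τ := τ) (by exact_mod_cast hτ)
  have e4 : ∀ z : ℂ, ‖z‖ₑ ^ 2 = ENNReal.ofReal (‖z‖ ^ 2) := fun z => by
    rw [ENNReal.ofReal_pow (norm_nonneg _), ofReal_norm]
  refine ⟨ι, hι, Λ, C, C.2, fun i u => ?_, fun u => ?_⟩
  · have := h1 i u
    rw [hgeo.lintegral_bulk, e4, ← ENNReal.ofReal_coe_nnreal,
      ← ENNReal.ofReal_mul (NNReal.coe_nonneg C)] at this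
    exact (ENNReal.ofReal_le_ofReal_iff (mul_nonneg C.2 (by positivity))).1 this
  · have := h2 u
    rw [hgeo.lintegral_bulk, hgeo.lintegral_bulkGrad] at this
    simp only [e4] at this
    rw [← ENNReal.ofReal_sum_of_nonneg fun i _ => by positivity,
      ← ENNReal.ofReal_coe_nnreal, ← ENNReal.ofReal_coe_nnreal, ← ENNReal.ofReal_mul (NNReal.coe_nonneg C),
      ← ENNReal.ofReal_mul (NNReal.coe_nonneg τ), ← ENNReal.ofReal_add (by positivity) (by positivity)] at this
    exact (ENNReal.ofReal_le_ofReal_iff (by positivity)).1 this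

theorem Geometric.exists_norm_toLpMeasure_le (hgeo : D.Geometric) {τ : ℝ} (hτ : 0 < τ) :
    ∃ (ι : Type) (_ : Fintype ι) (Λ : ι → testSpace D.ΓD →ₗ[ℂ] ℂ) (C : ℝ), 0 ≤ C ∧
      (∀ i u, ‖Λ i u‖ ≤ C * ‖hgeo.bulk u‖) ∧
      ∀ u, ‖hgeo.toLpMeasure u‖ ^ 2 ≤ C * ∑ i, ‖Λ i u‖ ^ 2 + τ * ‖hgeo.bulkGrad u‖ ^ 2 := by
  have hτ3 : 0 < τ / 3 := by positivity
  obtain ⟨K₁, hK₁, h₁⟩ := hgeo.isTraceSet_Γd.exists_norm_trace_sq_le hgeo hτ3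
  obtain ⟨K₂, hK₂, h₂⟩ := hgeo.isTraceSet_Sg.exists_norm_trace_sq_le hgeo hτ3
  -- m is the total weight of the L²(Ω) norm: 1 from the bulk and K₁, K₂ from the two traces. The
  -- bulk estimate and the two trace estimates each use τ/3.
  obtain ⟨m, hm⟩ : ∃ m, m = 1 + K₁ + K₂ := ⟨_, rfl⟩
  have hm1 : 1 ≤ m := by linarith
  have hm0 : 0 < m := one_pos.trans_le hm1
  obtain ⟨ι, hι, Λ, C, hC, h3, h4⟩ := hgeo.exists_norm_bulk_le (τ := τ / 3 / m) (by positivity)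
  refine ⟨ι, hι, Λ, m * (C + 1), by positivity, fun i u => ?_, fun u => ?_⟩
  · refine le_of_sq_le_sq ((h3 i u).trans ?_) (by positivity)
    rw [mul_pow]
    refine mul_le_mul_of_nonneg_right ?_ (sq_nonneg _)
    have h5 : C + 1 ≤ m * (C + 1) := le_mul_of_one_le_left (by positivity) hm1
    exact (le_self_pow₀ (by linarith) two_ne_zero).trans'
      (by linarith)
  · have h6 := hgeo.norm_toLpMeasure_sq_le u
    have h7 := h₁ u
    have h8 := h₂ u
    have h9 := mul_le_mul_of_nonneg_left (h4 u) hm0.le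
    have hs : 0 ≤ ∑ i, ‖Λ i u‖ ^ 2 := Finset.sum_nonneg fun i _ => sq_nonneg _
    generalize ‖hgeo.isTraceSet_Γd.trace hgeo u‖ ^ 2 = T₁ at h6 h7
    generalize ‖hgeo.isTraceSet_Sg.trace hgeo u‖ ^ 2 = T₂ at h6 h8
    generalize ‖hgeo.bulk u‖ ^ 2 = A at h6 h7 h8 h9
    generalize ‖hgeo.bulkGrad u‖ ^ 2 = B at h7 h8 h9 ⊢
    generalize ‖hgeo.toLpMeasure u‖ ^ 2 = E at h6 ⊢
    generalize ∑ i, ‖Λ i u‖ ^ 2 = s at h9 hs ⊢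
    have e : m * (C * s + τ / 3 / m * B) = m * C * s + τ / 3 * B := by field_simp
    rw [e] at h9
    have h13 : m * A = A + K₁ * A + K₂ * A := by rw [hm]; ring
    have h14 : 0 ≤ m * s := mul_nonneg hm0.le hs
    linarith

section Embedding

/-- The quadruple `(u, ∇u, ∇_{Γd} u, ∇_Σ u)`. -/
def Geometric.quadruple (hgeo : D.Geometric) (hcoeff : D.Coefficients) :
    testSpace D.ΓD →ₗ[ℂ] D.Ambient :=
  (WithLp.linearEquiv 2 ℂ _).symm.toLinearMap ∘ₗ LinearMap.prod
    ((WithLp.linearEquiv 2 ℂ _).symm.toLinearMap ∘ₗ LinearMap.prod hgeo.bulk hgeo.bulkGrad)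
    ((WithLp.linearEquiv 2 ℂ _).symm.toLinearMap ∘ₗ LinearMap.prod
      (hgeo.isTraceSet_Γd.traceGrad hgeo hcoeff.boundary)
      (hgeo.isTraceSet_Sg.traceGrad hgeo hcoeff.interface))

theorem Geometric.represents_quadruple (hgeo : D.Geometric) (hcoeff : D.Coefficients)
    (u : testSpace D.ΓD) :
    D.Represents (hgeo.quadruple hcoeff u) u.1 :=
  ⟨coeFn_toL2 _ hgeo.memLp_bulk u, coeFn_toL2 _ hgeo.memLp_grad u,
    coeFn_toL2 _ (hgeo.isTraceSet_Γd.memLp_surfaceGrad hgeo hcoeff.boundary) u,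
    coeFn_toL2 _ (hgeo.isTraceSet_Sg.memLp_surfaceGrad hgeo hcoeff.interface) u⟩

theorem Represents.unique {w w' : D.Ambient} {u : Rd n → ℂ} (h : D.Represents w u)
    (h' : D.Represents w' u) : w = w' := by
  obtain ⟨h1, h2, h3, h4⟩ := h
  obtain ⟨k1, k2, k3, k4⟩ := h'
  have e1 : w.fst.fst = w'.fst.fst := Lp.ext (h1.trans k1.symm)
  have e2 : w.fst.snd = w'.fst.snd := Lp.ext (h2.trans k2.symm)
  have e3 : w.snd.fst = w'.snd.fst := Lp.ext (h3.trans k3.symm)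
  have e4 : w.snd.snd = w'.snd.snd := Lp.ext (h4.trans k4.symm)
  have f1 : w.fst = w'.fst := WithLp.ofLp_injective 2 (Prod.ext e1 e2)
  have f2 : w.snd = w'.snd := WithLp.ofLp_injective 2 (Prod.ext e3 e4)
  exact WithLp.ofLp_injective 2 (Prod.ext f1 f2)

/-- The dense embedding of `C_D^∞(Ω)` into `dom(t)`. -/
def Geometric.embed (hgeo : D.Geometric) (hcoeff : D.Coefficients) :
    testSpace D.ΓD →ₗ[ℂ] D.FormDomain :=
  (hgeo.quadruple hcoeff).codRestrict D.core.topologicalClosure fun u =>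
    D.core.le_topologicalClosure ⟨u.1, u.2, hgeo.represents_quadruple hcoeff u⟩

theorem Geometric.denseRange_embed (hgeo : D.Geometric) (hcoeff : D.Coefficients) :
    DenseRange (hgeo.embed hcoeff) := by
  refine Subtype.dense_iff.2 fun w hw => ?_
  refine closure_mono (fun w hw => ?_) hw
  obtain ⟨u, hu, hw⟩ := hw
  exact ⟨_, ⟨⟨u, hu⟩, rfl⟩, (hgeo.represents_quadruple hcoeff ⟨u, hu⟩).unique hw⟩

theorem norm_sq_eq (w : D.Ambient) : ‖w‖ ^ 2 =
    ‖w.fst.fst‖ ^ 2 + ‖w.fst.snd‖ ^ 2 + (‖w.snd.fst‖ ^ 2 + ‖w.snd.snd‖ ^ 2) := by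
  rw [WithLp.prod_norm_sq_eq_of_L2, WithLp.prod_norm_sq_eq_of_L2, WithLp.prod_norm_sq_eq_of_L2]

theorem Geometric.norm_bulk_sq_le (hgeo : D.Geometric) (hcoeff : D.Coefficients)
    (u : testSpace D.ΓD) :
    ‖hgeo.bulk u‖ ^ 2 + ‖hgeo.bulkGrad u‖ ^ 2 ≤ ‖hgeo.embed hcoeff u‖ ^ 2 := by
  have h : ‖hgeo.embed hcoeff u‖ = ‖hgeo.quadruple hcoeff u‖ := rfl
  rw [h, norm_sq_eq]
  exact le_add_of_nonneg_right (by positivity)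

theorem Geometric.exists_traceMap (hgeo : D.Geometric) (hcoeff : D.Coefficients) :
    ∃ J : D.FormDomain →L[ℂ] D.L2,
      (∀ u, J (hgeo.embed hcoeff u) = hgeo.toLpMeasure u) ∧ IsCompactOperator J := by
  refine exists_compact_extension (hgeo.denseRange_embed hcoeff) _ fun τ hτ => ?_
  obtain ⟨ι, hι, Λ, C, hC, h1, h2⟩ := hgeo.exists_norm_toLpMeasure_le hτ
  refine ⟨ι, hι, Λ, C, hC, fun i u => ?_, fun u => ?_⟩
  · refine (h1 i u).trans (mul_le_mul_of_nonneg_left ?_ hC)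
    refine le_of_sq_le_sq ?_ (norm_nonneg _)
    exact (le_add_of_nonneg_right (sq_nonneg _)).trans (hgeo.norm_bulk_sq_le hcoeff u)
  · refine (h2 u).trans (add_le_add_right (mul_le_mul_of_nonneg_left ?_ hτ.le) _)
    exact (le_add_of_nonneg_left (sq_nonneg _)).trans (hgeo.norm_bulk_sq_le hcoeff u)

/-- Test functions vanish near Γ_D; this is what makes their vanishing harmless for density in 𝕃².
-/
theorem Geometric.measure_ΓD (hgeo : D.Geometric) : D.measure D.ΓD = 0 := by
  have hΩ : Disjoint D.ΓD D.Ω := by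
    have h1 : D.ΓD ⊆ frontier D.Ω := by
      rw [hgeo.frontier_eq, union_assoc]; exact subset_union_left
    exact (disjoint_frontier_iff_isOpen.2 hgeo.isOpen).mono_left h1
  rw [Data.measure, Measure.add_apply, Measure.restrict_apply hgeo.isClosed_D.measurableSet,
    Measure.restrict_apply hgeo.isClosed_D.measurableSet,
    (hΩ.mono_right sdiff_subset).inter_eq, measure_empty, zero_add, inter_union_distrib_left,
    hgeo.disjoint_Dd.inter_eq, (hΩ.mono_right hgeo.interface_subset).inter_eq, union_empty,
    measure_empty]

/-- A function orthogonal to all test functions integrates to zero against every smooth compactly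
supported function off Γ_D, so it vanishes there almost everywhere. The single measure treats bulk,
boundary and interface together. -/
theorem Geometric.denseRange_toLpMeasure (hgeo : D.Geometric) : DenseRange hgeo.toLpMeasure := by
  have := hgeo.isFiniteMeasure
  have h : (LinearMap.range hgeo.toLpMeasure).topologicalClosure = ⊤ := by
    rw [Submodule.topologicalClosure_eq_top_iff, Submodule.eq_bot_iff]
    intro f hf
    have hint : LocallyIntegrableOn f D.ΓDᶜ D.measure :=
      ((Lp.memLp f).integrable one_le_two).locallyIntegrable.locallyIntegrableOn _
    have hae := hgeo.isClosed_D.isOpen_compl.ae_eq_zero_of_integral_contDiff_smul_eq_zero hint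
      fun g hg hgc hgs => ?_
    · refine Lp.ext ?_
      have hD : ∀ᵐ x ∂D.measure, x ∉ D.ΓD := measure_eq_zero_iff_ae_notMem.1 hgeo.measure_ΓD
      filter_upwards [hae, hD, Lp.coeFn_zero ℂ 2 D.measure] with x h1 h2 h3
      rw [h3, h1 h2]; rfl
    · have hu : IsTest D.ΓD fun x => (g x : ℂ) := by
        have hts : tsupport (fun x => (g x : ℂ)) ⊆ tsupport g :=
          closure_mono fun x hx h => hx (by simp [h])
        exact ⟨Complex.ofRealCLM.contDiff.comp hg, hgc.comp_left (g := fun r : ℝ => (r : ℂ)) (by simp),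
          disjoint_left.2 fun x hx => hgs (hts hx)⟩
      have h1 := Submodule.inner_right_of_mem_orthogonal
        (LinearMap.mem_range_self hgeo.toLpMeasure ⟨_, hu⟩) hf
      rw [L2.inner_def] at h1
      rw [← h1]
      refine integral_congr_ae ?_
      filter_upwards [hgeo.coeFn_toLpMeasure ⟨_, hu⟩] with x hx
      rw [hx]
      simp [mul_comm]
  exact Submodule.dense_iff_topologicalClosure_eq_top.2 h

end Embedding

end Data

end

end DynBC

namespace DynBC

noncomputable section

/-! ### Real matrices acting on complex vectors -/

section Pairing

variable {n : ℕ}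

/-- The real part of a complex vector. -/
def rePart (a : Cd n) : Rd n := WithLp.toLp 2 fun i => (a i).re

/-- The imaginary part of a complex vector. -/
def imPart (a : Cd n) : Rd n := WithLp.toLp 2 fun i => (a i).im

theorem norm_sq_eq_rePart_add_imPart (a : Cd n) : ‖a‖ ^ 2 = ‖rePart a‖ ^ 2 + ‖imPart a‖ ^ 2 := by
  rw [EuclideanSpace.norm_sq_eq, EuclideanSpace.norm_sq_eq, EuclideanSpace.norm_sq_eq,
    ← Finset.sum_add_distrib]
  refine Finset.sum_congr rfl fun i _ => ?_
  rw [Complex.sq_norm, Complex.normSq_apply, rePart, imPart, Real.norm_eq_abs, Real.norm_eq_abs,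
    sq_abs, sq_abs]
  ring

theorem rePart_realMul (B : Matrix (Fin (n + 1)) (Fin (n + 1)) ℝ) (a : Cd n) :
    rePart (realMul B a) = Matrix.toEuclideanLin B (rePart a) := by
  ext i
  simp [rePart, realMul, Matrix.mulVec, dotProduct]

theorem imPart_realMul (B : Matrix (Fin (n + 1)) (Fin (n + 1)) ℝ) (a : Cd n) :
    imPart (realMul B a) = Matrix.toEuclideanLin B (imPart a) := by
  ext i
  simp [imPart, realMul, Matrix.mulVec, dotProduct]

theorem opNorm_nonneg (B : Matrix (Fin (n + 1)) (Fin (n + 1)) ℝ) : 0 ≤ opNorm B := norm_nonneg _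

theorem norm_toEuclideanLin_le (B : Matrix (Fin (n + 1)) (Fin (n + 1)) ℝ) (ξ : Rd n) :
    ‖Matrix.toEuclideanLin B ξ‖ ≤ opNorm B * ‖ξ‖ :=
  (Matrix.toEuclideanCLM (n := Fin (n + 1)) (𝕜 := ℝ) B).le_opNorm ξ

theorem norm_realMul_le_opNorm (B : Matrix (Fin (n + 1)) (Fin (n + 1)) ℝ) (a : Cd n) :
    ‖realMul B a‖ ≤ opNorm B * ‖a‖ := by
  refine le_of_sq_le_sq ?_ (mul_nonneg (opNorm_nonneg B) (norm_nonneg _))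
  rw [mul_pow, norm_sq_eq_rePart_add_imPart (realMul B a), norm_sq_eq_rePart_add_imPart a,
    rePart_realMul, imPart_realMul, mul_add, ← mul_pow, ← mul_pow]
  gcongr <;> exact norm_toEuclideanLin_le B _

theorem pairing_eq_inner (B : Matrix (Fin (n + 1)) (Fin (n + 1)) ℝ) (a b : Cd n) :
    pairing B a b = inner ℂ b (realMul B a) := by
  simp [pairing, realMul, PiLp.inner_apply, Finset.sum_mul]

theorem norm_pairing_le (B : Matrix (Fin (n + 1)) (Fin (n + 1)) ℝ) (a b : Cd n) :
    ‖pairing B a b‖ ≤ opNorm B * ‖a‖ * ‖b‖ := by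
  rw [pairing_eq_inner, mul_comm]
  exact (norm_inner_le_norm _ _).trans
    (mul_le_mul_of_nonneg_left (norm_realMul_le_opNorm B a) (norm_nonneg _))

/-- For real B the cross terms between real and imaginary parts are purely imaginary, whether or not
B is symmetric. -/
theorem re_pairing_self (B : Matrix (Fin (n + 1)) (Fin (n + 1)) ℝ) (a : Cd n) :
    (pairing B a a).re = quad B (rePart a) + quad B (imPart a) := by
  rw [pairing_eq_inner, quad, quad, ← rePart_realMul, ← imPart_realMul, PiLp.inner_apply,
    PiLp.inner_apply, PiLp.inner_apply, Complex.re_sum, ← Finset.sum_add_distrib]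
  refine Finset.sum_congr rfl fun i _ => ?_
  simp [rePart, imPart, Complex.mul_re]
  ring

theorem pairing_add_left (B : Matrix (Fin (n + 1)) (Fin (n + 1)) ℝ) (a a' b : Cd n) :
    pairing B (a + a') b = pairing B a b + pairing B a' b := by
  simp [pairing, mul_add, add_mul, Finset.sum_add_distrib]

theorem pairing_smul_left (B : Matrix (Fin (n + 1)) (Fin (n + 1)) ℝ) (z : ℂ) (a b : Cd n) :
    pairing B (z • a) b = z * pairing B a b := by
  simp only [pairing, PiLp.smul_apply, smul_eq_mul, Finset.mul_sum]
  refine Finset.sum_congr rfl fun i _ => Finset.sum_congr rfl fun j _ => ?_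
  ring

theorem pairing_add_right (B : Matrix (Fin (n + 1)) (Fin (n + 1)) ℝ) (a b b' : Cd n) :
    pairing B a (b + b') = pairing B a b + pairing B a b' := by
  simp [pairing, mul_add, Finset.sum_add_distrib]

theorem pairing_smul_right (B : Matrix (Fin (n + 1)) (Fin (n + 1)) ℝ) (z : ℂ) (a b : Cd n) :
    pairing B a (z • b) = star z * pairing B a b := by
  simp only [pairing, PiLp.smul_apply, smul_eq_mul, Finset.mul_sum, star_mul']
  refine Finset.sum_congr rfl fun i _ => Finset.sum_congr rfl fun j _ => ?_
  ring

theorem pairing_zero (a b : Cd n) :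
    pairing (0 : Matrix (Fin (n + 1)) (Fin (n + 1)) ℝ) a b = 0 := by
  simp [pairing]

theorem eq_zero_of_opNorm_eq_zero {B : Matrix (Fin (n + 1)) (Fin (n + 1)) ℝ} (h : opNorm B = 0) :
    B = 0 := by
  have h1 : Matrix.toEuclideanCLM (n := Fin (n + 1)) (𝕜 := ℝ) B = 0 := norm_eq_zero.1 h
  exact (map_eq_zero_iff _ (EquivLike.injective _)).1 h1

end Pairing

/-! ### The blocks of the form -/

/-- The sesquilinear form with coefficient `B` is well defined on `L²(ν)`. -/
structure IsFormCoefficient {n : ℕ} (μ ν : Measure (Rd n))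
    (B : Rd n → Matrix (Fin (n + 1)) (Fin (n + 1)) ℝ) (C : ℝ≥0) : Prop where
  measurable : ∀ i j, AEMeasurable (fun x => B x i j) μ
  ae : ∀ p : Rd n → Prop, (∀ᵐ x ∂ν, p x) → ∀ᵐ x ∂μ, B x ≠ 0 → p x
  bound : ∀ f : Rd n → ℝ≥0∞, Measurable f →
    ∫⁻ x, ENNReal.ofReal (opNorm (B x)) * f x ∂μ ≤ C * ∫⁻ x, f x ∂ν

/-- One of the three integrals in the form. -/
def block {n : ℕ} (μ : Measure (Rd n)) {ν : Measure (Rd n)}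
    (B : Rd n → Matrix (Fin (n + 1)) (Fin (n + 1)) ℝ) (a b : Lp (Cd n) 2 ν) : ℂ :=
  ∫ x, pairing (B x) (a x) (b x) ∂μ

theorem lintegral_enorm_sq_Lp {α F : Type*} [MeasurableSpace α] {ν : Measure α}
    [NormedAddCommGroup F] (a : Lp F 2 ν) :
    ∫⁻ x, ‖a x‖ₑ ^ 2 ∂ν = ‖a‖ₑ ^ 2 := by
  rw [Lp.enorm_def, eLpNorm_eq_lintegral_rpow_enorm_toReal two_ne_zero ENNReal.ofNat_ne_top,
    ← ENNReal.rpow_natCast, ← ENNReal.rpow_mul]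
  simp

theorem lintegral_enorm_mul_enorm_le {α F : Type*} [MeasurableSpace α] {ν : Measure α}
    [NormedAddCommGroup F] (a b : Lp F 2 ν) :
    ∫⁻ x, ‖a x‖ₑ * ‖b x‖ₑ ∂ν ≤ ‖a‖ₑ * ‖b‖ₑ := by
  have h := ENNReal.lintegral_mul_le_Lp_mul_Lq ν Real.HolderConjugate.two_two
    (f := fun x => ‖a x‖ₑ) (g := fun x => ‖b x‖ₑ) (Lp.aestronglyMeasurable a).enorm
    (Lp.aestronglyMeasurable b).enorm
  refine h.trans (le_of_eq ?_)
  have e : ∀ c : Lp F 2 ν, (∫⁻ x, ‖c x‖ₑ ^ (2 : ℝ) ∂ν) ^ (1 / (2 : ℝ)) = ‖c‖ₑ := fun c => by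
    rw [Lp.enorm_def, eLpNorm_eq_lintegral_rpow_enorm_toReal two_ne_zero ENNReal.ofNat_ne_top]
    simp
  rw [e, e]

namespace IsFormCoefficient

variable {n : ℕ} {μ ν : Measure (Rd n)} {B : Rd n → Matrix (Fin (n + 1)) (Fin (n + 1)) ℝ}
  {C : ℝ≥0} (h : IsFormCoefficient μ ν B C)

include h

/-- Equality almost everywhere for ν says nothing where the weight vanishes; there B vanishes as
well, and both integrands are zero. -/
theorem congr {a a' b b' : Rd n → Cd n} (ha : a =ᵐ[ν] a') (hb : b =ᵐ[ν] b') :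
    (fun x => pairing (B x) (a x) (b x)) =ᵐ[μ] fun x => pairing (B x) (a' x) (b' x) := by
  filter_upwards [h.ae _ (ha.and hb)] with x hx
  by_cases hB : B x = 0
  · rw [hB, pairing_zero, pairing_zero]
  · rw [(hx hB).1, (hx hB).2]

theorem lintegral_pairing_le (a b : Lp (Cd n) 2 ν) :
    ∫⁻ x, ‖pairing (B x) (a x) (b x)‖ₑ ∂μ ≤ C * (‖a‖ₑ * ‖b‖ₑ) := by
  have hm : Measurable fun x => ‖a x‖ₑ * ‖b x‖ₑ :=
    (Lp.stronglyMeasurable a).measurable.enorm.mul (Lp.stronglyMeasurable b).measurable.enorm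
  refine le_trans (lintegral_mono fun x => ?_) ((h.bound _ hm).trans
    (mul_le_mul_right (lintegral_enorm_mul_enorm_le a b) _))
  rw [← ofReal_norm, ← ofReal_norm, ← ofReal_norm, ← ENNReal.ofReal_mul (norm_nonneg _),
    ← ENNReal.ofReal_mul (opNorm_nonneg _), ← mul_assoc]
  exact ENNReal.ofReal_le_ofReal (norm_pairing_le _ _ _)

theorem integrable (a b : Lp (Cd n) 2 ν) :
    Integrable (fun x => pairing (B x) (a x) (b x)) μ := by
  refine ⟨?_, (h.lintegral_pairing_le a b).trans_lt ?_⟩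
  · unfold pairing
    refine Finset.aestronglyMeasurable_fun_sum _ fun i _ =>
      Finset.aestronglyMeasurable_fun_sum _ fun j _ => ?_
    have hc : ∀ k, Continuous fun z : Cd n => z k := fun k => by fun_prop
    have h1 := (hc j).measurable.comp (Lp.stronglyMeasurable a).measurable
    have h2 := (hc i).measurable.comp (Lp.stronglyMeasurable b).measurable
    exact (((Complex.measurable_ofReal.comp_aemeasurable (h.measurable i j)).mul
      h1.aemeasurable).mul (continuous_star.measurable.comp h2).aemeasurable).aestronglyMeasurable
  · exact ENNReal.mul_lt_top ENNReal.coe_lt_top (ENNReal.mul_lt_top enorm_lt_top enorm_lt_top)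

theorem norm_block_le (a b : Lp (Cd n) 2 ν) : ‖block μ B a b‖ ≤ C * ‖a‖ * ‖b‖ := by
  have h1 := (enorm_integral_le_lintegral_enorm _).trans (h.lintegral_pairing_le a b)
  change ‖block μ B a b‖ₑ ≤ _ at h1
  rw [← ofReal_norm, ← ofReal_norm, ← ofReal_norm, ← ENNReal.ofReal_mul (norm_nonneg _),
    ← ENNReal.ofReal_coe_nnreal, ← ENNReal.ofReal_mul (NNReal.coe_nonneg C), ← mul_assoc] at h1
  exact (ENNReal.ofReal_le_ofReal_iff (by positivity)).1 h1

theorem block_add_left (a a' b : Lp (Cd n) 2 ν) :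
    block μ B (a + a') b = block μ B a b + block μ B a' b := by
  rw [block, block, block, ← integral_add (h.integrable a b) (h.integrable a' b)]
  refine integral_congr_ae ((h.congr (Lp.coeFn_add a a') (EventuallyEq.refl _ _)).trans ?_)
  exact Eventually.of_forall fun x => pairing_add_left _ _ _ _

theorem block_add_right (a b b' : Lp (Cd n) 2 ν) :
    block μ B a (b + b') = block μ B a b + block μ B a b' := by
  rw [block, block, block, ← integral_add (h.integrable a b) (h.integrable a b')]
  refine integral_congr_ae ((h.congr (EventuallyEq.refl _ _) (Lp.coeFn_add b b')).trans ?_)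
  exact Eventually.of_forall fun x => pairing_add_right _ _ _ _

theorem block_smul_left (z : ℂ) (a b : Lp (Cd n) 2 ν) :
    block μ B (z • a) b = z * block μ B a b := by
  rw [block, block, ← integral_const_mul]
  refine integral_congr_ae ((h.congr (Lp.coeFn_smul z a) (EventuallyEq.refl _ _)).trans ?_)
  exact Eventually.of_forall fun x => pairing_smul_left _ _ _ _

theorem block_smul_right (z : ℂ) (a b : Lp (Cd n) 2 ν) :
    block μ B a (z • b) = star z * block μ B a b := by
  rw [block, block, ← integral_const_mul]
  refine integral_congr_ae ((h.congr (EventuallyEq.refl _ _) (Lp.coeFn_smul z b)).trans ?_)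
  exact Eventually.of_forall fun x => pairing_smul_right _ _ _ _

theorem mul_norm_sq_le_re_block {a : Lp (Cd n) 2 ν} {c : ℝ} (hc : 0 ≤ c)
    (hpos : ∀ᵐ x ∂μ, 0 ≤ (pairing (B x) (a x) (a x)).re)
    (hle : ENNReal.ofReal c * ∫⁻ x, ‖a x‖ₑ ^ 2 ∂ν ≤
      ∫⁻ x, ENNReal.ofReal (pairing (B x) (a x) (a x)).re ∂μ) :
    c * ‖a‖ ^ 2 ≤ (block μ B a a).re := by
  have hint := h.integrable a a
  have h1 : (block μ B a a).re = ∫ x, (pairing (B x) (a x) (a x)).re ∂μ := (integral_re hint).symm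
  have hre : Integrable (fun x => (pairing (B x) (a x) (a x)).re) μ := hint.re
  rw [← ofReal_integral_eq_lintegral_ofReal hre hpos, lintegral_enorm_sq_Lp, ← ofReal_norm,
    ← ENNReal.ofReal_pow (norm_nonneg _), ← ENNReal.ofReal_mul hc] at hle
  rw [h1]
  exact (ENNReal.ofReal_le_ofReal_iff (integral_nonneg_of_ae hpos)).1 hle

end IsFormCoefficient

theorem BulkCoefficient.exists_isFormCoefficient {n : ℕ} {Ω : Set (Rd n)} (hΩ : MeasurableSet Ω)
    {B : Rd n → Matrix (Fin (n + 1)) (Fin (n + 1)) ℝ} (hB : BulkCoefficient Ω B) :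
    ∃ C, IsFormCoefficient (volume.restrict Ω) (volume.restrict Ω) B C := by
  obtain ⟨hm, ⟨C, hC⟩, -⟩ := hB
  refine ⟨C.toNNReal, hm, fun p hp => hp.mono fun x hx _ => hx, fun f hf => ?_⟩
  rw [← lintegral_const_mul _ hf]
  refine setLIntegral_mono' hΩ fun x hx => ?_
  gcongr
  exact ENNReal.ofReal_le_ofReal (hC x hx)

theorem BulkCoefficient.exists_le_re_block {n : ℕ} {Ω : Set (Rd n)} (hΩ : MeasurableSet Ω)
    {B : Rd n → Matrix (Fin (n + 1)) (Fin (n + 1)) ℝ} (hB : BulkCoefficient Ω B) :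
    ∃ c : ℝ, 0 < c ∧ ∀ a : Lp (Cd n) 2 (volume.restrict Ω),
      c * ‖a‖ ^ 2 ≤ (block (volume.restrict Ω) B a a).re := by
  obtain ⟨C, h⟩ := hB.exists_isFormCoefficient hΩ
  obtain ⟨-, -, m, hm, hB⟩ := hB
  have key : ∀ x ∈ Ω, ∀ z : Cd n, m * ‖z‖ ^ 2 ≤ (pairing (B x) z z).re := fun x hx z => by
    rw [re_pairing_self, norm_sq_eq_rePart_add_imPart, mul_add]
    exact add_le_add (hB x hx _) (hB x hx _)
  refine ⟨m, hm, fun a => h.mul_norm_sq_le_re_block hm.le ?_ ?_⟩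
  · filter_upwards [ae_restrict_mem hΩ] with x hx
    exact (by positivity : 0 ≤ m * ‖a x‖ ^ 2).trans (key x hx _)
  · rw [← lintegral_const_mul' _ _ ENNReal.ofReal_ne_top]
    refine setLIntegral_mono' hΩ fun x hx => ?_
    rw [← ofReal_norm, ← ENNReal.ofReal_pow (norm_nonneg _), ← ENNReal.ofReal_mul hm.le]
    exact ENNReal.ofReal_le_ofReal (key x hx _)

/-- The bound ‖B‖ ≤ c₂w forces B = 0 wherever w = 0 and dominates the unweighted integral by the
weighted one. -/
theorem SurfaceCoefficient.exists_isFormCoefficient {n : ℕ} {S : Set (Rd n)}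
    (hS : MeasurableSet S) {B : Rd n → Matrix (Fin (n + 1)) (Fin (n + 1)) ℝ} {w : Rd n → ℝ}
    (hB : SurfaceCoefficient S B w) :
    ∃ C, IsFormCoefficient ((surfaceMeasure n).restrict S) (weighted S w) B C := by
  obtain ⟨hm, hw, -, hw0, -, c₂, -, hc₂, -, hle⟩ := hB
  refine ⟨c₂.toNNReal, hm, fun p hp => ?_, fun f hf => ?_⟩
  · rw [ae_withDensity_iff' hw.ennreal_ofReal] at hp
    filter_upwards [hp, ae_restrict_mem hS] with x hx hxS hBx
    refine hx ?_
    rw [ne_eq, ENNReal.ofReal_eq_zero, not_le]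
    refine lt_of_le_of_ne (hw0 x hxS) fun h => hBx (eq_zero_of_opNorm_eq_zero ?_)
    exact le_antisymm (by simpa [← h] using hle x hxS) (opNorm_nonneg _)
  · rw [lintegral_withDensity_eq_lintegral_mul₀ hw.ennreal_ofReal hf.aemeasurable,
      ← lintegral_const_mul' _ _ ENNReal.coe_ne_top]
    refine setLIntegral_mono' hS fun x hx => ?_
    rw [Pi.mul_apply, ← mul_assoc]
    gcongr
    change _ ≤ ENNReal.ofReal c₂ * _
    rw [← ENNReal.ofReal_mul hc₂.le]
    exact ENNReal.ofReal_le_ofReal (hle x hx)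

/-- Ellipticity holds on tangent vectors only, so the estimate is restricted to genuine surface
gradients; limits are reached afterwards by density. -/
theorem SurfaceCoefficient.exists_le_re_block {n : ℕ} {S : Set (Rd n)} (hS : MeasurableSet S)
    {B : Rd n → Matrix (Fin (n + 1)) (Fin (n + 1)) ℝ} {w : Rd n → ℝ}
    (hB : SurfaceCoefficient S B w) :
    ∃ c : ℝ, 0 < c ∧ ∀ (a : Lp (Cd n) 2 (weighted S w)) (u : Rd n → ℂ),
      a =ᵐ[weighted S w] surfaceGrad S u →
      c * ‖a‖ ^ 2 ≤ (block ((surfaceMeasure n).restrict S) B a a).re := by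
  obtain ⟨C, h⟩ := hB.exists_isFormCoefficient hS
  obtain ⟨hm, hw, -, hw0, c₁, c₂, hc₁, hc₂, hB, hle⟩ := hB
  have key : ∀ (u : Rd n → ℂ), ∀ x ∈ S, c₁ * w x * ‖surfaceGrad S u x‖ ^ 2 ≤
      (pairing (B x) (surfaceGrad S u x) (surfaceGrad S u x)).re := fun u x hx => by
    rcases exists_isTangent_surfaceGrad (S := S) (u := u) (x := x) with h0 | ⟨ξ, ζ, hξ, hζ, h1⟩
    · rw [h0]; simp [pairing]
    · have e1 : rePart (surfaceGrad S u x) = ξ := by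
        ext k; simp [rePart, h1 k]
      have e2 : imPart (surfaceGrad S u x) = ζ := by
        ext k; simp [imPart, h1 k]
      rw [re_pairing_self, norm_sq_eq_rePart_add_imPart, mul_add, e1, e2]
      exact add_le_add (hB x hx ξ hξ) (hB x hx ζ hζ)
  refine ⟨c₁, hc₁, fun a u ha => ?_⟩
  have hc := h.congr ha ha
  refine h.mul_norm_sq_le_re_block hc₁.le ?_ ?_
  · filter_upwards [hc, ae_restrict_mem hS] with x hx hxS
    rw [hx]
    exact (mul_nonneg (mul_nonneg hc₁.le (hw0 x hxS)) (sq_nonneg _)).trans (key u x hxS)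
  · have ha2 : (fun x => ‖a x‖ₑ ^ 2) =ᵐ[weighted S w] fun x => ‖surfaceGrad S u x‖ₑ ^ 2 := by
      filter_upwards [ha] with x hx
      rw [hx]
    rw [lintegral_withDensity_eq_lintegral_mul₀ hw.ennreal_ofReal
        ((Lp.stronglyMeasurable a).measurable.enorm.pow_const 2).aemeasurable,
      ← lintegral_const_mul' _ _ ENNReal.ofReal_ne_top]
    have ha3 := (ae_withDensity_iff' hw.ennreal_ofReal).1 ha
    refine lintegral_mono_ae ?_
    filter_upwards [hc, ae_restrict_mem hS, ha3] with x hx hxS hax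
    rw [hx, Pi.mul_apply]
    by_cases hwx : ENNReal.ofReal (w x) = 0
    · rw [hwx, zero_mul, mul_zero]
      exact zero_le
    · rw [hax hwx, ← ofReal_norm, ← ENNReal.ofReal_pow (norm_nonneg _),
        ← ENNReal.ofReal_mul (hw0 x hxS), ← ENNReal.ofReal_mul hc₁.le, ← mul_assoc]
      exact ENNReal.ofReal_le_ofReal (key u x hxS)

end

end DynBC

namespace DynBC

noncomputable section

/-! ### Sums of sesquilinear forms -/

/-- `b` is sesquilinear, and bounded with constant `C`. -/
structure IsBoundedSesquilinear {E : Type*} [NormedAddCommGroup E] [NormedSpace ℂ E]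
    (b : E → E → ℂ) (C : ℝ) : Prop where
  nonneg : 0 ≤ C
  add_left : ∀ u u' v, b (u + u') v = b u v + b u' v
  add_right : ∀ u v v', b u (v + v') = b u v + b u v'
  smul_left : ∀ (z : ℂ) u v, b (z • u) v = z * b u v
  smul_right : ∀ (z : ℂ) u v, b u (z • v) = star z * b u v
  bound : ∀ u v, ‖b u v‖ ≤ C * ‖u‖ * ‖v‖

namespace IsBoundedSesquilinear

variable {V E : Type*} [NormedAddCommGroup V] [NormedAddCommGroup E]

theorem comp [NormedSpace ℂ V] [NormedSpace ℂ E] {b : E → E → ℂ} {C : ℝ}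
    (h : IsBoundedSesquilinear b C) (P : V →L[ℂ] E) (hP : ∀ u, ‖P u‖ ≤ ‖u‖) :
    IsBoundedSesquilinear (fun u v => b (P u) (P v)) C where
  nonneg := h.nonneg
  add_left u u' v := by rw [map_add, h.add_left]
  add_right u v v' := by rw [map_add, h.add_right]
  smul_left z u v := by rw [map_smul, h.smul_left]
  smul_right z u v := by rw [map_smul, h.smul_right]
  bound u v := (h.bound _ _).trans (by
    have := h.nonneg
    gcongr
    exacts [hP u, hP v])

theorem add [NormedSpace ℂ E] {b b' : E → E → ℂ} {C C' : ℝ} (h : IsBoundedSesquilinear b C)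
    (h' : IsBoundedSesquilinear b' C') :
    IsBoundedSesquilinear (fun u v => b u v + b' u v) (C + C') where
  nonneg := add_nonneg h.nonneg h'.nonneg
  add_left u u' v := by rw [h.add_left, h'.add_left]; ring
  add_right u v v' := by rw [h.add_right, h'.add_right]; ring
  smul_left z u v := by rw [h.smul_left, h'.smul_left]; ring
  smul_right z u v := by rw [h.smul_right, h'.smul_right]; ring
  bound u v := (norm_add_le _ _).trans
    ((add_le_add (h.bound u v) (h'.bound u v)).trans (le_of_eq (by ring)))

/-- The Riesz representation. The conjugate of b is used because the representing operator is built
from a form antilinear in its first argument. -/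
theorem exists_inner_eq [InnerProductSpace ℂ V] [CompleteSpace V] {b : V → V → ℂ} {C : ℝ}
    (h : IsBoundedSesquilinear b C) : ∃ L : V →L[ℂ] V, ∀ u v, inner ℂ v (L u) = b u v := by
  let B : V →ₗ⋆[ℂ] V →ₗ[ℂ] ℂ :=
    LinearMap.mk₂'ₛₗ (starRingEnd ℂ) (RingHom.id ℂ) (fun u v => star (b u v))
      (fun u u' v => by rw [h.add_left, star_add])
      (fun z u v => by rw [h.smul_left, star_mul', smul_eq_mul, starRingEnd_apply])
      (fun u v v' => by rw [h.add_right, star_add])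
      (fun z u v => by
        rw [h.smul_right, star_mul', star_star, smul_eq_mul, RingHom.id_apply])
  refine ⟨InnerProductSpace.continuousLinearMapOfBilin (B.mkContinuous₂ C fun u v => ?_),
    fun u v => ?_⟩
  · exact (norm_star (b u v)).trans_le (h.bound u v)
  · rw [← inner_conj_symm, InnerProductSpace.continuousLinearMapOfBilin_apply]
    exact star_star (b u v)

end IsBoundedSesquilinear

/-- The operator associated with a form that is a sum of three coercive forms of components of `u`,
where the remaining component is controlled by `J`. -/
theorem exists_operator_of_blocks {X V H E₀ E₁ E₂ E₃ : Type*} [NormedAddCommGroup V]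
    [InnerProductSpace ℂ V] [CompleteSpace V] [NormedAddCommGroup H] [InnerProductSpace ℂ H]
    [CompleteSpace H] [NormedAddCommGroup E₀] [NormedSpace ℂ E₀] [NormedAddCommGroup E₁]
    [NormedSpace ℂ E₁] [NormedAddCommGroup E₂] [NormedSpace ℂ E₂] [NormedAddCommGroup E₃]
    [NormedSpace ℂ E₃] {P₀ : V →L[ℂ] E₀} {P₁ : V →L[ℂ] E₁} {P₂ : V →L[ℂ] E₂} {P₃ : V →L[ℂ] E₃}
    (hP : ∀ u, ‖u‖ ^ 2 = ‖P₀ u‖ ^ 2 + ‖P₁ u‖ ^ 2 + (‖P₂ u‖ ^ 2 + ‖P₃ u‖ ^ 2))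
    {b₁ : E₁ → E₁ → ℂ} {b₂ : E₂ → E₂ → ℂ} {b₃ : E₃ → E₃ → ℂ}
    (h₁ : ∃ C, IsBoundedSesquilinear b₁ C) (h₂ : ∃ C, IsBoundedSesquilinear b₂ C)
    (h₃ : ∃ C, IsBoundedSesquilinear b₃ C) {e : X → V} (he : DenseRange e)
    (k₁ : ∃ c, 0 < c ∧ ∀ x, c * ‖P₁ (e x)‖ ^ 2 ≤ (b₁ (P₁ (e x)) (P₁ (e x))).re)
    (k₂ : ∃ c, 0 < c ∧ ∀ x, c * ‖P₂ (e x)‖ ^ 2 ≤ (b₂ (P₂ (e x)) (P₂ (e x))).re)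
    (k₃ : ∃ c, 0 < c ∧ ∀ x, c * ‖P₃ (e x)‖ ^ 2 ≤ (b₃ (P₃ (e x)) (P₃ (e x))).re)
    {J : V →L[ℂ] H} (hJ : IsCompactOperator J) (hd : DenseRange J)
    (hJP : ∀ x, ‖P₀ (e x)‖ ≤ ‖J (e x)‖) {b : V → V → ℂ}
    (hb : ∀ u v, b u v = b₁ (P₁ u) (P₁ v) + b₂ (P₂ u) (P₂ v) + b₃ (P₃ u) (P₃ v)) :
    (∃ C : ℝ, ∀ u v, ‖b u v‖ ≤ C * ‖u‖ * ‖v‖) ∧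
    (∃ c : ℝ, 0 < c ∧ ∀ u, c * ‖u‖ ^ 2 ≤ (b u u).re + ‖J u‖ ^ 2) ∧
    ∃ A : H →ₗ.[ℂ] H, A.IsClosed ∧ Dense (A.domain : Set H) ∧
      (∀ φ ψ : H, (φ, ψ) ∈ A.graph ↔ ∃ u, φ = J u ∧ ∀ v, inner ℂ (J v) ψ = b u v) ∧
      (∃ T : ℝ → H →L[ℂ] H,
        IsAnalyticSemigroup T ∧ (∀ t, 0 ≤ t → ‖T t‖ ≤ 1) ∧ IsGenerator (-A) T) ∧
      HasCompactResolvent A := by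
  obtain ⟨C₁, h₁⟩ := h₁
  obtain ⟨C₂, h₂⟩ := h₂
  obtain ⟨C₃, h₃⟩ := h₃
  obtain ⟨c₁, hc₁, k₁⟩ := k₁
  obtain ⟨c₂, hc₂, k₂⟩ := k₂
  obtain ⟨c₃, hc₃, k₃⟩ := k₃
  have n₁ : ∀ u, ‖P₁ u‖ ≤ ‖u‖ := fun u => le_of_sq_le_sq
    (by rw [hP u]; linarith [sq_nonneg ‖P₀ u‖, sq_nonneg ‖P₂ u‖, sq_nonneg ‖P₃ u‖]) (norm_nonneg _)
  have n₂ : ∀ u, ‖P₂ u‖ ≤ ‖u‖ := fun u => le_of_sq_le_sq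
    (by rw [hP u]; linarith [sq_nonneg ‖P₀ u‖, sq_nonneg ‖P₁ u‖, sq_nonneg ‖P₃ u‖]) (norm_nonneg _)
  have n₃ : ∀ u, ‖P₃ u‖ ≤ ‖u‖ := fun u => le_of_sq_le_sq
    (by rw [hP u]; linarith [sq_nonneg ‖P₀ u‖, sq_nonneg ‖P₁ u‖, sq_nonneg ‖P₂ u‖]) (norm_nonneg _)
  have hsesq := ((h₁.comp P₁ n₁).add (h₂.comp P₂ n₂)).add (h₃.comp P₃ n₃)
  have hb' : b = fun u v => b₁ (P₁ u) (P₁ v) + b₂ (P₂ u) (P₂ v) + b₃ (P₃ u) (P₃ v) :=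
    funext fun u => funext fun v => hb u v
  rw [← hb'] at hsesq
  obtain ⟨L, hL⟩ := hsesq.exists_inner_eq
  -- G collects the components on which the form acts. It bounds Re b(u,u) from below and |b(u,u)|
  -- from above, so the form is sectorial without adding a multiple of ‖Ju‖².
  obtain ⟨G, hG⟩ : ∃ G : V → ℝ, ∀ u, G u = ‖P₁ u‖ ^ 2 + ‖P₂ u‖ ^ 2 + ‖P₃ u‖ ^ 2 := ⟨_, fun _ => rfl⟩
  have hG0 : ∀ u, 0 ≤ G u := fun u => by rw [hG]; positivity
  obtain ⟨c, hc, hle₁, hle₂, hle₃⟩ : ∃ c : ℝ, 0 < c ∧ c ≤ c₁ ∧ c ≤ c₂ ∧ c ≤ c₃ :=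
    ⟨min c₁ (min c₂ c₃), lt_min hc₁ (lt_min hc₂ hc₃), min_le_left _ _,
      (min_le_right _ _).trans (min_le_left _ _), (min_le_right _ _).trans (min_le_right _ _)⟩
  -- Coercivity is known on the dense range of e, and both sides are continuous.
  have hcoer : ∀ u, c * G u ≤ (b u u).re := by
    intro u
    have hcont : Continuous fun u => (b u u).re := by
      simp only [← hL]
      exact Complex.continuous_re.comp (continuous_id.inner L.continuous)
    have hGc : Continuous fun u => c * G u := by
      simp only [hG]
      fun_prop
    refine he.induction_on u (isClosed_le hGc hcont) fun x => ?_
    rw [hb, Complex.add_re, Complex.add_re, hG, mul_add, mul_add]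
    exact add_le_add (add_le_add
      ((mul_le_mul_of_nonneg_right hle₁ (sq_nonneg _)).trans (k₁ x))
      ((mul_le_mul_of_nonneg_right hle₂ (sq_nonneg _)).trans (k₂ x)))
      ((mul_le_mul_of_nonneg_right hle₃ (sq_nonneg _)).trans (k₃ x))
  have hJP' : ∀ u, ‖P₀ u‖ ≤ ‖J u‖ := fun u =>
    he.induction_on u (isClosed_le P₀.continuous.norm J.continuous.norm) hJP
  have hbG : ∀ u, ‖b u u‖ ≤ (C₁ + C₂ + C₃) * G u := fun u => by
    rw [hb, hG]
    refine (norm_add_le _ _).trans ((add_le_add_left (norm_add_le _ _) _).trans ?_)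
    have t₁ := h₁.bound (P₁ u) (P₁ u)
    have t₂ := h₂.bound (P₂ u) (P₂ u)
    have t₃ := h₃.bound (P₃ u) (P₃ u)
    have s₁ := mul_nonneg h₁.nonneg (add_nonneg (sq_nonneg ‖P₂ u‖) (sq_nonneg ‖P₃ u‖))
    have s₂ := mul_nonneg h₂.nonneg (add_nonneg (sq_nonneg ‖P₁ u‖) (sq_nonneg ‖P₃ u‖))
    have s₃ := mul_nonneg h₃.nonneg (add_nonneg (sq_nonneg ‖P₁ u‖) (sq_nonneg ‖P₂ u‖))
    rw [mul_assoc, ← pow_two] at t₁ t₂ t₃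
    linarith
  -- The only component of the norm missing from G is P₀u, and ‖Ju‖ dominates it.
  have hell : ∀ u, min c 1 * ‖u‖ ^ 2 ≤ (b u u).re + ‖J u‖ ^ 2 := fun u => by
    have hN : ‖u‖ ^ 2 = G u + ‖P₀ u‖ ^ 2 := by rw [hP, hG]; ring
    rw [hN, mul_add]
    refine add_le_add ((mul_le_mul_of_nonneg_right (min_le_left _ _) (hG0 u)).trans (hcoer u)) ?_
    refine (mul_le_of_le_one_left (sq_nonneg _) (min_le_right _ _)).trans ?_
    exact pow_le_pow_left₀ (norm_nonneg _) (hJP' u) 2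
  have hre : ∀ u, 0 ≤ (b u u).re := fun u => (mul_nonneg hc.le (hG0 u)).trans (hcoer u)
  have hC0 : 0 ≤ C₁ + C₂ + C₃ := hsesq.nonneg
  refine ⟨⟨_, hsesq.bound⟩, ⟨min c 1, lt_min hc one_pos, hell⟩, ?_⟩
  -- The sector constant is (C₁ + C₂ + C₃)/c, since |Im b(u,u)| ≤ (C₁ + C₂ + C₃) G(u) and c G(u) ≤
  -- Re b(u,u).
  have := exists_operator_of_form (J := J) (L := L) hJ hd (lt_min hc one_pos)
    (fun u => by rw [hL]; exact hell u) (C := (C₁ + C₂ + C₃) / c) (by positivity)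
    (fun u => by rw [hL]; exact hre u) fun u => by
      rw [hL, div_mul_eq_mul_div, le_div_iff₀ hc]
      refine (mul_le_mul_of_nonneg_right ((Complex.abs_im_le_norm _).trans (hbG u)) hc.le).trans ?_
      rw [mul_assoc, mul_comm (G u)]
      exact mul_le_mul_of_nonneg_left (hcoer u) hC0
  simpa only [hL] using this

theorem IsFormCoefficient.isBoundedSesquilinear {n : ℕ} {μ ν : Measure (Rd n)}
    {B : Rd n → Matrix (Fin (n + 1)) (Fin (n + 1)) ℝ} {C : ℝ≥0} (h : IsFormCoefficient μ ν B C) :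
    IsBoundedSesquilinear (block μ B : Lp (Cd n) 2 ν → Lp (Cd n) 2 ν → ℂ) C :=
  ⟨C.2, h.block_add_left, h.block_add_right, h.block_smul_left, h.block_smul_right,
    h.norm_block_le⟩

theorem BulkCoefficient.exists_isBoundedSesquilinear {n : ℕ} {Ω : Set (Rd n)}
    (hΩ : MeasurableSet Ω) {B : Rd n → Matrix (Fin (n + 1)) (Fin (n + 1)) ℝ}
    (hB : BulkCoefficient Ω B) :
    ∃ C, IsBoundedSesquilinear (E := Lp (Cd n) 2 (volume.restrict Ω))
      (block (volume.restrict Ω) B) C := by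
  obtain ⟨C, h⟩ := hB.exists_isFormCoefficient hΩ
  exact ⟨C, h.isBoundedSesquilinear⟩

theorem SurfaceCoefficient.exists_isBoundedSesquilinear {n : ℕ} {S : Set (Rd n)}
    (hS : MeasurableSet S) {B : Rd n → Matrix (Fin (n + 1)) (Fin (n + 1)) ℝ} {w : Rd n → ℝ}
    (hB : SurfaceCoefficient S B w) :
    ∃ C, IsBoundedSesquilinear (E := Lp (Cd n) 2 (weighted S w))
      (block ((surfaceMeasure n).restrict S) B) C := by
  obtain ⟨C, h⟩ := hB.exists_isFormCoefficient hS
  exact ⟨C, h.isBoundedSesquilinear⟩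

end

end DynBC

/-! ### The form on quadruples and its operator -/

namespace DynBC

noncomputable section

/-- The operator associated with a form on a space of quadruples that is a sum of forms of the last
three components. -/
theorem exists_operator_of_quadruples {X V H E₀ E₁ E₂ E₃ : Type*}
    [NormedAddCommGroup V] [InnerProductSpace ℂ V] [CompleteSpace V]
    [NormedAddCommGroup H] [InnerProductSpace ℂ H] [CompleteSpace H]
    [NormedAddCommGroup E₀] [NormedSpace ℂ E₀] [NormedAddCommGroup E₁] [NormedSpace ℂ E₁]
    [NormedAddCommGroup E₂] [NormedSpace ℂ E₂] [NormedAddCommGroup E₃] [NormedSpace ℂ E₃]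
    (ι : V →ₗᵢ[ℂ] WithLp 2 (WithLp 2 (E₀ × E₁) × WithLp 2 (E₂ × E₃)))
    {b₁ : E₁ → E₁ → ℂ} {b₂ : E₂ → E₂ → ℂ} {b₃ : E₃ → E₃ → ℂ}
    (h₁ : ∃ C, IsBoundedSesquilinear b₁ C) (h₂ : ∃ C, IsBoundedSesquilinear b₂ C)
    (h₃ : ∃ C, IsBoundedSesquilinear b₃ C) {e : X → V} (he : DenseRange e)
    (k₁ : ∃ c, 0 < c ∧ ∀ x, c * ‖(ι (e x)).fst.snd‖ ^ 2 ≤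
      (b₁ (ι (e x)).fst.snd (ι (e x)).fst.snd).re)
    (k₂ : ∃ c, 0 < c ∧ ∀ x, c * ‖(ι (e x)).snd.fst‖ ^ 2 ≤
      (b₂ (ι (e x)).snd.fst (ι (e x)).snd.fst).re)
    (k₃ : ∃ c, 0 < c ∧ ∀ x, c * ‖(ι (e x)).snd.snd‖ ^ 2 ≤
      (b₃ (ι (e x)).snd.snd (ι (e x)).snd.snd).re)
    {J : V →L[ℂ] H} (hJ : IsCompactOperator J) (hd : DenseRange J)
    (hJP : ∀ x, ‖(ι (e x)).fst.fst‖ ≤ ‖J (e x)‖) {b : V → V → ℂ}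
    (hb : ∀ u v, b u v = b₁ (ι u).fst.snd (ι v).fst.snd + b₂ (ι u).snd.fst (ι v).snd.fst +
      b₃ (ι u).snd.snd (ι v).snd.snd) :
    (∃ C : ℝ, ∀ u v, ‖b u v‖ ≤ C * ‖u‖ * ‖v‖) ∧
    (∃ c : ℝ, 0 < c ∧ ∀ u, c * ‖u‖ ^ 2 ≤ (b u u).re + ‖J u‖ ^ 2) ∧
    ∃ A : H →ₗ.[ℂ] H, A.IsClosed ∧ Dense (A.domain : Set H) ∧
      (∀ φ ψ : H, (φ, ψ) ∈ A.graph ↔ ∃ u, φ = J u ∧ ∀ v, inner ℂ (J v) ψ = b u v) ∧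
      (∃ T : ℝ → H →L[ℂ] H,
        IsAnalyticSemigroup T ∧ (∀ t, 0 ≤ t → ‖T t‖ ≤ 1) ∧ IsGenerator (-A) T) ∧
      HasCompactResolvent A := by
  obtain ⟨P₀, hP₀⟩ : ∃ P : V →L[ℂ] E₀, ∀ u, P u = (ι u).fst.fst :=
    ⟨(WithLp.fstL 2 ℂ E₀ E₁).comp ((WithLp.fstL 2 ℂ (WithLp 2 (E₀ × E₁))
      (WithLp 2 (E₂ × E₃))).comp ι.toContinuousLinearMap), fun _ => rfl⟩
  obtain ⟨P₁, hP₁⟩ : ∃ P : V →L[ℂ] E₁, ∀ u, P u = (ι u).fst.snd :=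
    ⟨(WithLp.sndL 2 ℂ E₀ E₁).comp ((WithLp.fstL 2 ℂ (WithLp 2 (E₀ × E₁))
      (WithLp 2 (E₂ × E₃))).comp ι.toContinuousLinearMap), fun _ => rfl⟩
  obtain ⟨P₂, hP₂⟩ : ∃ P : V →L[ℂ] E₂, ∀ u, P u = (ι u).snd.fst :=
    ⟨(WithLp.fstL 2 ℂ E₂ E₃).comp ((WithLp.sndL 2 ℂ (WithLp 2 (E₀ × E₁))
      (WithLp 2 (E₂ × E₃))).comp ι.toContinuousLinearMap), fun _ => rfl⟩
  obtain ⟨P₃, hP₃⟩ : ∃ P : V →L[ℂ] E₃, ∀ u, P u = (ι u).snd.snd :=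
    ⟨(WithLp.sndL 2 ℂ E₂ E₃).comp ((WithLp.sndL 2 ℂ (WithLp 2 (E₀ × E₁))
      (WithLp 2 (E₂ × E₃))).comp ι.toContinuousLinearMap), fun _ => rfl⟩
  have hP : ∀ u, ‖u‖ ^ 2 = ‖P₀ u‖ ^ 2 + ‖P₁ u‖ ^ 2 + (‖P₂ u‖ ^ 2 + ‖P₃ u‖ ^ 2) := fun u => by
    rw [hP₀, hP₁, hP₂, hP₃, ← ι.norm_map, WithLp.prod_norm_sq_eq_of_L2,
      WithLp.prod_norm_sq_eq_of_L2, WithLp.prod_norm_sq_eq_of_L2]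
  simp only [← hP₀, ← hP₁, ← hP₂, ← hP₃] at k₁ k₂ k₃ hJP hb
  exact exists_operator_of_blocks hP h₁ h₂ h₃ he k₁ k₂ k₃ hJ hd hJP hb

namespace Data

variable {n : ℕ} {D : Data n}

theorem Geometric.isTraceMap (hgeo : D.Geometric) (hcoeff : D.Coefficients)
    {J : D.FormDomain →L[ℂ] D.L2} (hJe : ∀ u, J (hgeo.embed hcoeff u) = hgeo.toLpMeasure u) :
    D.IsTraceMap J := fun u hu =>
  ⟨hgeo.embed hcoeff ⟨u, hu⟩, hgeo.represents_quadruple hcoeff ⟨u, hu⟩,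
    (congrArg (fun f : D.L2 => (f : Rd n → ℂ)) (hJe ⟨u, hu⟩)).eventuallyEq.trans
      (hgeo.coeFn_toLpMeasure ⟨u, hu⟩)⟩

theorem Geometric.denseRange_traceMap (hgeo : D.Geometric) (hcoeff : D.Coefficients)
    {J : D.FormDomain →L[ℂ] D.L2} (hJe : ∀ u, J (hgeo.embed hcoeff u) = hgeo.toLpMeasure u) :
    DenseRange J := by
  refine hgeo.denseRange_toLpMeasure.mono ?_
  rintro _ ⟨u, rfl⟩
  exact ⟨_, hJe u⟩

theorem Geometric.exists_operator (hgeo : D.Geometric) (hcoeff : D.Coefficients)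
    {J : D.FormDomain →L[ℂ] D.L2} (hJe : ∀ u, J (hgeo.embed hcoeff u) = hgeo.toLpMeasure u)
    (hJ : IsCompactOperator J) :
    (∃ C : ℝ, ∀ u v : D.FormDomain, ‖D.form u v‖ ≤ C * ‖u‖ * ‖v‖) ∧
    (∃ c : ℝ, 0 < c ∧ ∀ u : D.FormDomain, c * ‖u‖ ^ 2 ≤ (D.form u u).re + ‖J u‖ ^ 2) ∧
    ∃ A : D.L2 →ₗ.[ℂ] D.L2,
      A.IsClosed ∧ Dense (A.domain : Set D.L2) ∧
      (∀ φ ψ : D.L2, (φ, ψ) ∈ A.graph ↔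
        ∃ u : D.FormDomain, φ = J u ∧ ∀ v : D.FormDomain, inner ℂ (J v) ψ = D.form u v) ∧
      (∃ T : ℝ → D.L2 →L[ℂ] D.L2,
        IsAnalyticSemigroup T ∧ (∀ t, 0 ≤ t → ‖T t‖ ≤ 1) ∧ IsGenerator (-A) T) ∧
      HasCompactResolvent A := by
  -- The inclusion of dom(t) into the space of quadruples is isometric, and t is by definition the
  -- sum of the three blocks.
  have h := exists_operator_of_quadruples D.core.topologicalClosure.subtypeₗᵢ (J := J)
    (e := hgeo.embed hcoeff)
    (hcoeff.bulk.exists_isBoundedSesquilinear hgeo.measurableSet)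
    (hcoeff.boundary.exists_isBoundedSesquilinear hgeo.isTraceSet_Γd.measurableSet)
    (hcoeff.interface.exists_isBoundedSesquilinear hgeo.isTraceSet_Sg.measurableSet)
  have h := h (hgeo.denseRange_embed hcoeff)
  have h := h ((hcoeff.bulk.exists_le_re_block hgeo.measurableSet).imp fun _ h =>
      ⟨h.1, fun u => h.2 (hgeo.quadruple hcoeff u).fst.snd⟩)
    ((hcoeff.boundary.exists_le_re_block hgeo.isTraceSet_Γd.measurableSet).imp fun _ h =>
      ⟨h.1, fun u => h.2 (hgeo.quadruple hcoeff u).snd.fst u.1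
        (hgeo.represents_quadruple hcoeff u).2.2.1⟩)
    ((hcoeff.interface.exists_le_re_block hgeo.isTraceSet_Sg.measurableSet).imp fun _ h =>
      ⟨h.1, fun u => h.2 (hgeo.quadruple hcoeff u).snd.snd u.1
        (hgeo.represents_quadruple hcoeff u).2.2.2⟩)
  have h := h hJ (hgeo.denseRange_traceMap hcoeff hJe)
    (fun u => (hgeo.norm_bulk_le u).trans_eq (congrArg norm (hJe u).symm)) (b := D.form)
    (fun _ _ => rfl)
  exact ⟨h.1, h.2.1, h.2.2⟩

end Data

end

end DynBC

theorem proposition4p5 {n : ℕ} (hn : 1 ≤ n) (D : DynBC.Data n)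
    (hgeo : D.Geometric) (hcoeff : D.Coefficients) :
    ∃ J : D.FormDomain →L[ℂ] D.L2,
      D.IsTraceMap J ∧ IsCompactOperator J ∧ DenseRange J ∧
      (∃ C : ℝ, ∀ u v : D.FormDomain, ‖D.form u v‖ ≤ C * ‖u‖ * ‖v‖) ∧
      (∃ c : ℝ, 0 < c ∧ ∀ u : D.FormDomain, c * ‖u‖ ^ 2 ≤ (D.form u u).re + ‖J u‖ ^ 2) ∧
      ∃ A : D.L2 →ₗ.[ℂ] D.L2,
        A.IsClosed ∧ Dense (A.domain : Set D.L2) ∧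
        (∀ φ ψ : D.L2, (φ, ψ) ∈ A.graph ↔
          ∃ u : D.FormDomain, φ = J u ∧ ∀ v : D.FormDomain, inner ℂ (J v) ψ = D.form u v) ∧
        (∃ T : ℝ → D.L2 →L[ℂ] D.L2,
          DynBC.IsAnalyticSemigroup T ∧ (∀ t, 0 ≤ t → ‖T t‖ ≤ 1) ∧ DynBC.IsGenerator (-A) T) ∧
        DynBC.HasCompactResolvent A := by
  exact (hgeo.exists_traceMap hcoeff).imp fun _ hJ => ⟨hgeo.isTraceMap hcoeff hJ.1, hJ.2,
    hgeo.denseRange_traceMap hcoeff hJ.1, hgeo.exists_operator hcoeff hJ.1 hJ.2⟩
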